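/- **Setting.** Let $V$ be a finite-dimensional real vector space with a lattice $\Lambda$, dual lattice $\Lambda^*\subset V^*$, let $L\subseteq V$ be a rational subspace (i.e. $L\cap\Lambda$ is a lattice in $L$), let $\Lambda_{V/L}$ be the image of $\Lambda$ in $V/L$, and let $\mathfrak c\subseteq V$ be a full-dimensional rational polyhedral cone with vertex $0$ (a finite intersection of halfspaces $\{\eta\ge 0\}$ with $\eta\in\Lambda^*$; it may contain lines). *Generating functions.* Let $\mathcal M_\ell(V^*)$ be the ring of meromorphic functions near $0\in V^*_{\mathbb C}$ of the form $h(\xi)/\prod_{j}\langle\xi,w_j\rangle$ with $h$ holomorphic near $0$ and finitely many $0\ne w_j\in V$. For $s\in V$, $S^L(s+\mathfrak c)\in\mathcal M_\ell(V^*)$ is the intermediate generating function of $s+\mathfrak c$: it is $0$ if $\mathfrak c$ contains a line, and otherwise it is the element of $\mathcal M_\ell(V^*)$ given by $$S^L(s+\mathfrak c)(\xi)=\sum_{y\in\Lambda_{V/L}}\int_{(s+\mathfrak c)\cap(y+L)}e^{\langle\xi,x\rangle}\,dx$$ for those $\xi$ near $0$, off the poles, for which this converges absolutely, where $dx$ is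 the Lebesgue measure on $y+L$ normalized by $L\cap\Lambda$. Put $M^L(s,\mathfrak c)(\xi)=e^{-\langle\xi,s\rangle}S^L(s+\mathfrak c)(\xi)$. For $\phi\in\mathcal M_\ell(V^*)$ and $m\in\mathbb Z$, the homogeneous component $\phi_{[m]}$ is the rational function defined by the Laurent expansion $\phi(\tau\xi)=\sum_{m\ge m_0}\tau^m\phi_{[m]}(\xi)$ in $\tau\in\mathbb C$. *Alcoves.* Congruences $\equiv$ between functions are modulo the span of the indicator functions of rational cones containing lines. Choose a decomposition $[\mathfrak c]\equiv\sum_i\epsilon_i[\mathfrak c_i]$, $\epsilon_i=\pm1$, where each $\mathfrak c_i$ is a full-dimensional simplicial rational cone with a face parallel to $L$, and for each $i$ a decomposition $[\mathfrak c_i']\equiv\sum_l\delta_{il}[\mathfrak u_{il}]$, $\delta_{il}=\pm1$, of the projection $\mathfrak c_i'$ of $\mathfrak c_i$ to $V/L$, where each $\mathfrak u_{il}$ is generated by a $\mathbb Z$-basis of $\Lambda_{V/L}$. Let $\Psi^L_{\mathfrak c}\subset\Lambda^*\cap L^\perp$ be the set of all elements of the dual bases of these $\mathbb Z$-bases. A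 $\Psi^L_{\mathfrak c}$-alcove is a connected component of the complement in $V$ of the union of the hyperplanes $\{x:\langle\eta,x\rangle=n\}$, $\eta\in\Psi^L_{\mathfrak c}$, $n\in\mathbb Z$. **Proposition.** Let $(v_j)_{j=1}^N$ be non-zero vectors in $V$ such that for every $s\in V$ the function $\prod_{j=1}^N\langle\xi,v_j\rangle\,S^L(s+\mathfrak c)(\xi)$ is holomorphic near $\xi=0$. Let $m\in\mathbb Z$, and let $W=\frac{1}{\prod_{j=1}^N v_j}\mathcal P_{[m+N]}(V^*)$ be the space of rational functions $P(\xi)/\prod_{j=1}^N\langle\xi,v_j\rangle$ with $P$ a homogeneous polynomial of degree $m+N$ with complex coefficients ($W=0$ if $m+N<0$). It is finite-dimensional, and: (i) For every choice of the decompositions defining $\Psi^L_{\mathfrak c}$, the restrictions of $s\mapsto M^L(s,\mathfrak c)_{[m]}$ and of $s\mapsto S^L(s+\mathfrak c)_{[m]}$ to any $\Psi^L_{\mathfrak c}$-alcove $\mathfrak a\subset V$ are polynomial functions of $s$ with values in $W$. (ii) For every $s\in V$, every $v\in L-\mathfrak c$ and every $\xi\in V^*_{\mathbb C}$ with $\prod_{j=1}^N\langle\xi,v_j\rangle\neq0$,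 $$\lim_{\substack{t\to0\\ t>0}}M^L(s+tv,\mathfrak c)_{[m]}(\xi)=M^L(s,\mathfrak c)_{[m]}(\xi).$$ -/

import Mathlib

open Filter Topology MeasureTheory Module
open scoped Pointwise

noncomputable section

namespace IntermediateSum

/-! ### Rational spaces, polyhedral cones, decompositions modulo cones with lines -/

section Algebraic

variable {V : Type*} [AddCommGroup V] [Module ℝ V]

/-- The dual lattice `Λ* ⊂ V*`: linear forms taking integral values on `Λ`. -/
def dualLattice (Λ : Submodule ℤ V) : Set (Dual ℝ V) :=
  {η | ∀ x ∈ Λ, ∃ n : ℤ, η x = n}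

/-- `L` is rational if `L ∩ Λ` is a lattice in `L`, i.e. spans `L`
(discreteness is inherited from `Λ`). -/
def IsRationalSubspace (Λ : Submodule ℤ V) (L : Submodule ℝ V) : Prop :=
  Submodule.span ℝ ((L : Set V) ∩ (Λ : Set V)) = L

/-- The projected lattice `Λ_{V/L}`, the image of `Λ` in `V/L`. -/
def projLattice (Λ : Submodule ℤ V) (L : Submodule ℝ V) : Submodule ℤ (V ⧸ L) :=
  Λ.map (L.mkQ.restrictScalars ℤ)

/-- A rational polyhedral cone with vertex `0`: a finite intersection of closed linear halfspaces
bounded by rational hyperplanes. It may contain lines and need not be full-dimensional. -/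
def IsRationalCone (Λ : Submodule ℤ V) (c : Set V) : Prop :=
  ∃ (n : ℕ) (η : Fin n → Dual ℝ V), (∀ i, η i ∈ dualLattice Λ) ∧ c = {x | ∀ i, 0 ≤ η i x}

/-- The set `p` contains an affine line. -/
def ContainsLine (p : Set V) : Prop :=
  ∃ x u : V, u ≠ 0 ∧ ∀ t : ℝ, x + t • u ∈ p

/-- The simplicial full-dimensional cone generated by a basis. -/
def basisCone {ι : Type*} (b : Basis ι ℝ V) : Set V :=
  {x | ∀ i, 0 ≤ b.repr x i}

/-- The indicator function `[p]`. -/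
def ind (p : Set V) : V → ℝ := p.indicator 1

/-- `f ≡ g` modulo the space spanned by the indicator functions of cones which contain lines. -/
def CongrModLines (Λ : Submodule ℤ V) (f g : V → ℝ) : Prop :=
  f - g ∈ Submodule.span ℝ {h : V → ℝ | ∃ q, IsRationalCone Λ q ∧ ContainsLine q ∧ h = ind q}

/-- `Ψ` is a set `Ψ^L_𝔠`, i.e. it is obtained as follows, for some choice of decompositions:
* `[𝔠] ≡ ∑ᵢ εᵢ [𝔠ᵢ]` modulo cones with lines, each `𝔠ᵢ` being a full-dimensional rational
  simplicial cone (generated by the basis `b i` of `V`, contained in `Λ`) with a face parallel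
  to `L`;
* for each `i`, the projection of `𝔠ᵢ` to `V/L` is decomposed as `∑ₗ δᵢₗ [𝔲ᵢₗ]` modulo cones with
  lines, each `𝔲ᵢₗ` being a full-dimensional cone which is unimodular with respect to the projected
  lattice (generated by the basis `u i l` of `Λ_{V/L}`);
* `Ψ` is the set of all the elements of the dual bases of the `u i l`, seen as linear forms
  on `V` which vanish on `L`. -/
def IsPsi (Λ : Submodule ℤ V) (L : Submodule ℝ V) (c : Set V) (Ψ : Set (Dual ℝ V)) : Prop :=
  ∃ (n : ℕ) (ε : Fin n → ℤˣ) (b : Fin n → Basis (Fin (finrank ℝ V)) ℝ V)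
    (k : Fin n → ℕ) (δ : ∀ i, Fin (k i) → ℤˣ)
    (u : ∀ i, Fin (k i) → Basis (Fin (finrank ℝ (V ⧸ L))) ℝ (V ⧸ L)),
    (∀ i j, b i j ∈ Λ) ∧
    (∀ i, ∃ I : Set (Fin (finrank ℝ V)), Submodule.span ℝ (b i '' I) = L) ∧
    CongrModLines Λ (ind c) (∑ i, ((ε i : ℤ) : ℝ) • ind (basisCone (b i))) ∧
    (∀ i l, Submodule.span ℤ (Set.range (u i l)) = projLattice Λ L) ∧
    (∀ i, CongrModLines (projLattice Λ L) (ind (L.mkQ '' basisCone (b i)))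
      (∑ l, ((δ i l : ℤ) : ℝ) • ind (basisCone (u i l)))) ∧
    Ψ = {η | ∃ i l j, η = (u i l).coord j ∘ₗ L.mkQ}

/-- The complement of the union of the hyperplanes `⟨η, x⟩ = n`, for `η ∈ Ψ` and `n ∈ ℤ`. -/
def alcoveDomain (Ψ : Set (Dual ℝ V)) : Set V :=
  {x | ∀ η ∈ Ψ, ∀ n : ℤ, η x ≠ n}

/-- A `Ψ`-alcove: a connected component of the complement of these hyperplanes. -/
def IsAlcove [TopologicalSpace V] (Ψ : Set (Dual ℝ V)) (a : Set V) : Prop :=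
  ∃ x ∈ alcoveDomain Ψ, a = connectedComponentIn (alcoveDomain Ψ) x

end Algebraic

/-! ### Meromorphic functions near `0` with hyperplane singularities -/

section Meromorphic

variable (V : Type*) [NormedAddCommGroup V] [NormedSpace ℝ V]

/-- The complexified dual space `V*_ℂ`: real-linear forms on `V` with complex values. -/
abbrev DualC : Type _ := V →L[ℝ] ℂ

/-- The filter on `V*_ℂ` generated by the sets
`U \ ⋃ⱼ {ξ | ⟨ξ, wⱼ⟩ = 0}` where `U` is a neighbourhood of `0` and `(wⱼ)` is a finite family of
non-zero elements of `V`. -/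
def genericNhds : Filter (DualC V) :=
  𝓝 0 ⊓ ⨅ w : {w : V // w ≠ 0}, 𝓟 {ξ : DualC V | ξ w.1 ≠ 0}

/-- Germs at `0 ∈ V*_ℂ` of functions defined outside finitely many hyperplanes. -/
abbrev GenGerm : Type _ := Germ (genericNhds V) ℂ

variable {V}

/-- `(∏ⱼ ⟨ξ, wⱼ⟩) φ(ξ) = h(ξ)` with `h` holomorphic near `0`. -/
def IsRep (φ : GenGerm V) {N : ℕ} (w : Fin N → V) (h : DualC V → ℂ) : Prop :=
  AnalyticAt ℂ h 0 ∧
    ((fun ξ : DualC V => ∏ j, ξ (w j) : DualC V → ℂ) : GenGerm V) * φ = (h : GenGerm V)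

/-- `(∏ⱼ ⟨ξ, vⱼ⟩) φ(ξ)` is holomorphic near `ξ = 0`. -/
def HolomorphicAfterMul {N : ℕ} (v : Fin N → V) (φ : GenGerm V) : Prop :=
  ∃ h : DualC V → ℂ, IsRep φ v h

/-- `φ` belongs to `ℳ_ℓ(V*)`: near `0` it is the quotient of a holomorphic function by a finite
product of linear forms `⟨ξ, wⱼ⟩`, `wⱼ ≠ 0`. -/
def IsMl (φ : GenGerm V) : Prop :=
  ∃ (N : ℕ) (w : Fin N → V), (∀ j, w j ≠ 0) ∧ HolomorphicAfterMul w φ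

/-- `τ ↦ φ(τ ξ)` has the Laurent expansion `∑_{m ≥ m₀} a_m τ^m` at `τ = 0`. Here `φ(τ ξ)` is
evaluated by means of any representation of `φ` as a quotient whose denominator does not vanish
at `ξ`. -/
def HasRayExpansion (φ : GenGerm V) (ξ : DualC V) (a : ℤ → ℂ) : Prop :=
  ∃ (N : ℕ) (w : Fin N → V) (h : DualC V → ℂ),
    IsRep φ w h ∧ (∀ j, ξ (w j) ≠ 0) ∧ (∃ m₀ : ℤ, ∀ m < m₀, a m = 0) ∧
    ∀ᶠ τ : ℂ in 𝓝[≠] 0,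
      HasSum (fun m : ℤ => τ ^ m * a m) (h (τ • ξ) / ∏ j, (τ • ξ) (w j))

open Classical in
/-- The homogeneous component `φ_[m]` of `φ ∈ ℳ_ℓ(V*)`: the value `φ_[m](ξ)` is the coefficient of
`τ^m` in the Laurent expansion of `τ ↦ φ(τ ξ)`. It is `0` by convention if the line `ℂ ξ` is
contained in the polar set of `φ`. -/
def homComp (φ : GenGerm V) (m : ℤ) (ξ : DualC V) : ℂ :=
  if h : ∃ a : ℤ → ℂ, HasRayExpansion φ ξ a then h.choose m else 0

/-- The exponential `ξ ↦ e^{⟨ξ, s⟩}`. -/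
def expGerm (s : V) : GenGerm V := ((fun ξ : DualC V => Complex.exp (ξ s) : DualC V → ℂ) : GenGerm V)

end Meromorphic

/-! ### Intermediate generating functions -/

section Generating

/-- The Lebesgue measure on `E` normalized by the lattice `Γ`, so that `E/Γ` has measure `1`. -/
def latticeMeasure {E : Type*} [NormedAddCommGroup E] [NormedSpace ℝ E] [FiniteDimensional ℝ E]
    [MeasurableSpace E] [BorelSpace E] (Γ : Submodule ℤ E) : Measure E :=
  (ENNReal.ofReal (ZLattice.covolume Γ Measure.addHaar))⁻¹ • Measure.addHaar

variable {V : Type*} [NormedAddCommGroup V] [NormedSpace ℝ V] [FiniteDimensional ℝ V]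
  [MeasurableSpace V] [BorelSpace V]

/-- The Lebesgue measure on `L` defined by the intersection lattice `L ∩ Λ`. -/
def subspaceMeasure (Λ : Submodule ℤ V) (L : Submodule ℝ V) : Measure L :=
  latticeMeasure (Λ.comap (L.subtype.restrictScalars ℤ))

/-- The function `x ↦ [p](x) e^{⟨ξ, x⟩}` on the affine subspace `y + L`, `y ∈ V/L`, which is
parametrized by `L` through the choice of a point in it. -/
def sliceFun {L : Submodule ℝ V} (p : Set V) (ξ : DualC V) (y : V ⧸ L) (x : L) : ℂ :=
  p.indicator (fun z => Complex.exp (ξ z)) (Quotient.out y + (x : V))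

/-- The sum over `y ∈ Λ_{V/L}` of the integrals of `e^{⟨ξ, x⟩}` over `p ∩ (y + L)`. -/
def sliceSum (Λ : Submodule ℤ V) (L : Submodule ℝ V) (p : Set V) (ξ : DualC V) : ℂ :=
  ∑' y : projLattice Λ L, ∫ x : L, sliceFun p ξ (y : V ⧸ L) x ∂(subspaceMeasure Λ L)

/-- The above sum of integrals converges (absolutely). -/
def SliceConverges (Λ : Submodule ℤ V) (L : Submodule ℝ V) (p : Set V) (ξ : DualC V) : Prop :=
  (∀ y : projLattice Λ L, Integrable (sliceFun p ξ (y : V ⧸ L)) (subspaceMeasure Λ L)) ∧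
    Summable (fun y : projLattice Λ L =>
      ∫ x : L, ‖sliceFun p ξ (y : V ⧸ L) x‖ ∂(subspaceMeasure Λ L))

/-- `φ ∈ ℳ_ℓ(V*)` is the meromorphic continuation to a neighbourhood of `0` of
`ξ ↦ ∑_{y ∈ Λ_{V/L}} ∫_{p ∩ (y + L)} e^{⟨ξ, x⟩} dx`. -/
def IsContinuation (Λ : Submodule ℤ V) (L : Submodule ℝ V) (p : Set V) (φ : GenGerm V) : Prop :=
  IsMl φ ∧ ∃ f : DualC V → ℂ, φ = (f : GenGerm V) ∧
    ∀ᶠ ξ in genericNhds V, SliceConverges Λ L p ξ → f ξ = sliceSum Λ L p ξ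

open Classical in
/-- The intermediate generating function `S^L_Λ(p) ∈ ℳ_ℓ(V*)` of a semi-rational polyhedron `p`:
it is `0` if `p` contains a line; otherwise the set of `ξ` for which the sum
`∑_{y ∈ Λ_{V/L}} ∫_{p ∩ (y + L)} e^{⟨ξ, x⟩} dx` converges has interior points arbitrarily close
to `0`, and `S^L_Λ(p)` is the unique element of `ℳ_ℓ(V*)` given by this sum wherever it
converges. -/
def genFun (Λ : Submodule ℤ V) (L : Submodule ℝ V) (p : Set V) : GenGerm V :=
  if ContainsLine p then 0
  else if h : ∃ φ, IsContinuation Λ L p φ then h.choose else 0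

/-- `S^L_Λ(s + 𝔠)`. -/
def SL (Λ : Submodule ℤ V) (L : Submodule ℝ V) (c : Set V) (s : V) : GenGerm V :=
  genFun Λ L (s +ᵥ c)

/-- `M^L_Λ(s, 𝔠)(ξ) = e^{-⟨ξ, s⟩} S^L_Λ(s + 𝔠)(ξ)`. -/
def ML (Λ : Submodule ℤ V) (L : Submodule ℝ V) (c : Set V) (s : V) : GenGerm V :=
  expGerm (-s) * SL Λ L c s

end Generating

/-! ### Polynomial functions and the finite-dimensional spaces of rational functions -/

section Polynomial

variable {V : Type*} [NormedAddCommGroup V] [NormedSpace ℝ V]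

/-- The algebra of polynomial functions on `V` (with complex coefficients), generated by the
linear forms. -/
def polyFun (V : Type*) [NormedAddCommGroup V] [NormedSpace ℝ V] : Subalgebra ℂ (V → ℂ) :=
  Algebra.adjoin ℂ (Set.range fun ζ : DualC V => (ζ : V → ℂ))

/-- `𝒫_[k](V*)`: homogeneous polynomial functions of degree `k` on `V*_ℂ`, spanned by the products
of `k` linear forms `ξ ↦ ⟨ξ, u⟩`, `u ∈ V`. It is `0` for `k < 0`. -/
def homPoly (V : Type*) [NormedAddCommGroup V] [NormedSpace ℝ V] (k : ℤ) :
    Submodule ℂ (DualC V → ℂ) :=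
  Submodule.span ℂ
    {P | ∃ (n : ℕ) (u : Fin n → V), (n : ℤ) = k ∧ P = fun ξ : DualC V => ∏ i, ξ (u i)}

/-- The set of `ξ ∈ V*_ℂ` outside the hyperplanes `⟨ξ, vⱼ⟩ = 0`. -/
abbrev Regular {N : ℕ} (v : Fin N → V) : Type _ := {ξ : DualC V // ∀ j, ξ (v j) ≠ 0}

/-- The space `(1 / ∏ⱼ vⱼ) 𝒫_[k](V*)` of the rational functions `P(ξ) / ∏ⱼ ⟨ξ, vⱼ⟩` with
`P ∈ 𝒫_[k](V*)`, seen as functions on the complement of the hyperplanes `⟨ξ, vⱼ⟩ = 0`. -/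
def fracSpace {N : ℕ} (v : Fin N → V) (k : ℤ) : Submodule ℂ (Regular v → ℂ) where
  carrier := {f | ∃ P ∈ homPoly V k, ∀ ξ : Regular v, f ξ = P ξ.1 / ∏ j, ξ.1 (v j)}
  add_mem' := by
    rintro f g ⟨P, hP, hf⟩ ⟨Q, hQ, hg⟩
    exact ⟨P + Q, add_mem hP hQ, fun ξ => by simp [hf, hg, add_div]⟩
  zero_mem' := ⟨0, zero_mem _, fun ξ => by simp⟩
  smul_mem' := by
    rintro r f ⟨P, hP, hf⟩
    exact ⟨r • P, Submodule.smul_mem _ r hP, fun ξ => by simp [hf, mul_div_assoc]⟩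

/-- The restriction of `f` to `a` is a polynomial function with values in the space `W`. -/
def IsPolynomialOn {E : Type*} [AddCommGroup E] [Module ℂ E] (a : Set V) (W : Submodule ℂ E)
    (f : V → E) : Prop :=
  ∃ (K : ℕ) (p : Fin K → V → ℂ) (w : Fin K → E),
    (∀ k, p k ∈ polyFun V) ∧ (∀ k, w k ∈ W) ∧ ∀ s ∈ a, f s = ∑ k, p k s • w k

end Polynomial

end IntermediateSum

end

noncomputable section

set_option linter.unusedSectionVars false
set_option linter.style.haveILetI false

namespace IntermediateSum

/-! Let μ_s be the sum of the Lebesgue measures of the slices y + L - s, for y in the projected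
lattice (`sliceMeasure`). It is invariant under Λ, so applying 1 - T_w with w ∈ Λ to a function
multiplies its exponential integral by 1 - e^{⟨ξ,w⟩}. For a rational cone, a suitable product of
such operators turns the indicator function into a bounded function g with bounded support
(`exists_list_bddSupp`). If c contains no line, it follows that M^L(s,c)(ξ) = ∫ g e^ξ dμ_s / ∏ (1 -
e^{⟨ξ,w⟩}) (`ML_eq`): an analytic numerator over a denominator independent of s. The identity
theorem shows that this is the only continuation. If c contains a line, everything is 0.

One-sided continuity: along a ray τξ, the component of degree m is a finite combination of the
moments ∫ g(x) ⟨ξ,x⟩^k dμ_s, with coefficients independent of s (`exists_homComp_ML_eq_sum`). Moving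
s along L does not change μ_s. Moving s by -tu with u ∈ c amounts to evaluating the integrand at x +
tu, and g(x + tu) = g(x) for small t > 0 because c is closed and stable under adding u. Dominated
convergence concludes (`tendsto_momentCoeff`).

Polynomiality: the same quotient defines a regularized integral (`IsExt`) even for cones with lines.
It does not depend on the operators used, it is linear, and it vanishes on cones with lines, since a
lattice translation along the line fixes the indicator function. Congruences modulo lines thus
become identities. For a simplicial cone with a face parallel to L, the half-open box splits into a
factor on L, independent of s, and a factor counting lattice points in V/L. The latter is rewritten
with unimodular cones, whose boxes contain exactly one point, found by rounding up the coordinates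
of s. Hence M is a finite sum of terms e^{⟨ξ,A_q(s)⟩} R_q(ξ) (`exists_regFun_eq_sum`). On an alcove
the ceilings are constant, so A_q is affine there; since R_q(τξ) has a pole of finite order, the
coefficient of τ^m is polynomial in s.

These arguments need ξ off finitely many extra hyperplanes. The holomorphy hypothesis puts the
components in the finite-dimensional space W (`homComp_mem_fracSpace`), and evaluations at generic
points span the dual of W (`span_evalOn_generic`), so both conclusions reach every ξ with ∏⟨ξ,v_j⟩ ≠
0. -/

/-! ### Difference operators and regularized exponential integrals -/

section Extension

variable {E : Type*} [NormedAddCommGroup E] [NormedSpace ℝ E]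

/-- The difference operator `∏_{w ∈ l} (1 - T_w)`, where `T_w f x = f (x - w)`. -/
def diffOp : List E → (E → ℂ) → E → ℂ
  | [], f => f
  | w :: l, f => fun x => diffOp l f x - diffOp l f (x - w)

lemma diffOp_add (l : List E) (f g : E → ℂ) : diffOp l (f + g) = diffOp l f + diffOp l g := by
  induction l with
  | nil => rfl
  | cons w l ih => funext x; simp only [diffOp, ih, Pi.add_apply]; ring

lemma diffOp_smul (l : List E) (r : ℂ) (f : E → ℂ) : diffOp l (r • f) = r • diffOp l f := by
  induction l with
  | nil => rfl
  | cons w l ih => funext x; simp only [diffOp, ih, Pi.smul_apply, smul_eq_mul]; ring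

lemma diffOp_append (l₁ l₂ : List E) (f : E → ℂ) :
    diffOp (l₁ ++ l₂) f = diffOp l₁ (diffOp l₂ f) := by
  induction l₁ with
  | nil => rfl
  | cons w l ih => funext x; simp only [List.cons_append, diffOp, ih]

lemma diffOp_perm {l₁ l₂ : List E} (h : l₁.Perm l₂) (f : E → ℂ) : diffOp l₁ f = diffOp l₂ f := by
  induction h with
  | nil => rfl
  | cons w _ ih => funext x; simp only [diffOp, ih]
  | swap a b l => funext x; simp only [diffOp, sub_right_comm x a b]; ring
  | trans _ _ h₁ h₂ => rw [h₁, h₂]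

/-- Expanding the product of the 1 - T_w gives a signed sum of the values of `f` at `x` minus the
sums of sublists. -/
lemma diffOp_eq_zero (l : List E) (f : E → ℂ) (x : E)
    (h : ∀ l' : List E, l'.Sublist l → f (x - l'.sum) = 0) : diffOp l f x = 0 := by
  induction l generalizing x with
  | nil => simpa [diffOp] using h [] (List.Sublist.refl _)
  | cons w l ih =>
    have h₁ : diffOp l f x = 0 := ih x fun l' hl' => h l' (hl'.cons w)
    have h₂ : diffOp l f (x - w) = 0 := ih (x - w) fun l' hl' => by
      simpa [sub_sub] using h (w :: l') (hl'.cons_cons w)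
    simp only [diffOp, h₁, h₂, sub_zero]

variable [MeasurableSpace E]

/-- Bounded measurable functions with bounded support. -/
structure BddSupp (f : E → ℂ) : Prop where
  meas : Measurable f
  bdd : ∃ C : ℝ, ∀ x, ‖f x‖ ≤ C
  supp : ∃ R : ℝ, ∀ x, R < ‖x‖ → f x = 0

namespace BddSupp

lemma zero : BddSupp (0 : E → ℂ) := ⟨measurable_const, ⟨0, by simp⟩, 0, by simp⟩

lemma add {f g : E → ℂ} (hf : BddSupp f) (hg : BddSupp g) : BddSupp (f + g) := by
  obtain ⟨mf, ⟨C, hC⟩, R, hR⟩ := hf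
  obtain ⟨mg, ⟨D, hD⟩, S, hS⟩ := hg
  refine ⟨mf.add mg, ⟨C + D, fun x => (norm_add_le _ _).trans (add_le_add (hC x) (hD x))⟩,
    max R S, fun x hx => ?_⟩
  simp [hR x ((le_max_left _ _).trans_lt hx), hS x ((le_max_right _ _).trans_lt hx)]

lemma smul {f : E → ℂ} (r : ℂ) (hf : BddSupp f) : BddSupp (r • f) := by
  obtain ⟨mf, ⟨C, hC⟩, R, hR⟩ := hf
  refine ⟨mf.const_smul r, ⟨‖r‖ * C, fun x => ?_⟩, R, fun x hx => by simp [hR x hx]⟩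
  simpa using mul_le_mul_of_nonneg_left (hC x) (norm_nonneg r)

lemma translate [BorelSpace E] {f : E → ℂ} (w : E) (hf : BddSupp f) :
    BddSupp fun x => f (x - w) := by
  obtain ⟨mf, ⟨C, hC⟩, R, hR⟩ := hf
  refine ⟨mf.comp (continuous_sub_right w).measurable, ⟨C, fun x => hC _⟩, R + ‖w‖,
    fun x hx => hR _ ?_⟩
  have := norm_sub_norm_le x w
  linarith

lemma diffOp [BorelSpace E] {f : E → ℂ} (hf : BddSupp f) (l : List E) :
    BddSupp (diffOp l f) := by
  induction l with
  | nil => exact hf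
  | cons w l ih =>
    have := ih.add ((ih.translate w).smul (-1))
    convert this using 1
    funext x
    simp [IntermediateSum.diffOp, sub_eq_add_neg]

end BddSupp

/-- Measures which are invariant under translation by `Λ` and finite on bounded sets. -/
structure Adm (Λ : Submodule ℤ E) (μ : Measure E) : Prop where
  inv : ∀ w ∈ Λ, μ.map (fun x => x + w) = μ
  fin : ∀ R : ℝ, μ (Metric.closedBall 0 R) < ⊤

/-- The exponential integral `∫ f(x) e^{⟨ξ, x⟩} dμ(x)`. -/
def expInt (μ : Measure E) (ξ : DualC E) (f : E → ℂ) : ℂ := ∫ x, f x * Complex.exp (ξ x) ∂μ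

lemma BddSupp.integrable_mul [BorelSpace E] [FiniteDimensional ℝ E] {Λ : Submodule ℤ E}
    {μ : Measure E} (hμ : Adm Λ μ) {f : E → ℂ} (hf : BddSupp f) {g : E → ℂ} (hg : Continuous g) :
    Integrable (fun x => f x * g x) μ := by
  obtain ⟨mf, ⟨C, hC⟩, R, hR⟩ := hf
  haveI : ProperSpace E := FiniteDimensional.proper_real E
  obtain ⟨D, hD⟩ := (isCompact_closedBall (0 : E) R).exists_bound_of_continuousOn hg.continuousOn
  have hs : Function.support (fun x => f x * g x) ⊆ Metric.closedBall 0 R := by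
    intro x hx
    by_contra h
    rw [mem_closedBall_zero_iff, not_le] at h
    exact hx (by simp [hR x h])
  rw [← integrableOn_iff_integrable_of_support_subset hs]
  refine Measure.integrableOn_of_bounded (hμ.fin R).ne
    (mf.mul hg.measurable).aestronglyMeasurable (M := C * D) ?_
  refine (ae_restrict_iff' Metric.isClosed_closedBall.measurableSet).2 (Eventually.of_forall ?_)
  intro x hx
  rw [norm_mul]
  exact mul_le_mul (hC x) (hD x hx) (norm_nonneg _) ((norm_nonneg _).trans (hC x))

lemma BddSupp.integrable_exp [BorelSpace E] [FiniteDimensional ℝ E] {Λ : Submodule ℤ E}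
    {μ : Measure E} (hμ : Adm Λ μ) {f : E → ℂ} (hf : BddSupp f) (ξ : DualC E) :
    Integrable (fun x => f x * Complex.exp (ξ x)) μ :=
  hf.integrable_mul hμ (by fun_prop)

lemma expInt_add {μ : Measure E} {ξ : DualC E} {f g : E → ℂ}
    (hf : Integrable (fun x => f x * Complex.exp (ξ x)) μ)
    (hg : Integrable (fun x => g x * Complex.exp (ξ x)) μ) :
    expInt μ ξ (f + g) = expInt μ ξ f + expInt μ ξ g := by
  simp only [expInt, Pi.add_apply, add_mul]
  exact integral_add hf hg

lemma expInt_smul (μ : Measure E) (ξ : DualC E) (r : ℂ) (f : E → ℂ) :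
    expInt μ ξ (r • f) = r * expInt μ ξ f := by
  simp only [expInt, Pi.smul_apply, smul_eq_mul, mul_assoc]
  exact integral_const_mul _ _

variable [BorelSpace E] {Λ : Submodule ℤ E} {μ : Measure E}

lemma Adm.integrable_translate (hμ : Adm Λ μ) {w : E} (hw : w ∈ Λ) {ξ : DualC E} {f : E → ℂ}
    (hf : Integrable (fun x => f x * Complex.exp (ξ x)) μ) :
    Integrable (fun x => f (x - w) * Complex.exp (ξ x)) μ := by
  have he : MeasurableEmbedding fun x : E => x + w := (Homeomorph.addRight w).measurableEmbedding
  rw [← hμ.inv w hw, he.integrable_map_iff]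
  convert hf.const_mul (Complex.exp (ξ w)) using 1
  funext x
  simp only [Function.comp_apply, add_sub_cancel_right, map_add, Complex.exp_add]
  ring

lemma Adm.expInt_translate (hμ : Adm Λ μ) {w : E} (hw : w ∈ Λ) (ξ : DualC E) (f : E → ℂ) :
    expInt μ ξ (fun x => f (x - w)) = Complex.exp (ξ w) * expInt μ ξ f := by
  have he : MeasurableEmbedding fun x : E => x + w := (Homeomorph.addRight w).measurableEmbedding
  rw [expInt, expInt, ← integral_const_mul]
  conv_lhs => rw [← hμ.inv w hw]
  rw [he.integral_map]
  congr 1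
  funext x
  simp only [add_sub_cancel_right, map_add, Complex.exp_add]
  ring

/-- The product `∏_{w ∈ l} (1 - e^{⟨ξ, w⟩})`. -/
def expDen (l : List E) (ξ : DualC E) : ℂ := (l.map fun w => 1 - Complex.exp (ξ w)).prod

lemma expDen_append (l₁ l₂ : List E) (ξ : DualC E) :
    expDen (l₁ ++ l₂) ξ = expDen l₁ ξ * expDen l₂ ξ := by simp [expDen]

lemma expDen_ne_zero {l : List E} {ξ : DualC E} (h : ∀ w ∈ l, Complex.exp (ξ w) ≠ 1) :
    expDen l ξ ≠ 0 := by
  rw [expDen]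
  refine List.prod_ne_zero fun h0 => ?_
  obtain ⟨w, hw, h1⟩ := List.mem_map.1 h0
  exact h w hw (sub_eq_zero.1 h1).symm

/-- Invariance of μ turns each translation by w into the factor e^{⟨ξ,w⟩}. Only integrability is
needed, so this serves both genuine convergent integrals and functions that are already regularized.
-/
lemma Adm.integrable_diffOp (hμ : Adm Λ μ) {l : List E} (hl : ∀ w ∈ l, w ∈ Λ) {ξ : DualC E}
    {f : E → ℂ} (hf : Integrable (fun x => f x * Complex.exp (ξ x)) μ) :
    Integrable (fun x => diffOp l f x * Complex.exp (ξ x)) μ ∧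
      expInt μ ξ (diffOp l f) = expDen l ξ * expInt μ ξ f := by
  induction l with
  | nil => exact ⟨hf, by simp [diffOp, expDen]⟩
  | cons w l ih =>
    obtain ⟨h₁, h₂⟩ := ih fun w hw => hl w (List.mem_cons_of_mem _ hw)
    have hw : w ∈ Λ := hl w List.mem_cons_self
    have h₃ := hμ.integrable_translate hw h₁
    have h₄ := hμ.expInt_translate hw ξ (diffOp l f)
    constructor
    · simp only [diffOp, sub_mul]
      exact h₁.sub h₃
    · have : expInt μ ξ (diffOp (w :: l) f)
          = expInt μ ξ (diffOp l f) - expInt μ ξ (fun x => diffOp l f (x - w)) := by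
        simp only [expInt, diffOp, sub_mul]
        exact integral_sub h₁ h₃
      rw [this, h₄, h₂]
      simp only [expDen, List.map_cons, List.prod_cons]
      ring

/-- `z` is the regularized value of `∫ f(x) e^{⟨ξ, x⟩} dμ(x)`. -/
def IsExt (Λ : Submodule ℤ E) (μ : Measure E) (ξ : DualC E) (f : E → ℂ) (z : ℂ) : Prop :=
  ∃ l : List E, (∀ w ∈ l, w ∈ Λ ∧ Complex.exp (ξ w) ≠ 1) ∧ BddSupp (diffOp l f) ∧
    expInt μ ξ (diffOp l f) = expDen l ξ * z

variable [FiniteDimensional ℝ E] {ξ : DualC E} {f g : E → ℂ} {z z' : ℂ}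

lemma IsExt.append (hμ : Adm Λ μ) {l l' : List E} (hl' : ∀ w ∈ l', w ∈ Λ)
    (hb : BddSupp (diffOp l f)) (h : expInt μ ξ (diffOp l f) = expDen l ξ * z) :
    BddSupp (diffOp (l' ++ l) f) ∧ expInt μ ξ (diffOp (l' ++ l) f) = expDen (l' ++ l) ξ * z := by
  rw [diffOp_append, expDen_append]
  refine ⟨hb.diffOp l', ?_⟩
  rw [(hμ.integrable_diffOp hl' (hb.integrable_exp hμ ξ)).2, h, mul_assoc]

/-- Difference operators commute and preserve bounded support, so the concatenation of the two lists
works for both functions. -/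
lemma IsExt.common (hμ : Adm Λ μ) (h : IsExt Λ μ ξ f z) (h' : IsExt Λ μ ξ g z') :
    ∃ l : List E, (∀ w ∈ l, w ∈ Λ ∧ Complex.exp (ξ w) ≠ 1) ∧
      (BddSupp (diffOp l f) ∧ expInt μ ξ (diffOp l f) = expDen l ξ * z) ∧
      (BddSupp (diffOp l g) ∧ expInt μ ξ (diffOp l g) = expDen l ξ * z') := by
  obtain ⟨l, hl, hb, he⟩ := h
  obtain ⟨l', hl', hb', he'⟩ := h'
  refine ⟨l' ++ l, ?_, IsExt.append hμ (fun w hw => (hl' w hw).1) hb he, ?_⟩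
  · intro w hw
    rcases List.mem_append.1 hw with hw | hw
    exacts [hl' w hw, hl w hw]
  · have := IsExt.append hμ (fun w hw => (hl w hw).1) hb' he'
    have hp : (l ++ l').Perm (l' ++ l) := List.perm_append_comm
    have hd : expDen (l ++ l') ξ = expDen (l' ++ l) ξ := by
      rw [expDen_append, expDen_append, mul_comm]
    rwa [diffOp_perm hp, hd] at this

/-- With a common list, both values are the same integral divided by the same product, which is
non-zero because no e^{⟨ξ,w⟩} equals 1. -/
lemma IsExt.unique (hμ : Adm Λ μ) (h : IsExt Λ μ ξ f z) (h' : IsExt Λ μ ξ f z') : z = z' := by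
  obtain ⟨l, hl, ⟨_, h₁⟩, ⟨_, h₂⟩⟩ := h.common hμ h'
  exact mul_left_cancel₀ (expDen_ne_zero fun w hw => (hl w hw).2) (h₁.symm.trans h₂)

lemma IsExt.add (hμ : Adm Λ μ) (h : IsExt Λ μ ξ f z) (h' : IsExt Λ μ ξ g z') :
    IsExt Λ μ ξ (f + g) (z + z') := by
  obtain ⟨l, hl, ⟨b₁, h₁⟩, ⟨b₂, h₂⟩⟩ := h.common hμ h'
  refine ⟨l, hl, ?_, ?_⟩
  · rw [diffOp_add]; exact b₁.add b₂
  · rw [diffOp_add, expInt_add (b₁.integrable_exp hμ ξ) (b₂.integrable_exp hμ ξ), h₁, h₂, mul_add]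

lemma IsExt.smul (r : ℂ) (h : IsExt Λ μ ξ f z) : IsExt Λ μ ξ (r • f) (r * z) := by
  obtain ⟨l, hl, hb, h₁⟩ := h
  refine ⟨l, hl, ?_, ?_⟩
  · rw [diffOp_smul]; exact hb.smul r
  · rw [diffOp_smul, expInt_smul, h₁]; ring

lemma IsExt.zero : IsExt Λ μ ξ (0 : E → ℂ) 0 :=
  ⟨[], by simp, by simpa [diffOp] using BddSupp.zero, by simp [diffOp, expInt]⟩

lemma IsExt.sum (hμ : Adm Λ μ) {ι : Type*} (s : Finset ι) {F : ι → E → ℂ} {Z : ι → ℂ}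
    (h : ∀ i ∈ s, IsExt Λ μ ξ (F i) (Z i)) : IsExt Λ μ ξ (∑ i ∈ s, F i) (∑ i ∈ s, Z i) := by
  classical
  induction s using Finset.induction_on with
  | empty => simpa using IsExt.zero
  | insert a s ha ih =>
    rw [Finset.sum_insert ha, Finset.sum_insert ha]
    exact (h a (Finset.mem_insert_self _ _)).add hμ
      (ih fun i hi => h i (Finset.mem_insert_of_mem hi))

end Extension

/-! ### Lattice points in faces of rational cones -/

section Cones

variable {E : Type*} [NormedAddCommGroup E] [NormedSpace ℝ E] {Λ : Submodule ℤ E}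

/-- If η(e₀) ≠ 0 for a lattice vector e₀ of M, the map x ↦ η(e₀)x - η(x)e₀ sends lattice vectors of
M to lattice vectors of the kernel, and on the kernel it is multiplication by η(e₀). -/
lemma IsRationalSubspace.inf_ker {M : Submodule ℝ E} (hM : IsRationalSubspace Λ M)
    {η : Dual ℝ E} (hη : η ∈ dualLattice Λ) : IsRationalSubspace Λ (M ⊓ LinearMap.ker η) := by
  refine le_antisymm (Submodule.span_le.2 fun x hx => hx.1) ?_
  by_cases h0 : ∀ e ∈ (M : Set E) ∩ Λ, η e = 0
  · have hle : M ≤ LinearMap.ker η := by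
      rw [← hM, Submodule.span_le]
      exact h0
    rw [inf_eq_left.2 hle]
    exact hM.ge
  push Not at h0
  obtain ⟨e₀, ⟨he₀M, he₀Λ⟩, he₀⟩ := h0
  have key : ∀ x ∈ M, η e₀ • x - η x • e₀ ∈
      Submodule.span ℝ (((M ⊓ LinearMap.ker η : Submodule ℝ E) : Set E) ∩ Λ) := by
    intro x hx
    rw [← hM] at hx
    induction hx using Submodule.span_induction with
    | mem x hx =>
      obtain ⟨a, ha⟩ := hη e₀ he₀Λ
      obtain ⟨b, hb⟩ := hη x hx.2
      refine Submodule.subset_span ⟨⟨?_, ?_⟩, ?_⟩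
      · exact M.sub_mem (M.smul_mem _ hx.1) (M.smul_mem _ he₀M)
      · simp [LinearMap.mem_ker, mul_comm]
      · rw [ha, hb, Int.cast_smul_eq_zsmul, Int.cast_smul_eq_zsmul]
        exact Λ.sub_mem (Λ.smul_mem _ hx.2) (Λ.smul_mem _ he₀Λ)
    | zero => simp
    | add x y _ _ ihx ihy =>
      convert Submodule.add_mem _ ihx ihy using 1
      simp only [map_add, smul_add, add_smul]
      abel
    | smul r x _ ih =>
      convert Submodule.smul_mem _ r ih using 1
      simp only [map_smul, smul_eq_mul, smul_sub, smul_smul, mul_comm]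
  rintro x ⟨hxM, hx⟩
  have h := Submodule.smul_mem _ (η e₀)⁻¹ (key x hxM)
  have hx' : η x = 0 := hx
  rwa [hx', zero_smul, sub_zero, inv_smul_smul₀ he₀] at h

lemma isRationalSubspace_iInf_ker (hΛ : Submodule.span ℝ (Λ : Set E) = ⊤) {ι : Type*}
    (J : Finset ι) (η : ι → Dual ℝ E) (hη : ∀ i, η i ∈ dualLattice Λ) :
    ∃ M : Submodule ℝ E, IsRationalSubspace Λ M ∧ ∀ x, x ∈ M ↔ ∀ j ∈ J, η j x = 0 := by
  classical
  induction J using Finset.induction_on with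
  | empty => exact ⟨⊤, by simpa [IsRationalSubspace] using hΛ, by simp⟩
  | insert a J _ ih =>
    obtain ⟨M, hM, h⟩ := ih
    exact ⟨_, hM.inf_ker (hη a), fun x => by simp [h, and_comm]⟩

/-- Rational combinations of lattice vectors are dense in their real span, and clearing denominators
brings them into Λ. -/
lemma IsRationalSubspace.subset_closure {M : Submodule ℝ E} (hM : IsRationalSubspace Λ M) :
    (M : Set E) ⊆ closure {y | y ∈ M ∧ ∃ k : ℕ, 0 < k ∧ k • y ∈ Λ} := by
  intro x hx
  rw [SetLike.mem_coe, ← hM] at hx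
  induction hx using Submodule.span_induction with
  | mem x hx => exact _root_.subset_closure ⟨hx.1, 1, one_pos, by simpa using hx.2⟩
  | zero => exact _root_.subset_closure ⟨M.zero_mem, 1, one_pos, by simp⟩
  | add x y _ _ ihx ihy =>
    refine map_mem_closure₂ continuous_add ihx ihy ?_
    rintro a ⟨ha, k, hk, hka⟩ b ⟨hb, m, hm, hmb⟩
    refine ⟨M.add_mem ha hb, k * m, by positivity, ?_⟩
    rw [smul_add]
    refine Λ.add_mem ?_ ?_
    · rw [mul_comm k m, mul_smul]; exact Λ.nsmul_mem hka m
    · rw [mul_smul]; exact Λ.nsmul_mem hmb k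
  | smul r x _ ih =>
    refine map_mem_closure₂ (f := fun (t : ℝ) (y : E) => t • y) continuous_smul
      (Rat.denseRange_cast (𝕜 := ℝ) r) ih ?_
    rintro _ ⟨q, rfl⟩ b ⟨hb, m, hm, hmb⟩
    refine ⟨M.smul_mem _ hb, q.den * m, by have := q.den_pos; positivity, ?_⟩
    have : (q.den * m) • ((q : ℝ) • b) = q.num • (m • b) := by
      rw [← Nat.cast_smul_eq_nsmul ℝ, ← Nat.cast_smul_eq_nsmul ℝ, ← Int.cast_smul_eq_zsmul ℝ,
        smul_smul, smul_smul]
      congr 1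
      have h : (q : ℝ) * q.den = q.num := by exact_mod_cast Rat.mul_den_eq_num q
      push_cast
      rw [← h]
      ring
    rw [this]
    exact Λ.smul_mem _ hmb

/-- The polyhedral cone defined by the inequalities `η i ≥ 0`. -/
def coneOf {n : ℕ} (η : Fin n → Dual ℝ E) : Set E := {x | ∀ i, 0 ≤ η i x}

variable [FiniteDimensional ℝ E] {n : ℕ} {η : Fin n → Dual ℝ E}

lemma exists_lattice_mem_face (hΛ : Submodule.span ℝ (Λ : Set E) = ⊤)
    (hη : ∀ i, η i ∈ dualLattice Λ) {x : E} (hx : x ∈ coneOf η) (hx0 : x ≠ 0) :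
    ∃ w ∈ Λ, w ≠ 0 ∧ w ∈ coneOf η ∧ ∀ j, η j x = 0 → η j w = 0 := by
  classical
  obtain ⟨M, hM, hMm⟩ :=
    isRationalSubspace_iInf_ker hΛ (Finset.univ.filter fun j => η j x = 0) η hη
  have hxM : x ∈ M := (hMm x).2 fun j hj => (Finset.mem_filter.1 hj).2
  have hc : ∀ j, Continuous (η j) := fun j => (η j).continuous_of_finiteDimensional
  -- The inequalities strict at x are open conditions, while those that are equalities are kept
  -- exactly by staying in M. A rational point of M near x therefore satisfies all of them.
  have hU : {y | y ≠ 0} ∩ ⋂ j, {y | η j x ≠ 0 → 0 < η j y} ∈ 𝓝 x := by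
    refine inter_mem (isOpen_ne.mem_nhds hx0) (Filter.iInter_mem.2 fun j => ?_)
    by_cases h : η j x = 0
    · simp [h]
    · have : {y | 0 < η j y} ∈ 𝓝 x :=
        (isOpen_lt continuous_const (hc j)).mem_nhds (lt_of_le_of_ne (hx j) (Ne.symm h))
      exact mem_of_superset this fun y hy _ => hy
  obtain ⟨y, ⟨hy0, hy⟩, hyM, k, hk, hky⟩ := mem_closure_iff_nhds.1 (hM.subset_closure hxM) _ hU
  rw [hMm] at hyM
  simp only [Set.mem_iInter, Set.mem_ofPred_eq] at hy
  have hface : ∀ j, η j x = 0 → η j y = 0 := fun j hj => hyM j (by simp [hj])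
  refine ⟨k • y, hky, ?_, fun j => ?_, fun j hj => by simp [hface j hj]⟩
  · rw [← Nat.cast_smul_eq_nsmul ℝ]
    exact smul_ne_zero (by positivity) hy0
  · rw [map_nsmul]
    by_cases h : η j x = 0
    · simp [hface j h]
    · exact nsmul_nonneg (hy j h).le k

/-- Compactness of the unit sphere and homogeneity of degree 1. -/
lemma exists_pos_mul_norm_le {Φ : E → ℝ} (hc : Continuous Φ)
    (hs : ∀ (t : ℝ) (x : E), 0 ≤ t → Φ (t • x) = t * Φ x) (hp : ∀ x, x ≠ 0 → 0 < Φ x) :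
    ∃ δ > 0, ∀ x, δ * ‖x‖ ≤ Φ x := by
  have h0 : Φ 0 = 0 := by simpa using hs 0 0 le_rfl
  rcases subsingleton_or_nontrivial E with hE | hE
  · exact ⟨1, one_pos, fun x => by simp [Subsingleton.elim x 0, h0]⟩
  have : ProperSpace E := FiniteDimensional.proper_real E
  obtain ⟨x₀, hx₀, hmin⟩ := (isCompact_sphere (0 : E) 1).exists_isMinOn
    (NormedSpace.sphere_nonempty.2 zero_le_one) hc.continuousOn
  refine ⟨Φ x₀, hp x₀ ?_, fun x => ?_⟩
  · rintro rfl; simp at hx₀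
  · rcases eq_or_ne x 0 with rfl | hx
    · simp [h0]
    have hn : 0 < ‖x‖ := norm_pos_iff.2 hx
    have h1 : Φ x₀ ≤ Φ (‖x‖⁻¹ • x) :=
      hmin (by simp [norm_smul, hn.ne'])
    rw [hs _ _ (by positivity)] at h1
    calc Φ x₀ * ‖x‖ ≤ (‖x‖⁻¹ * Φ x) * ‖x‖ := by gcongr
      _ = Φ x := by field_simp

/-- The complex-valued indicator function. -/
def indC (q : Set E) (x : E) : ℂ := (ind q x : ℂ)

lemma indC_of_mem {q : Set E} {x : E} (h : x ∈ q) : indC q x = 1 := by simp [indC, ind, h]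

lemma indC_of_notMem {q : Set E} {x : E} (h : x ∉ q) : indC q x = 0 := by simp [indC, ind, h]

lemma norm_indC_le (q : Set E) (x : E) : ‖indC q x‖ ≤ 1 := by
  by_cases h : x ∈ q
  · simp [indC_of_mem h]
  · simp [indC_of_notMem h]

lemma isClosed_coneOf : IsClosed (coneOf η) := by
  have : coneOf η = ⋂ i, {x | 0 ≤ η i x} := by ext; simp [coneOf]
  rw [this]
  exact isClosed_iInter fun i =>
    isClosed_le continuous_const (η i).continuous_of_finiteDimensional

variable [MeasurableSpace E] [BorelSpace E]

lemma measurable_indC {q : Set E} (hq : IsClosed q) : Measurable (indC q) :=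
  Complex.measurable_ofReal.comp (measurable_one.indicator hq.measurableSet)

lemma measurable_diffOp {f : E → ℂ} (hf : Measurable f) (l : List E) :
    Measurable (diffOp l f) := by
  induction l with
  | nil => exact hf
  | cons w l ih => exact ih.sub (ih.comp (continuous_sub_right w).measurable)

lemma bounded_diffOp {f : E → ℂ} (hf : ∃ C : ℝ, ∀ x, ‖f x‖ ≤ C) (l : List E) :
    ∃ C : ℝ, ∀ x, ‖diffOp l f x‖ ≤ C := by
  induction l with
  | nil => exact hf
  | cons w l ih =>
    obtain ⟨C, hC⟩ := ih
    exact ⟨C + C, fun x => (norm_sub_le _ _).trans (add_le_add (hC _) (hC _))⟩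

/-- The list contains a non-zero lattice vector of each non-trivial face. A point of the cone far
from the origin is near such a face relative to the other walls, so the difference along the vector
of that face cancels there. The cone may contain lines. -/
lemma exists_list_bddSupp (hΛ : Submodule.span ℝ (Λ : Set E) = ⊤)
    (hη : ∀ i, η i ∈ dualLattice Λ) :
    ∃ l : List E, (∀ w ∈ l, w ∈ Λ ∧ w ≠ 0) ∧ BddSupp (diffOp l (indC (coneOf η))) := by
  classical
  set P : Finset (Fin n) → Prop := fun J => ∃ x ∈ coneOf η, x ≠ 0 ∧ ∀ j ∈ J, η j x = 0 with hP
  have hex : ∀ J, ∃ w : E, P J → w ∈ Λ ∧ w ≠ 0 ∧ w ∈ coneOf η ∧ ∀ j ∈ J, η j w = 0 := by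
    intro J
    by_cases h : P J
    · obtain ⟨x, hx, hx0, hJ⟩ := h
      obtain ⟨w, h1, h2, h3, h4⟩ := exists_lattice_mem_face hΛ hη hx hx0
      exact ⟨w, fun _ => ⟨h1, h2, h3, fun j hj => h4 j (hJ j hj)⟩⟩
    · exact ⟨0, fun h' => absurd h' h⟩
  choose W hW using hex
  set l : List E := ((Finset.univ.filter P).toList).map W with hl
  have hlm : ∀ w ∈ l, ∃ J, P J ∧ W J = w := by
    intro w hw
    obtain ⟨J, hJ, rfl⟩ := List.mem_map.1 hw
    exact ⟨J, by simpa using hJ, rfl⟩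
  have hlc : ∀ w ∈ l, w ∈ coneOf η := by
    intro w hw
    obtain ⟨J, hJ, rfl⟩ := hlm w hw
    exact (hW J hJ).2.2.1
  have hsum : ∀ l' : List E, l'.Sublist l → ∀ j, 0 ≤ η j l'.sum ∧ η j l'.sum ≤ η j l.sum := by
    intro l' hl' j
    rw [map_list_sum, map_list_sum]
    refine ⟨List.sum_nonneg fun a ha => ?_, (hl'.map _).sum_le_sum fun a ha => ?_⟩
    · obtain ⟨w, hw, rfl⟩ := List.mem_map.1 ha
      exact hlc w (hl'.subset hw) j
    · obtain ⟨w, hw, rfl⟩ := List.mem_map.1 ha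
      exact hlc w hw j
  refine ⟨l, fun w hw => ?_, measurable_diffOp (measurable_indC isClosed_coneOf) l,
    bounded_diffOp ⟨1, norm_indC_le _⟩ l, ?_⟩
  · obtain ⟨J, hJ, rfl⟩ := hlm w hw
    exact ⟨(hW J hJ).1, (hW J hJ).2.1⟩
  -- A uniform bound for the points which are close to a trivial face
  have hb : ∀ J : Finset (Fin n), ∃ R : ℝ, ¬ P J → ∀ x ∈ coneOf η,
      (∀ j ∈ J, η j x ≤ η j l.sum) → ‖x‖ ≤ R := by
    intro J
    by_cases h : P J
    · exact ⟨0, fun h' => absurd h h'⟩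
    -- The second sum vanishes exactly on the cone, so a non-zero zero of Φ would be a non-zero
    -- point of the face cut out by J, contrary to the assumption on J.
    obtain ⟨δ, hδ, hle⟩ := exists_pos_mul_norm_le
      (Φ := fun x => ∑ j ∈ J, |η j x| + ∑ j, max 0 (-η j x))
      (by
        have hc : ∀ j, Continuous (η j) := fun j => (η j).continuous_of_finiteDimensional
        have := hc
        fun_prop)
      (by
        intro t x ht
        simp only [map_smul, smul_eq_mul, abs_mul, abs_of_nonneg ht, mul_add, Finset.mul_sum]
        congr 1
        refine Finset.sum_congr rfl fun j _ => ?_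
        rw [← mul_neg, mul_max_of_nonneg _ _ ht, mul_zero])
      (by
        intro x hx
        have h1 : 0 ≤ ∑ j ∈ J, |η j x| := Finset.sum_nonneg fun _ _ => abs_nonneg _
        have h2 : 0 ≤ ∑ j, max 0 (-η j x) := Finset.sum_nonneg fun _ _ => le_max_left _ _
        refine lt_of_le_of_ne (add_nonneg h1 h2) fun h0 => h ?_
        have h1' : ∑ j ∈ J, |η j x| = 0 := by linarith
        have h2' : ∑ j, max 0 (-η j x) = 0 := by linarith
        rw [Finset.sum_eq_zero_iff_of_nonneg fun _ _ => abs_nonneg _] at h1'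
        rw [Finset.sum_eq_zero_iff_of_nonneg fun _ _ => le_max_left _ _] at h2'
        refine ⟨x, fun j => ?_, hx, fun j hj => abs_eq_zero.1 (h1' j hj)⟩
        have := max_eq_left_iff.1 (h2' j (Finset.mem_univ j))
        linarith)
    refine ⟨δ⁻¹ * ∑ j ∈ J, η j l.sum, fun _ x hx hxJ => ?_⟩
    rw [inv_mul_eq_div, le_div_iff₀ hδ, mul_comm]
    refine (hle x).trans ?_
    have h2 : ∑ j, max 0 (-η j x) = 0 :=
      Finset.sum_eq_zero fun j _ => max_eq_left (by simpa using hx j)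
    rw [h2, add_zero]
    exact Finset.sum_le_sum fun j hj => by rw [abs_of_nonneg (hx j)]; exact hxJ j hj
  choose R hR using hb
  refine ⟨∑ J, |R J|, fun x hx => ?_⟩
  by_cases hxc : x ∈ coneOf η
  -- J collects the walls that subtracting vectors of the list might cross; all the other walls stay
  -- strictly positive under every partial sum.
  · set J := Finset.univ.filter fun j => η j x ≤ η j l.sum with hJ
    have hPJ : P J := by
      by_contra hPJ
      have h1 : ‖x‖ ≤ R J := hR J hPJ x hxc fun j hj => (Finset.mem_filter.1 hj).2
      have h2 : |R J| ≤ ∑ J, |R J| :=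
        Finset.single_le_sum (f := fun J => |R J|) (fun _ _ => abs_nonneg _) (Finset.mem_univ J)
      linarith [le_abs_self (R J)]
    obtain ⟨-, -, hwc, hwJ⟩ := hW J hPJ
    have hwl : W J ∈ l := List.mem_map.2 ⟨J, by simpa using hPJ, rfl⟩
    have hp : l.Perm (W J :: l.erase (W J)) := List.perm_cons_erase hwl
    have hp' : l.Perm (l.erase (W J) ++ [W J]) :=
      hp.trans (List.perm_append_singleton _ _).symm
    -- With W J placed innermost, each term of the expansion compares the indicator function at two
    -- points differing by W J, and these lie in the cone simultaneously.
    rw [diffOp_perm hp', diffOp_append]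
    refine diffOp_eq_zero _ _ _ fun l' hl' => ?_
    have hs : (W J :: l').Subperm l :=
      ((List.Sublist.cons_cons (W J) hl').subperm).trans hp.symm.subperm
    obtain ⟨l'', hl'', hsub⟩ := hs
    have hsum' := hsum l'' hsub
    rw [hl''.sum_eq, List.sum_cons] at hsum'
    have hiff : x - l'.sum ∈ coneOf η ↔ x - l'.sum - W J ∈ coneOf η := by
      refine forall_congr' fun j => ?_
      by_cases hj : j ∈ J
      · simp [hwJ j hj]
      · have hj' : η j l.sum < η j x := by simpa [hJ] using hj
        have h3 := hsum' j
        rw [map_add] at h3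
        have h4 : 0 ≤ η j (W J) := hwc j
        simp only [map_sub]
        exact ⟨fun _ => by linarith, fun _ => by linarith⟩
    simp only [diffOp]
    by_cases h : x - l'.sum ∈ coneOf η
    · rw [indC_of_mem h, indC_of_mem (hiff.1 h), sub_self]
    · rw [indC_of_notMem h, indC_of_notMem (fun h' => h (hiff.2 h')), sub_self]
  · refine diffOp_eq_zero _ _ _ fun l' hl' => indC_of_notMem fun h => hxc fun j => ?_
    have h1 := h j
    have h2 := (hsum l' hl' j).1
    rw [map_sub] at h1
    linarith


/-! ### Cones with lines have vanishing regularized integrals -/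

lemma containsLine_coneOf_iff : ContainsLine (coneOf η) ↔ ∃ u, u ≠ 0 ∧ ∀ j, η j u = 0 := by
  constructor
  · rintro ⟨x, u, hu, h⟩
    refine ⟨u, hu, fun j => ?_⟩
    by_contra hj
    have h1 := h ((-1 - η j x) / η j u) j
    rw [map_add, map_smul, smul_eq_mul, div_mul_cancel₀ _ hj] at h1
    linarith
  · rintro ⟨u, hu, h⟩
    exact ⟨0, u, hu, fun t j => by simp [h j]⟩

/-- Functions whose regularized exponential integrals vanish for generic `ξ`. -/
def Negligible (Λ : Submodule ℤ E) (f : E → ℂ) : Prop :=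
  ∃ l : List E, (∀ w ∈ l, w ∈ Λ ∧ w ≠ 0) ∧ ∀ ξ : DualC E, (∀ w ∈ l, Complex.exp (ξ w) ≠ 1) →
    ∀ μ : Measure E, Adm Λ μ → IsExt Λ μ ξ f 0

/-- A rational cone with a line is invariant under translation by some non-zero lattice vector w, so
1 - T_w kills its indicator function. -/
lemma negligible_indC (hΛ : Submodule.span ℝ (Λ : Set E) = ⊤) {q : Set E}
    (hq : IsRationalCone Λ q) (hline : ContainsLine q) : Negligible Λ (indC q) := by
  obtain ⟨n, η, hη, rfl⟩ := hq
  obtain ⟨u, hu, huη⟩ := containsLine_coneOf_iff.1 hline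
  obtain ⟨w, hwΛ, hw0, -, hw⟩ :=
    exists_lattice_mem_face hΛ hη (x := u) (fun j => (huη j).ge) hu
  refine ⟨[w], by simp [hwΛ, hw0], fun ξ hξ μ _ => ⟨[w], by simpa [hwΛ] using hξ, ?_⟩⟩
  have h0 : diffOp [w] (indC {x | ∀ i, 0 ≤ η i x}) = 0 := by
    funext x
    simp [diffOp, indC, ind, Set.indicator, fun j => hw j (huη j)]
  rw [h0]
  exact ⟨BddSupp.zero, by simp [expInt]⟩

lemma CongrModLines.negligible (hΛ : Submodule.span ℝ (Λ : Set E) = ⊤) {f g : E → ℝ}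
    (h : CongrModLines Λ f g) : Negligible Λ (fun x => ((f x - g x : ℝ) : ℂ)) := by
  unfold CongrModLines at h
  change Negligible Λ (fun x => (((f - g) x : ℝ) : ℂ))
  generalize f - g = F at h
  induction h using Submodule.span_induction with
  | mem F hF =>
    obtain ⟨q, hq, hl, rfl⟩ := hF
    exact negligible_indC hΛ hq hl
  | zero =>
    refine ⟨[], by simp, fun ξ _ μ _ => ?_⟩
    convert IsExt.zero (Λ := Λ) (μ := μ) (ξ := ξ) using 1
    funext x
    simp
  | add F G _ _ ihF ihG =>
    obtain ⟨l, hl, h⟩ := ihF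
    obtain ⟨l', hl', h'⟩ := ihG
    refine ⟨l ++ l', fun w hw => ?_, fun ξ hξ μ hμ => ?_⟩
    · rcases List.mem_append.1 hw with hw | hw
      exacts [hl w hw, hl' w hw]
    · have := (h ξ (fun w hw => hξ w (List.mem_append_left _ hw)) μ hμ).add hμ
        (h' ξ (fun w hw => hξ w (List.mem_append_right _ hw)) μ hμ)
      rw [add_zero] at this
      convert this using 1
      funext x
      simp
  | smul r F _ ih =>
    obtain ⟨l, hl, h⟩ := ih
    refine ⟨l, hl, fun ξ hξ μ hμ => ?_⟩
    have := (h ξ hξ μ hμ).smul (r : ℂ)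
    rw [mul_zero] at this
    convert this using 1
    funext x
    simp

end Cones

/-- Round down in a lattice basis: the remainder lies in the fundamental parallelepiped, which is
bounded. -/
lemma exists_lattice_near {E : Type*} [NormedAddCommGroup E] [NormedSpace ℝ E]
    [FiniteDimensional ℝ E] (Λ : Submodule ℤ E) [DiscreteTopology Λ] [IsZLattice ℝ Λ] :
    ∃ R : ℝ, ∀ x : E, ∃ w : Λ, ‖x - w‖ ≤ R := by
  have : Module.Free ℤ Λ := ZLattice.module_free ℝ Λ
  have : Module.Finite ℤ Λ := ZLattice.module_finite ℝ Λ
  let b := (Module.Free.chooseBasis ℤ Λ)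
  let B := b.ofZLatticeBasis ℝ Λ
  refine ⟨∑ i, ‖B i‖, fun x => ?_⟩
  have hm : (ZSpan.floor B x : E) ∈ Λ := by
    exact (b.ofZLatticeBasis_span ℝ).le (ZSpan.floor B x).2
  exact ⟨⟨_, hm⟩, ZSpan.norm_fract_le B x⟩

/-! ### Analytic dependence of exponential integrals -/

section ExpInt

variable {E : Type*} [NormedAddCommGroup E] [NormedSpace ℝ E] [FiniteDimensional ℝ E]
  [MeasurableSpace E] [BorelSpace E] {Λ : Submodule ℤ E} {μ : Measure E}

/-- Restricting to a ball K that contains the support, ξ becomes an element of the Banach algebra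
C(K, ℂ) and integration against f a continuous functional on it. Analyticity in ξ and the Taylor
expansion along rays then come from the exponential of that algebra. -/
lemma exists_expInt_eq_clm_exp (hμ : Adm Λ μ) {f : E → ℂ} (hf : BddSupp f) :
    ∃ (K : Set E) (_ : CompactSpace K) (ρ : DualC E →L[ℂ] C(K, ℂ)) (ℓ : C(K, ℂ) →L[ℂ] ℂ),
      (∀ ξ, expInt μ ξ f = ℓ (NormedSpace.exp (ρ ξ))) ∧
      ∀ ξ (k : ℕ), ∫ x, f x * (ξ x) ^ k ∂μ = ℓ (ρ ξ ^ k) := by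
  have hint := fun (g : E → ℂ) (hg : Continuous g) => hf.integrable_mul hμ hg
  obtain ⟨mf, ⟨C, hC⟩, R, hR⟩ := hf
  have : ProperSpace E := FiniteDimensional.proper_real E
  set K : Set E := Metric.closedBall 0 R with hK
  have hcomp : IsCompact K := isCompact_closedBall 0 R
  haveI : CompactSpace K := isCompact_iff_compactSpace.1 hcomp
  have hKm : MeasurableSet K := Metric.isClosed_closedBall.measurableSet
  let ν : Measure K := μ.comap (Subtype.val)
  haveI : IsFiniteMeasure ν := ⟨by
    rw [comap_subtype_coe_apply hKm]
    simpa using hμ.fin R⟩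
  have hC0 : 0 ≤ C := (norm_nonneg _).trans (hC 0)
  have hgint : ∀ g : C(K, ℂ), Integrable (fun x : K => f x * g x) ν := by
    intro g
    refine Integrable.of_bound
      ((mf.comp measurable_subtype_coe).mul g.continuous.measurable).aestronglyMeasurable
      (C * ‖g‖) (Eventually.of_forall fun x => ?_)
    rw [norm_mul]
    exact mul_le_mul (hC x) (g.norm_coe_le_norm x) (norm_nonneg _) hC0
  let ℓ : C(K, ℂ) →L[ℂ] ℂ := LinearMap.mkContinuous
    { toFun := fun g => ∫ x : K, f x * g x ∂ν
      map_add' := fun g h => by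
        simp only [ContinuousMap.add_apply, mul_add]
        exact integral_add (hgint g) (hgint h)
      map_smul' := fun r g => by
        simp only [ContinuousMap.smul_apply, smul_eq_mul, RingHom.id_apply, mul_left_comm _ r]
        exact integral_const_mul _ _ } (C * ν.real Set.univ) (by
    intro g
    refine (norm_integral_le_of_norm_le_const (C := C * ‖g‖) (Eventually.of_forall fun x => ?_)).trans
      (le_of_eq (by ring))
    rw [norm_mul]
    exact mul_le_mul (hC x) (g.norm_coe_le_norm x) (norm_nonneg _) hC0)
  let ρ : DualC E →L[ℂ] C(K, ℂ) := LinearMap.mkContinuous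
    { toFun := fun ξ => ⟨fun x => ξ x, by fun_prop⟩
      map_add' := fun ξ ζ => rfl
      map_smul' := fun r ξ => rfl } |R| (by
    intro ξ
    refine (ContinuousMap.norm_le _ (by positivity)).2 fun x => ?_
    have hx : ‖(x : E)‖ ≤ |R| := (mem_closedBall_zero_iff.1 x.2).trans (le_abs_self R)
    calc ‖ξ x‖ ≤ ‖ξ‖ * ‖(x : E)‖ := ξ.le_opNorm _
      _ ≤ ‖ξ‖ * |R| := by gcongr
      _ = |R| * ‖ξ‖ := mul_comm _ _)
  have key : ∀ g : E → ℂ, ∫ x, f x * g x ∂μ = ∫ x : K, f x * g x ∂ν := by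
    intro g
    rw [integral_subtype_comap hKm (fun x => f x * g x), setIntegral_eq_integral_of_forall_compl_eq_zero]
    intro x hx
    rw [hR x (by simpa [hK] using hx), zero_mul]
  refine ⟨K, inferInstance, ρ, ℓ, fun ξ => ?_, fun ξ k => ?_⟩
  · rw [expInt, key]
    refine integral_congr_ae (Eventually.of_forall fun x => ?_)
    have h1 : NormedSpace.exp (ρ ξ) x = NormedSpace.exp (ρ ξ x) :=
      NormedSpace.map_exp (ContinuousMap.evalAlgHom ℂ ℂ x) (continuous_eval_const x) (ρ ξ)
    change f x * Complex.exp (ξ x) = f x * NormedSpace.exp (ρ ξ) x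
    rw [h1, ← Complex.exp_eq_exp_ℂ]
    rfl
  · rw [key]
    rfl

lemma BddSupp.analyticAt_expInt (hμ : Adm Λ μ) {f : E → ℂ} (hf : BddSupp f) (ξ₀ : DualC E) :
    AnalyticAt ℂ (fun ξ : DualC E => expInt μ ξ f) ξ₀ := by
  obtain ⟨K, _, ρ, ℓ, h, -⟩ := exists_expInt_eq_clm_exp hμ hf
  simp only [h]
  exact (ℓ.analyticAt _).comp ((NormedSpace.exp_analytic (𝕂 := ℂ) _).comp (ρ.analyticAt ξ₀))

lemma BddSupp.hasSum_expInt_smul (hμ : Adm Λ μ) {f : E → ℂ} (hf : BddSupp f) (ξ : DualC E)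
    (τ : ℂ) : HasSum (fun k : ℕ => τ ^ k * ((k.factorial : ℂ)⁻¹ * ∫ x, f x * (ξ x) ^ k ∂μ))
      (expInt μ (τ • ξ) f) := by
  obtain ⟨K, _, ρ, ℓ, h, h'⟩ := exists_expInt_eq_clm_exp hμ hf
  rw [h]
  convert ℓ.hasSum (NormedSpace.exp_series_hasSum_exp' (𝕂 := ℂ) (ρ (τ • ξ))) using 2 with k
  rw [h', map_smul, map_smul, smul_pow, map_smul, smul_eq_mul, smul_eq_mul]
  ring

lemma summable_exp_neg_mul_norm [DiscreteTopology Λ] {δ : ℝ} (hδ : 0 < δ) :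
    Summable fun w : Λ => Real.exp (-(δ * ‖(w : E)‖)) := by
  -- Any exponent above the rank makes ∑ ‖w‖^{-n} converge, and e^{-t} ≤ n!/tⁿ.
  set n := finrank ℤ Λ + 1 with hn
  have hs := ((ZLattice.summable_norm_pow_inv Λ n (by omega)).mul_left
    ((n.factorial : ℝ) * (δ ^ n)⁻¹))
  refine Summable.of_norm_bounded_eventually hs ?_
  have : ∀ᶠ w : Λ in cofinite, w ≠ 0 := by simp [eventually_cofinite]
  filter_upwards [this] with w hw
  have hw' : 0 < ‖(w : E)‖ := norm_pos_iff.2 (by simpa using hw)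
  rw [Real.norm_of_nonneg (Real.exp_pos _).le, Real.exp_neg]
  have h1 := Real.pow_div_factorial_le_exp (δ * ‖(w : E)‖) (by positivity) n
  have h2 : ((n.factorial : ℝ) * (δ ^ n)⁻¹) * (‖w‖ ^ n)⁻¹
      = ((δ * ‖(w : E)‖) ^ n / n.factorial)⁻¹ := by
    rw [mul_pow, inv_div]
    field_simp
    rfl
  rw [inv_pow, h2]
  exact inv_anti₀ (by positivity) h1

/-- Balls of one radius about the lattice points cover the space and have equal mass by invariance,
so the integral is dominated by a convergent lattice sum. -/
lemma Adm.integrable_exp_neg_mul_norm [DiscreteTopology Λ] [IsZLattice ℝ Λ] (hμ : Adm Λ μ)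
    {δ : ℝ} (hδ : 0 < δ) : Integrable (fun x => Real.exp (-(δ * ‖x‖))) μ := by
  refine ⟨by fun_prop, ?_⟩
  obtain ⟨R, hR⟩ := exists_lattice_near Λ
  have : Countable Λ := inferInstance
  have hcov : (⋃ w : Λ, Metric.closedBall (w : E) R) = Set.univ :=
    Set.eq_univ_of_forall fun x => by
      obtain ⟨w, hw⟩ := hR x
      exact Set.mem_iUnion.2 ⟨w, by rwa [Metric.mem_closedBall, dist_eq_norm]⟩
  have hball : ∀ w : Λ, μ (Metric.closedBall (w : E) R) = μ (Metric.closedBall 0 R) := by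
    intro w
    have he : MeasurableEmbedding fun x : E => x + w :=
      (Homeomorph.addRight (w : E)).measurableEmbedding
    conv_lhs => rw [← hμ.inv w w.2, he.map_apply]
    congr 1
    ext x
    simp
  rw [HasFiniteIntegral, ← setLIntegral_univ, ← hcov]
  refine (lintegral_iUnion_le _ _).trans_lt ?_
  have hle : ∀ w : Λ, ∫⁻ x in Metric.closedBall (w : E) R, ‖Real.exp (-(δ * ‖x‖))‖ₑ ∂μ ≤
      ENNReal.ofReal (Real.exp (-(δ * ‖(w : E)‖))) *
        (ENNReal.ofReal (Real.exp (δ * R)) * μ (Metric.closedBall 0 R)) := by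
    intro w
    rw [← mul_assoc, ← ENNReal.ofReal_mul (Real.exp_pos _).le, ← hball w, ← Real.exp_add]
    refine (setLIntegral_mono' Metric.isClosed_closedBall.measurableSet
      (g := fun _ => ENNReal.ofReal (Real.exp (-(δ * ‖(w : E)‖) + δ * R)))
      fun x hx => ?_).trans (setLIntegral_const _ _).le
    rw [Real.enorm_eq_ofReal (Real.exp_pos _).le]
    refine ENNReal.ofReal_le_ofReal (Real.exp_le_exp.2 ?_)
    have h1 : ‖(w : E)‖ ≤ ‖x‖ + R := by
      have h2 := norm_sub_norm_le (w : E) x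
      rw [Metric.mem_closedBall', dist_eq_norm] at hx
      linarith
    nlinarith
  refine (ENNReal.tsum_le_tsum hle).trans_lt ?_
  rw [ENNReal.tsum_mul_right]
  refine ENNReal.mul_lt_top ?_ (ENNReal.mul_lt_top ENNReal.ofReal_lt_top (hμ.fin R))
  exact (summable_exp_neg_mul_norm hδ).tsum_ofReal_lt_top

/-- Without lines, ∑ η_j dominates δ‖x‖ on the cone, so -∑ η_j gives exponential decay, which
survives perturbations of size δ/2. Scaling by t produces open sets of convergence arbitrarily close
to 0. -/
lemma exists_integrable_indC_exp [DiscreteTopology Λ] [IsZLattice ℝ Λ] {n : ℕ}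
    {η : Fin n → Dual ℝ E} (hline : ¬ ContainsLine (coneOf η)) :
    ∃ (ξ₀ : DualC E) (δ : ℝ), 0 < δ ∧ ∀ t : ℝ, 0 < t → ∀ ξ : DualC E, ‖ξ - t • ξ₀‖ < t * δ →
      ∀ μ : Measure E, Adm Λ μ →
        Integrable (fun x => indC (coneOf η) x * Complex.exp (ξ x)) μ := by
  rw [containsLine_coneOf_iff] at hline
  push Not at hline
  obtain ⟨δ, hδ, hle⟩ := exists_pos_mul_norm_le
    (Φ := fun x => ∑ j, |η j x|)
    (by
      have hc : ∀ j, Continuous (η j) := fun j => (η j).continuous_of_finiteDimensional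
      fun_prop)
    (by
      intro t x ht
      simp only [map_smul, smul_eq_mul, abs_mul, abs_of_nonneg ht, Finset.mul_sum])
    (by
      intro x hx
      obtain ⟨j, hj⟩ := hline x hx
      exact Finset.sum_pos' (fun _ _ => abs_nonneg _) ⟨j, Finset.mem_univ j, abs_pos.2 hj⟩)
  refine ⟨-Complex.ofRealCLM.comp (LinearMap.toContinuousLinearMap (∑ j, η j)), δ / 2,
    by positivity, fun t ht ξ hξ μ hμ => ?_⟩
  set ξ₀ : DualC E := -Complex.ofRealCLM.comp (LinearMap.toContinuousLinearMap (∑ j, η j)) with hξ₀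
  refine (hμ.integrable_exp_neg_mul_norm (δ := t * δ / 2) (by positivity)).mono'
    ((measurable_indC isClosed_coneOf).mul (by fun_prop)).aestronglyMeasurable
    (Eventually.of_forall fun x => ?_)
  by_cases hx : x ∈ coneOf η
  · rw [indC_of_mem hx, one_mul, Complex.norm_exp]
    refine Real.exp_le_exp.2 ?_
    have h1 : (ξ x).re = ((ξ - t • ξ₀) x).re + t * (ξ₀ x).re := by simp
    have h2 : ((ξ - t • ξ₀) x).re ≤ t * (δ / 2) * ‖x‖ :=
      (Complex.re_le_norm _).trans (((ξ - t • ξ₀).le_opNorm x).trans (by gcongr))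
    have h3 : (ξ₀ x).re = -∑ j, |η j x| := by
      simp [hξ₀, fun j => abs_of_nonneg (hx j)]
    have h4 := hle x
    rw [h1, h3]
    nlinarith
  · rw [indC_of_notMem hx, zero_mul, norm_zero]
    positivity

end ExpInt

/-! ### Generic covectors -/

section Generic

variable {V : Type*} [NormedAddCommGroup V] [NormedSpace ℝ V]

lemma eventually_genericNhds_iff {p : DualC V → Prop} :
    (∀ᶠ ξ in genericNhds V, p ξ) ↔
      ∃ ws : Finset V, (∀ w ∈ ws, w ≠ 0) ∧ ∀ᶠ ξ in 𝓝 0, (∀ w ∈ ws, ξ w ≠ 0) → p ξ := by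
  classical
  have hb := ((𝓝 (0 : DualC V)).basis_sets).inf
    (Filter.hasBasis_iInf_principal_finite fun w : {w : V // w ≠ 0} => {ξ : DualC V | ξ w.1 ≠ 0})
  rw [genericNhds, hb.eventually_iff]
  constructor
  · rintro ⟨⟨U, t⟩, ⟨hU, ht⟩, h⟩
    refine ⟨ht.toFinset.image Subtype.val, ?_, ?_⟩
    · intro w hw
      obtain ⟨x, -, rfl⟩ := Finset.mem_image.1 hw
      exact x.2
    · filter_upwards [hU] with ξ hξ hw
      refine h ⟨hξ, Set.mem_iInter₂.2 fun w hwt => hw w ?_⟩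
      exact Finset.mem_image_of_mem _ (ht.mem_toFinset.2 hwt)
  · rintro ⟨ws, hws, h⟩
    refine ⟨⟨{ξ | (∀ w ∈ ws, ξ w ≠ 0) → p ξ}, {w | w.1 ∈ ws}⟩, ⟨h, ?_⟩, ?_⟩
    · exact ws.finite_toSet.preimage Subtype.val_injective.injOn
    · rintro ξ ⟨hξ, hw⟩
      refine hξ fun w hw' => ?_
      exact Set.mem_iInter₂.1 hw ⟨w, hws w hw'⟩ hw'

lemma eventually_genericNhds_of_nhds {p : DualC V → Prop} (ws : Finset V)
    (hws : ∀ w ∈ ws, w ≠ 0) (h : ∀ᶠ ξ in 𝓝 0, (∀ w ∈ ws, ξ w ≠ 0) → p ξ) :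
    ∀ᶠ ξ in genericNhds V, p ξ :=
  eventually_genericNhds_iff.2 ⟨ws, hws, h⟩

lemma eventually_apply_ne_zero {w : V} (hw : w ≠ 0) : ∀ᶠ ξ in genericNhds V, ξ w ≠ 0 :=
  eventually_genericNhds_of_nhds {w} (by simpa using hw) (Eventually.of_forall fun ξ h =>
    h w (Finset.mem_singleton_self w))

lemma eventually_genericNhds_of_eventually {p : DualC V → Prop} (h : ∀ᶠ ξ in 𝓝 0, p ξ) :
    ∀ᶠ ξ in genericNhds V, p ξ :=
  h.filter_mono inf_le_left

lemma tendsto_smul_nhds_zero (ξ : DualC V) :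
    Tendsto (fun τ : ℂ => τ • ξ) (𝓝[≠] 0) (𝓝 0) := by
  have h : Continuous fun τ : ℂ => τ • ξ := continuous_id.smul continuous_const
  exact (h.tendsto' 0 0 (zero_smul ℂ ξ)).mono_left nhdsWithin_le_nhds

lemma eventually_exp_smul_ne_one {ξ : DualC V} {w : V} (hw : ξ w ≠ 0) :
    ∀ᶠ τ : ℂ in 𝓝[≠] 0, Complex.exp ((τ • ξ) w) ≠ 1 := by
  have h1 : HasDerivAt (fun τ : ℂ => Complex.exp (τ * ξ w)) (ξ w) 0 := by
    simpa using ((hasDerivAt_id (0 : ℂ)).mul_const (ξ w)).cexp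
  have := h1.eventually_ne (c := 1) hw
  simpa using this

variable [FiniteDimensional ℝ V]

lemma exists_forall_apply_ne_zero (ws : Finset V) (hws : ∀ w ∈ ws, w ≠ 0) :
    ∃ ξ : DualC V, ∀ w ∈ ws, ξ w ≠ 0 := by
  obtain ⟨f, hf⟩ := Module.exists_dual_forall_apply_ne_zero (K := ℝ) (fun w : ws => (w : V))
    fun w => hws w w.2
  refine ⟨Complex.ofRealCLM.comp (LinearMap.toContinuousLinearMap f), fun w hw => ?_⟩
  simpa using hf ⟨w, hw⟩

lemma dense_generic (ws : Finset V) (hws : ∀ w ∈ ws, w ≠ 0) :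
    Dense {ξ : DualC V | ∀ w ∈ ws, ξ w ≠ 0} := by
  obtain ⟨ξ₁, hξ₁⟩ := exists_forall_apply_ne_zero ws hws
  intro ξ₀
  have ht : Tendsto (fun t : ℂ => ξ₀ + t • ξ₁) (𝓝[≠] 0) (𝓝 ξ₀) := by
    simpa using (tendsto_const_nhds (x := ξ₀)).add (tendsto_smul_nhds_zero ξ₁)
  refine mem_closure_of_tendsto ht ?_
  have : ∀ w ∈ ws, ∀ᶠ t : ℂ in 𝓝[≠] 0, (ξ₀ + t • ξ₁) w ≠ 0 := by
    intro w hw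
    have h1 : HasDerivAt (fun t : ℂ => ξ₀ w + t * ξ₁ w) (ξ₁ w) 0 := by
      simpa using ((hasDerivAt_id (0 : ℂ)).mul_const (ξ₁ w)).const_add (ξ₀ w)
    simpa using h1.eventually_ne (c := 0) (hξ₁ w hw)
  exact (Filter.eventually_all_finset ws).2 this

lemma eqOn_of_generic {F G : DualC V → ℂ} {U : Set (DualC V)} (hU : IsOpen U)
    (hF : ContinuousOn F U) (hG : ContinuousOn G U) {ws : Finset V} (hws : ∀ w ∈ ws, w ≠ 0)
    (h : ∀ ξ ∈ U, (∀ w ∈ ws, ξ w ≠ 0) → F ξ = G ξ) : Set.EqOn F G U := by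
  have h1 : Set.EqOn F G (U ∩ {ξ : DualC V | ∀ w ∈ ws, ξ w ≠ 0}) := fun ξ hξ => h ξ hξ.1 hξ.2
  exact h1.of_subset_closure hF hG Set.inter_subset_left
    ((dense_generic ws hws).open_subset_closure_inter hU)

/-- The complement of finitely many hyperplanes is dense and both functions are continuous near 0.
-/
lemma eventuallyEq_nhds_of_generic {F G : DualC V → ℂ} (hF : AnalyticAt ℂ F 0)
    (hG : AnalyticAt ℂ G 0) (h : ∀ᶠ ξ in genericNhds V, F ξ = G ξ) : F =ᶠ[𝓝 0] G := by
  obtain ⟨ws, hws, h⟩ := eventually_genericNhds_iff.1 h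
  obtain ⟨U, hUs, hU, h0⟩ := _root_.eventually_nhds_iff.1
    ((h.and hF.eventually_continuousAt).and hG.eventually_continuousAt)
  have := eqOn_of_generic hU (fun ξ hξ => (hUs ξ hξ).1.2.continuousWithinAt)
    (fun ξ hξ => (hUs ξ hξ).2.continuousWithinAt) hws fun ξ hξ => (hUs ξ hξ).1.1
  exact this.eventuallyEq_of_mem (hU.mem_nhds h0)

/-- The evaluation `ξ ↦ ⟨ξ, w⟩` as a complex linear form. -/
def evalC (w : V) : DualC V →L[ℂ] ℂ :=
  LinearMap.mkContinuous ⟨⟨fun ξ => ξ w, fun _ _ => rfl⟩, fun _ _ => rfl⟩ ‖w‖ fun ξ => by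
    simpa [mul_comm] using ξ.le_opNorm w

lemma analyticAt_apply (w : V) (ξ₀ : DualC V) : AnalyticAt ℂ (fun ξ : DualC V => ξ w) ξ₀ :=
  (evalC w).analyticAt ξ₀

lemma analyticAt_exp_apply (w : V) (ξ₀ : DualC V) :
    AnalyticAt ℂ (fun ξ : DualC V => Complex.exp (ξ w)) ξ₀ :=
  (analyticAt_apply w ξ₀).cexp

/-! ### Representations as quotients by linear forms -/

lemma isRep_coe_iff {f h : DualC V → ℂ} {N : ℕ} {w : Fin N → V} :
    IsRep (f : GenGerm V) w h ↔
      AnalyticAt ℂ h 0 ∧ ∀ᶠ ξ in genericNhds V, (∏ j, ξ (w j)) * f ξ = h ξ := by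
  unfold IsRep
  rw [← Germ.coe_mul, Germ.coe_eq]
  rfl

lemma IsRep.mul_eq_mul {φ : GenGerm V} {N N' : ℕ} {w : Fin N → V} {w' : Fin N' → V}
    {h h' : DualC V → ℂ} (H : IsRep φ w h) (H' : IsRep φ w' h') :
    ∀ᶠ ξ in 𝓝 0, (∏ j, ξ (w' j)) * h ξ = (∏ j, ξ (w j)) * h' ξ := by
  induction φ using Germ.inductionOn with | _ f => ?_
  rw [isRep_coe_iff] at H H'
  refine eventuallyEq_nhds_of_generic
    ((Finset.analyticAt_fun_prod _ fun j _ => analyticAt_apply _ _).mul H.1)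
    ((Finset.analyticAt_fun_prod _ fun j _ => analyticAt_apply _ _).mul H'.1) ?_
  filter_upwards [H.2, H'.2] with ξ h1 h2
  rw [← h1, ← h2]
  ring

lemma IsRep.div_eq_div {φ : GenGerm V} {N N' : ℕ} {w : Fin N → V} {w' : Fin N' → V}
    {h h' : DualC V → ℂ} (H : IsRep φ w h) (H' : IsRep φ w' h') {ξ : DualC V}
    (hw : ∀ j, ξ (w j) ≠ 0) (hw' : ∀ j, ξ (w' j) ≠ 0) :
    ∀ᶠ τ : ℂ in 𝓝[≠] 0, h (τ • ξ) / ∏ j, (τ • ξ) (w j) = h' (τ • ξ) / ∏ j, (τ • ξ) (w' j) := by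
  filter_upwards [(tendsto_smul_nhds_zero ξ).eventually (H.mul_eq_mul H'), self_mem_nhdsWithin]
    with τ hτ hτ0
  rw [div_eq_div_iff]
  · rw [mul_comm, hτ, mul_comm]
  · exact Finset.prod_ne_zero_iff.2 fun j _ => mul_ne_zero hτ0 (hw j)
  · exact Finset.prod_ne_zero_iff.2 fun j _ => mul_ne_zero hτ0 (hw' j)

/-- The entire function `(1 - e^z) / z`. -/
def expQuot (z : ℂ) : ℂ := dslope (fun z => 1 - Complex.exp z) 0 z

lemma mul_expQuot (z : ℂ) : z * expQuot z = 1 - Complex.exp z := by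
  have := sub_smul_dslope (fun z => 1 - Complex.exp z) 0 z
  simpa [expQuot] using this

lemma expQuot_zero : expQuot 0 = -1 := by
  rw [expQuot, dslope_same]
  simp

lemma analyticAt_expQuot (z : ℂ) : AnalyticAt ℂ expQuot z := by
  have h : DifferentiableOn ℂ (dslope (fun z => 1 - Complex.exp z) 0) Set.univ :=
    (Complex.differentiableOn_dslope univ_mem).2 (by fun_prop)
  exact h.analyticAt univ_mem

lemma expDen_eq_prod (l : List V) (ξ : DualC V) :
    expDen l ξ = ∏ j, (ξ (l.get j) * expQuot (ξ (l.get j))) := by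
  simp only [expDen, mul_expQuot, List.get_eq_getElem]
  rw [← List.prod_ofFn]
  congr 1
  exact (List.ofFn_getElem_eq_map l fun w => 1 - Complex.exp (ξ w)).symm

/-- Each factor 1 - e^{⟨ξ,w⟩} is ⟨ξ,w⟩ times `expQuot`, which equals -1 at 0 and is therefore
invertible near 0. -/
lemma isRep_div_expDen {F : DualC V → ℂ} (hF : AnalyticAt ℂ F 0) {l : List V}
    (hl : ∀ w ∈ l, w ≠ 0) :
    IsRep ((fun ξ => F ξ / expDen l ξ : DualC V → ℂ) : GenGerm V) l.get
      (fun ξ => F ξ * ∏ j, (expQuot (ξ (l.get j)))⁻¹) := by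
  rw [isRep_coe_iff]
  have ha : ∀ w : V, AnalyticAt ℂ (fun ξ : DualC V => expQuot (ξ w)) 0 := fun w =>
    (analyticAt_expQuot _).comp (analyticAt_apply w 0)
  have h0 : ∀ w : V, expQuot ((0 : DualC V) w) ≠ 0 := fun w => by simp [expQuot_zero]
  refine ⟨hF.mul (Finset.analyticAt_fun_prod _ fun j _ => (ha _).inv (h0 _)), ?_⟩
  have h1 : ∀ j, ∀ᶠ ξ in genericNhds V, ξ (l.get j) ≠ 0 := fun j =>
    eventually_apply_ne_zero (hl _ (List.get_mem l j))
  have h2 : ∀ j, ∀ᶠ ξ in genericNhds V, expQuot (ξ (l.get j)) ≠ 0 := fun j =>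
    eventually_genericNhds_of_eventually ((ha _).continuousAt.eventually_ne (h0 _))
  filter_upwards [eventually_all.2 h1, eventually_all.2 h2] with ξ h1 h2
  rw [expDen_eq_prod, Finset.prod_mul_distrib, Finset.prod_inv_distrib]
  have h4 : ∏ j, ξ (l.get j) ≠ 0 := Finset.prod_ne_zero_iff.2 fun j _ => h1 j
  have h5 : ∏ j, expQuot (ξ (l.get j)) ≠ 0 := Finset.prod_ne_zero_iff.2 fun j _ => h2 j
  field_simp

end Generic

/-! ### The projected lattice and the measures attached to `L` and `Λ` -/

section LatticePoints

variable {E : Type*} [NormedAddCommGroup E] [NormedSpace ℝ E] [FiniteDimensional ℝ E]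

lemma finite_lattice_inter_closedBall (Γ : Submodule ℤ E) [DiscreteTopology Γ] (s : E) (R : ℝ) :
    {y : Γ | (y : E) - s ∈ Metric.closedBall 0 R}.Finite := by
  have : ProperSpace E := FiniteDimensional.proper_real E
  have hcl : IsClosed (Γ : Set E) :=
    AddSubgroup.isClosed_of_discrete (H := Γ.toAddSubgroup)
  have hd : IsDiscrete (Γ : Set E) := ⟨inferInstanceAs (DiscreteTopology Γ)⟩
  have hf := Metric.finite_isBounded_inter_isClosed hd
    (Metric.isBounded_closedBall (x := s) (r := R)) hcl
  refine (hf.preimage (f := fun y : Γ => (y : E)) Subtype.val_injective.injOn).subset ?_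
  intro y hy
  refine ⟨?_, y.2⟩
  rw [Metric.mem_closedBall, dist_eq_norm]
  simpa using hy

variable [MeasurableSpace E] [BorelSpace E]

/-- The counting measure of the translated lattice `Γ - s`. -/
def latticeCount (Γ : Submodule ℤ E) (s : E) : Measure E :=
  Measure.sum fun y : Γ => Measure.dirac ((y : E) - s)

lemma adm_latticeCount (Γ : Submodule ℤ E) [DiscreteTopology Γ] (s : E) :
    Adm Γ (latticeCount Γ s) where
  inv w hw := by
    rw [latticeCount, Measure.map_sum (measurable_add_const w).aemeasurable]
    simp only [Measure.map_dirac' (measurable_add_const w)]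
    rw [← Measure.sum_comp_equiv (Equiv.addRight (⟨w, hw⟩ : Γ))
      (fun y : Γ => Measure.dirac ((y : E) - s))]
    congr 1
    funext y
    simp [sub_add_eq_add_sub]
  fin R := by
    rw [latticeCount, Measure.sum_apply _ Metric.isClosed_closedBall.measurableSet]
    have hf := finite_lattice_inter_closedBall Γ s R
    rw [tsum_eq_sum (s := hf.toFinset)]
    · exact ENNReal.sum_lt_top.2 fun y _ => measure_lt_top _ _
    · intro y hy
      rw [Measure.dirac_apply' _ Metric.isClosed_closedBall.measurableSet]
      rw [Set.indicator_of_notMem]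
      exact fun h => hy (hf.mem_toFinset.2 h)

end LatticePoints

section Slices

variable {V : Type*} [NormedAddCommGroup V] [NormedSpace ℝ V] [FiniteDimensional ℝ V]

instance isClosed_submodule (L : Submodule ℝ V) : IsClosed (L : Set V) :=
  L.closed_of_finiteDimensional

instance borelSpace_quotient [MeasurableSpace V] [BorelSpace V] (L : Submodule ℝ V) :
    BorelSpace (V ⧸ L) := by
  haveI : IsClosed (L.toAddSubgroup : Set V) := L.closed_of_finiteDimensional
  haveI : PolishSpace V := inferInstance
  exact inferInstanceAs (BorelSpace (V ⧸ L.toAddSubgroup))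

variable (Λ : Submodule ℤ V) [DiscreteTopology Λ] [IsZLattice ℝ Λ] (L : Submodule ℝ V)

/-- The lattice `L ∩ Λ` of `L`. -/
abbrev interLattice : Submodule ℤ L := Λ.comap (L.subtype.restrictScalars ℤ)

instance discreteTopology_interLattice : DiscreteTopology (interLattice Λ L) :=
  ZLattice.comap_discreteTopology ℝ Λ (e := L.subtype) L.subtypeL.continuous
    Subtype.val_injective

variable {Λ L}

lemma isZLattice_interLattice (hL : IsRationalSubspace Λ L) : IsZLattice ℝ (interLattice Λ L) := by
  refine ⟨?_⟩
  apply Submodule.map_injective_of_injective (f := L.subtype) Subtype.val_injective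
  rw [Submodule.map_span, Submodule.map_top, Submodule.range_subtype]
  conv_rhs => rw [← hL]
  congr 1
  ext x
  constructor
  · rintro ⟨y, hy, rfl⟩
    exact ⟨y.2, hy⟩
  · rintro ⟨h1, h2⟩
    exact ⟨⟨x, h1⟩, h2, rfl⟩

lemma mk_mem_projLattice {w : V} (hw : w ∈ Λ) : L.mkQ w ∈ projLattice Λ L :=
  Submodule.mem_map_of_mem (f := L.mkQ.restrictScalars ℤ) hw

/-- A class of norm less than 1 has a small representative; correcting by an element of L ∩ Λ gives
a lattice representative of norm at most 1 + R. Only finitely many classes are therefore this small.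
-/
lemma discreteTopology_projLattice (hL : IsRationalSubspace Λ L) :
    DiscreteTopology (projLattice Λ L) := by
  have := isZLattice_interLattice hL
  obtain ⟨R, hR⟩ := exists_lattice_near (interLattice Λ L)
  have hfin : {y : projLattice Λ L | ‖(y : V ⧸ L)‖ < 1}.Finite := by
    have hf := (finite_lattice_inter_closedBall Λ 0 (1 + R)).image
      (fun w : Λ => (⟨L.mkQ w, mk_mem_projLattice w.2⟩ : projLattice Λ L))
    refine hf.subset ?_
    rintro ⟨y, hy⟩ hy1
    obtain ⟨v, hv, rfl⟩ := hy
    obtain ⟨u, hu, hu1⟩ := Submodule.Quotient.norm_mk_lt (L.mkQ v)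
      (sub_pos.2 (show ‖L.mkQ v‖ < 1 from hy1))
    have hvu : v - u ∈ L := (Submodule.Quotient.eq L).1 hu.symm
    obtain ⟨w, hw⟩ := hR ⟨v - u, hvu⟩
    refine ⟨⟨v - w, Λ.sub_mem hv w.2⟩, ?_, ?_⟩
    · simp only [Set.mem_ofPred_eq, sub_zero, mem_closedBall_zero_iff]
      have h1 : v - (w : L) = u + ((⟨v - u, hvu⟩ - (w : L) : L) : V) := by
        simp only [Submodule.coe_sub]
        abel
      rw [h1]
      refine (norm_add_le _ _).trans (add_le_add ?_ hw)
      linarith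
    · ext
      change L.mkQ (v - ((w : L) : V)) = L.mkQ v
      rw [map_sub, Submodule.mkQ_apply L ((w : L) : V), (Submodule.Quotient.mk_eq_zero L).2 (w : L).2,
        sub_zero]
  refine discreteTopology_of_isOpen_singleton_zero ?_
  have h1 : IsOpen {y : projLattice Λ L | ‖(y : V ⧸ L)‖ < 1} :=
    isOpen_lt (by fun_prop) continuous_const
  have h2 : IsClosed ({y : projLattice Λ L | ‖(y : V ⧸ L)‖ < 1} \ {0}) :=
    (hfin.subset Set.sdiff_subset).isClosed
  have h3 : ({0} : Set (projLattice Λ L)) = {y : projLattice Λ L | ‖(y : V ⧸ L)‖ < 1} \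
      ({y : projLattice Λ L | ‖(y : V ⧸ L)‖ < 1} \ {0}) := by
    ext y
    simp only [Set.mem_singleton_iff, Set.mem_sdiff, Set.mem_ofPred_eq]
    constructor
    · rintro rfl; simp
    · intro h; by_contra h0; exact h.2 ⟨h.1, h0⟩
  rw [h3]
  exact h1.sdiff h2

lemma span_projLattice : Submodule.span ℝ (projLattice Λ L : Set (V ⧸ L)) = ⊤ := by
  have h : (projLattice Λ L : Set (V ⧸ L)) = L.mkQ '' (Λ : Set V) := rfl
  rw [h, ← Submodule.map_span, IsZLattice.span_top (K := ℝ) (L := Λ), Submodule.map_top,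
    Submodule.range_mkQ]

variable [MeasurableSpace V] [BorelSpace V]

lemma isAddHaarMeasure_subspaceMeasure (hL : IsRationalSubspace Λ L) :
    (subspaceMeasure Λ L).IsAddHaarMeasure := by
  have := isZLattice_interLattice hL
  have hpos := ZLattice.covolume_pos (interLattice Λ L) (Measure.addHaar : Measure L)
  refine Measure.IsAddHaarMeasure.smul _ ?_ ?_
  · simp
  · simpa using hpos

variable (Λ L) in
/-- The sum of the Lebesgue measures of the affine subspaces `y + L`, `y ∈ Λ_{V/L}`, translated
by `-s`. -/
def sliceMeasure (s : V) : Measure V :=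
  Measure.sum fun y : projLattice Λ L =>
    (subspaceMeasure Λ L).map fun x : L => Quotient.out (y : V ⧸ L) + (x : V) - s

lemma mk_out (y : V ⧸ L) : L.mkQ (Quotient.out y) = y := Quotient.out_eq y

lemma map_add_coe_eq (hL : IsRationalSubspace Λ L) {a b : V} (h : L.mkQ a = L.mkQ b) :
    (subspaceMeasure Λ L).map (fun x : L => a + (x : V)) =
      (subspaceMeasure Λ L).map fun x : L => b + (x : V) := by
  have := isAddHaarMeasure_subspaceMeasure hL
  have hab : a - b ∈ L := (Submodule.Quotient.eq L).1 h
  have hm : Measurable fun x : L => b + (x : V) := by fun_prop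
  conv_rhs => rw [← map_add_right_eq_self (subspaceMeasure Λ L) ⟨a - b, hab⟩]
  rw [Measure.map_map hm (measurable_add_const _)]
  congr 1
  funext x
  simp only [Function.comp_apply, Submodule.coe_add]
  abel

lemma sliceMeasure_eq (hL : IsRationalSubspace Λ L) (s : V) {ρ : projLattice Λ L → V}
    (hρ : ∀ y, L.mkQ (ρ y) = y - L.mkQ s) :
    sliceMeasure Λ L s =
      Measure.sum fun y => (subspaceMeasure Λ L).map fun x : L => ρ y + (x : V) := by
  rw [sliceMeasure]
  congr 1
  funext y
  rw [← map_add_coe_eq hL (a := Quotient.out (y : V ⧸ L) - s) (b := ρ y)]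
  · congr 1
    funext x
    abel
  · rw [map_sub, mk_out, hρ]

/-- Translation by an element of L is absorbed by the Haar measure on each slice. -/
lemma sliceMeasure_congr (hL : IsRationalSubspace Λ L) {s s' : V} (h : L.mkQ s = L.mkQ s') :
    sliceMeasure Λ L s = sliceMeasure Λ L s' := by
  have h1 : ∀ (s : V) (y : projLattice Λ L),
      L.mkQ (Quotient.out (y : V ⧸ L) - s) = y - L.mkQ s := fun s y => by rw [map_sub, mk_out]
  rw [sliceMeasure_eq hL s (h1 s), sliceMeasure_eq hL s' fun y => (h1 s y).trans (by rw [h])]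

lemma sliceMeasure_eq_map_prod (hL : IsRationalSubspace Λ L) (s : V) {σ : (V ⧸ L) →ₗ[ℝ] V}
    (hσ : ∀ z, L.mkQ (σ z) = z) :
    sliceMeasure Λ L s = ((latticeCount (projLattice Λ L) (L.mkQ s)).prod
      (subspaceMeasure Λ L)).map fun p : (V ⧸ L) × L => σ p.1 + (p.2 : V) := by
  have := isAddHaarMeasure_subspaceMeasure hL
  have hc : Continuous σ := σ.continuous_of_finiteDimensional
  have hm : Measurable fun p : (V ⧸ L) × L => σ p.1 + (p.2 : V) :=
    ((hc.measurable.comp measurable_fst).add (measurable_subtype_coe.comp measurable_snd))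
  rw [latticeCount, Measure.prod_sum_left, Measure.map_sum hm.aemeasurable,
    sliceMeasure_eq hL s (ρ := fun y => σ (y - L.mkQ s)) fun y => hσ _]
  congr 1
  funext y
  rw [Measure.dirac_prod, Measure.map_map hm measurable_prodMk_left]
  rfl

lemma exists_section (L : Submodule ℝ V) : ∃ σ : (V ⧸ L) →ₗ[ℝ] V, ∀ z, L.mkQ (σ z) = z := by
  obtain ⟨σ, hσ⟩ := L.mkQ.exists_rightInverse_of_surjective L.range_mkQ
  exact ⟨σ, fun z => LinearMap.congr_fun hσ z⟩

/-- Translation by w ∈ Λ permutes the slices through the class of w, up to a shift in L. For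
finiteness, a section of V → V/L presents the measure as a product of a lattice count and a Haar
measure, where a ball has bounded projections. -/
lemma adm_sliceMeasure (hL : IsRationalSubspace Λ L) (s : V) : Adm Λ (sliceMeasure Λ L s) where
  inv w hw := by
    have hm : Measurable fun x : V => x + w := measurable_add_const w
    have h1 : ∀ y : projLattice Λ L,
        Measurable fun x : L => Quotient.out (y : V ⧸ L) + (x : V) - s := fun y => by fun_prop
    conv_lhs => rw [sliceMeasure, Measure.map_sum hm.aemeasurable]
    simp only [Measure.map_map hm (h1 _)]
    conv_rhs => rw [sliceMeasure, ← Measure.sum_comp_equiv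
      (Equiv.addRight (⟨L.mkQ w, mk_mem_projLattice hw⟩ : projLattice Λ L))]
    congr 1
    funext y
    have h2 := map_add_coe_eq hL (a := Quotient.out (y : V ⧸ L) - s + w)
      (b := Quotient.out ((y : V ⧸ L) + L.mkQ w) - s) (by
        simp only [map_add, map_sub, mk_out]; abel)
    refine Eq.trans ?_ (h2.trans ?_)
    · congr 1
      funext x
      simp only [Function.comp_apply]
      abel
    · simp only [Function.comp_apply, Equiv.coe_addRight, Submodule.coe_add]
      congr 1
      funext x
      abel
  fin R := by
    have := isAddHaarMeasure_subspaceMeasure hL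
    have := discreteTopology_projLattice hL
    obtain ⟨σ, hσ⟩ := exists_section L
    have hc : Continuous σ := σ.continuous_of_finiteDimensional
    have hm : Measurable fun p : (V ⧸ L) × L => σ p.1 + (p.2 : V) :=
      ((hc.measurable.comp measurable_fst).add (measurable_subtype_coe.comp measurable_snd))
    rw [sliceMeasure_eq_map_prod hL s hσ,
      Measure.map_apply hm Metric.isClosed_closedBall.measurableSet]
    set σ' : (V ⧸ L) →L[ℝ] V := LinearMap.toContinuousLinearMap σ
    have hsub : (fun p : (V ⧸ L) × L => σ p.1 + (p.2 : V)) ⁻¹' Metric.closedBall 0 R ⊆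
        Metric.closedBall 0 R ×ˢ Metric.closedBall 0 (R + ‖σ'‖ * R) := by
      rintro ⟨y, x⟩ hp
      rw [Set.mem_preimage, mem_closedBall_zero_iff] at hp
      have hy : ‖y‖ ≤ R := by
        have h3 := Submodule.Quotient.norm_mk_le L (σ y + (x : V))
        have h4 : (Submodule.Quotient.mk (σ y + (x : V)) : V ⧸ L) = y := by
          have := hσ y
          rw [Submodule.Quotient.mk_add, (Submodule.Quotient.mk_eq_zero L).2 x.2, add_zero]
          exact this
        rw [h4] at h3
        exact h3.trans hp
      refine ⟨mem_closedBall_zero_iff.2 hy, mem_closedBall_zero_iff.2 ?_⟩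
      have h5 : (x : V) = (σ y + (x : V)) - σ' y := by
        change (x : V) = (σ y + (x : V)) - σ y
        abel
      change ‖(x : V)‖ ≤ _
      rw [h5]
      refine (norm_sub_le _ _).trans (add_le_add hp ((σ'.le_opNorm y).trans ?_))
      gcongr
    refine (measure_mono hsub).trans_lt ?_
    rw [Measure.prod_prod]
    have : ProperSpace L := FiniteDimensional.proper_real L
    exact ENNReal.mul_lt_top ((adm_latticeCount (projLattice Λ L) _).fin R)
      (isCompact_closedBall _ _).measure_lt_top

/-! ### The generating function as an integral -/

lemma countable_projLattice (hL : IsRationalSubspace Λ L) : Countable (projLattice Λ L) := by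
  have := discreteTopology_projLattice hL
  have : IsZLattice ℝ (projLattice Λ L) := ⟨span_projLattice⟩
  infer_instance

lemma indC_mul_eq_indicator (p : Set V) (ξ : DualC V) :
    (fun z => indC p z * Complex.exp (ξ z)) = p.indicator fun z => Complex.exp (ξ z) := by
  funext z
  by_cases h : z ∈ p
  · simp [indC_of_mem h, h]
  · simp [indC_of_notMem h, h]

lemma sliceFun_integral (p : Set V) (ξ : DualC V) (y : projLattice Λ L) :
    MeasurableEmbedding (fun x : L => Quotient.out (y : V ⧸ L) + (x : V) - 0) ∧
      sliceFun p ξ (y : V ⧸ L) = (fun z => indC p z * Complex.exp (ξ z)) ∘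
        fun x : L => Quotient.out (y : V ⧸ L) + (x : V) - 0 := by
  constructor
  · have h1 : MeasurableEmbedding fun x : L => (x : V) :=
      MeasurableEmbedding.subtype_coe L.closed_of_finiteDimensional.measurableSet
    have h2 : MeasurableEmbedding fun x : V => Quotient.out (y : V ⧸ L) + x :=
      (Homeomorph.addLeft (Quotient.out (y : V ⧸ L))).measurableEmbedding
    simpa [Function.comp_def] using h2.comp h1
  · rw [indC_mul_eq_indicator]
    funext x
    simp [sliceFun]

lemma sliceConverges_iff (hL : IsRationalSubspace Λ L) (p : Set V)
    (ξ : DualC V) : SliceConverges Λ L p ξ ↔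
      Integrable (fun z => indC p z * Complex.exp (ξ z)) (sliceMeasure Λ L 0) := by
  have := countable_projLattice hL
  rw [sliceMeasure, integrable_sum_measure_iff, SliceConverges]
  refine and_congr (forall_congr' fun y => ?_) ?_
  · rw [(sliceFun_integral p ξ y).1.integrable_map_iff, (sliceFun_integral p ξ y).2]
  · simp only [(sliceFun_integral p ξ _).1.integral_map, (sliceFun_integral p ξ _).2,
      Function.comp_apply]

lemma sliceSum_eq {p : Set V} {ξ : DualC V}
    (h : Integrable (fun z => indC p z * Complex.exp (ξ z)) (sliceMeasure Λ L 0)) :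
    sliceSum Λ L p ξ = expInt (sliceMeasure Λ L 0) ξ (indC p) := by
  rw [expInt, sliceMeasure, integral_sum_measure (by rwa [sliceMeasure] at h), sliceSum]
  simp only [(sliceFun_integral p ξ _).1.integral_map, (sliceFun_integral p ξ _).2,
    Function.comp_apply]

lemma sliceMeasure_zero_eq_map (s : V) :
    sliceMeasure Λ L 0 = (sliceMeasure Λ L s).map fun x => x + s := by
  have hm : Measurable fun x : V => x + s := measurable_add_const s
  have h1 : ∀ y : projLattice Λ L,
      Measurable fun x : L => Quotient.out (y : V ⧸ L) + (x : V) - s := fun y => by fun_prop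
  conv_rhs => rw [sliceMeasure, Measure.map_sum hm.aemeasurable]
  simp only [Measure.map_map hm (h1 _)]
  rw [sliceMeasure]
  congr 1
  funext y
  congr 1
  funext x
  simp

lemma indC_vadd (s : V) (c : Set V) (x : V) : indC (s +ᵥ c) (x + s) = indC c x := by
  have : x + s ∈ s +ᵥ c ↔ x ∈ c := by
    rw [add_comm, ← vadd_eq_add, Set.vadd_mem_vadd_set_iff]
  by_cases h : x ∈ c
  · rw [indC_of_mem h, indC_of_mem (this.2 h)]
  · rw [indC_of_notMem h, indC_of_notMem (mt this.1 h)]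

lemma integrable_vadd_iff (s : V) (c : Set V) (ξ : DualC V) :
    Integrable (fun z => indC (s +ᵥ c) z * Complex.exp (ξ z)) (sliceMeasure Λ L 0) ↔
      Integrable (fun z => indC c z * Complex.exp (ξ z)) (sliceMeasure Λ L s) := by
  have he : MeasurableEmbedding fun x : V => x + s := (Homeomorph.addRight s).measurableEmbedding
  rw [sliceMeasure_zero_eq_map s, he.integrable_map_iff]
  have : ((fun z => indC (s +ᵥ c) z * Complex.exp (ξ z)) ∘ fun x : V => x + s) =
      fun z => Complex.exp (ξ s) * (indC c z * Complex.exp (ξ z)) := by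
    funext z
    simp only [Function.comp_apply, indC_vadd, map_add, Complex.exp_add]
    ring
  rw [this, integrable_const_mul_iff (Complex.exp_ne_zero _).isUnit]

lemma expInt_vadd (s : V) (c : Set V) (ξ : DualC V) :
    expInt (sliceMeasure Λ L 0) ξ (indC (s +ᵥ c)) =
      Complex.exp (ξ s) * expInt (sliceMeasure Λ L s) ξ (indC c) := by
  have he : MeasurableEmbedding fun x : V => x + s := (Homeomorph.addRight s).measurableEmbedding
  rw [expInt, sliceMeasure_zero_eq_map s, he.integral_map, expInt, ← integral_const_mul]
  congr 1
  funext z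
  simp only [indC_vadd, map_add, Complex.exp_add]
  ring

end Slices

/-! ### The generating function of a translated cone -/

section GeneratingFunction

variable {V : Type*} [NormedAddCommGroup V] [NormedSpace ℝ V] [FiniteDimensional ℝ V]

lemma eventually_exp_ne_one {w : V} (hw : w ≠ 0) :
    ∀ᶠ ξ in genericNhds V, Complex.exp (ξ w) ≠ 1 := by
  have h : ContinuousAt (fun ξ : DualC V => expQuot (ξ w)) 0 :=
    ((analyticAt_expQuot _).comp (analyticAt_apply w 0)).continuousAt
  have h2 : ∀ᶠ ξ in genericNhds V, expQuot (ξ w) ≠ 0 :=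
    eventually_genericNhds_of_eventually (h.eventually_ne (by simp [expQuot_zero]))
  filter_upwards [eventually_apply_ne_zero hw, h2] with ξ h1 h2 h3
  exact mul_ne_zero h1 h2 (by rw [mul_expQuot, h3, sub_self])

lemma eventually_forall_exp_ne_one {l : List V} (hl : ∀ w ∈ l, w ≠ 0) :
    ∀ᶠ ξ in genericNhds V, ∀ w ∈ l, Complex.exp (ξ w) ≠ 1 := by
  induction l with
  | nil => simp
  | cons w l ih =>
    filter_upwards [eventually_exp_ne_one (hl w List.mem_cons_self),
      ih fun w hw => hl w (List.mem_cons_of_mem _ hw)] with ξ h1 h2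
    simpa using ⟨h1, h2⟩

lemma containsLine_vadd_iff (s : V) (c : Set V) : ContainsLine (s +ᵥ c) ↔ ContainsLine c := by
  have key : ∀ (s : V) (c : Set V), ContainsLine c → ContainsLine (s +ᵥ c) := by
    rintro s c ⟨x, u, hu, h⟩
    refine ⟨s + x, u, hu, fun t => ?_⟩
    rw [add_assoc, ← vadd_eq_add, Set.vadd_mem_vadd_set_iff]
    exact h t
  refine ⟨fun h => ?_, key s c⟩
  simpa using key (-s) _ h

variable [MeasurableSpace V] [BorelSpace V] {Λ : Submodule ℤ V} [DiscreteTopology Λ]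
  [IsZLattice ℝ Λ] {L : Submodule ℝ V} {n : ℕ} {η : Fin n → Dual ℝ V}

/-- The function `M^L(s, c)`, expressed by means of a difference operator. -/
def regFun (Λ : Submodule ℤ V) (L : Submodule ℝ V) (c : Set V) (l : List V) (s : V)
    (ξ : DualC V) : ℂ :=
  expInt (sliceMeasure Λ L s) ξ (diffOp l (indC c)) / expDen l ξ

/-- Wherever the sum converges, the difference operator multiplies it by `expDen`, so dividing
recovers it. The quotient itself makes sense at every generic ξ near 0. -/
lemma isContinuation_regFun (hL : IsRationalSubspace Λ L) {l : List V}
    (hl : ∀ w ∈ l, w ∈ Λ ∧ w ≠ 0) (hb : BddSupp (diffOp l (indC (coneOf η)))) (s : V) :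
    IsContinuation Λ L (s +ᵥ coneOf η)
      ((fun ξ => Complex.exp (ξ s) * regFun Λ L (coneOf η) l s ξ : DualC V → ℂ) : GenGerm V) := by
  have hμ := adm_sliceMeasure (Λ := Λ) hL s
  constructor
  · have h := isRep_div_expDen ((analyticAt_exp_apply s 0).mul (hb.analyticAt_expInt hμ 0))
      (fun w hw => (hl w hw).2)
    have he : (fun ξ => Complex.exp (ξ s) * regFun Λ L (coneOf η) l s ξ : DualC V → ℂ) = fun ξ =>
        (Complex.exp (ξ s) * expInt (sliceMeasure Λ L s) ξ (diffOp l (indC (coneOf η)))) /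
          expDen l ξ := by
      funext ξ
      rw [regFun, mul_div_assoc]
    rw [he]
    exact ⟨l.length, l.get, fun j => (hl _ (List.get_mem l j)).2, _, h⟩
  · refine ⟨_, rfl, ?_⟩
    filter_upwards [eventually_forall_exp_ne_one fun w hw => (hl w hw).2] with ξ hξ hconv
    rw [sliceConverges_iff hL] at hconv
    rw [sliceSum_eq hconv, expInt_vadd, regFun,
      (hμ.integrable_diffOp (fun w hw => (hl w hw).1) ((integrable_vadd_iff s _ ξ).1 hconv)).2,
      mul_div_cancel_left₀ _ (expDen_ne_zero hξ)]

/-- After clearing denominators, both candidates are analytic on one ball about 0. They agree on a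
smaller ball of convergence inside it, and the identity theorem spreads the equality. -/
lemma IsContinuation.unique (hL : IsRationalSubspace Λ L) (hline : ¬ ContainsLine (coneOf η))
    {s : V} {φ₁ φ₂ : GenGerm V} (h₁ : IsContinuation Λ L (s +ᵥ coneOf η) φ₁)
    (h₂ : IsContinuation Λ L (s +ᵥ coneOf η) φ₂) : φ₁ = φ₂ := by
  classical
  obtain ⟨ξ₀, δ, hδ, hint⟩ := exists_integrable_indC_exp (Λ := Λ) hline
  obtain ⟨⟨N₁, w₁, hw₁, H₁, hrep₁⟩, f₁, rfl, hf₁⟩ := h₁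
  obtain ⟨⟨N₂, w₂, hw₂, H₂, hrep₂⟩, f₂, rfl, hf₂⟩ := h₂
  rw [isRep_coe_iff] at hrep₁ hrep₂
  have hg : ∀ᶠ ξ in genericNhds V, (SliceConverges Λ L (s +ᵥ coneOf η) ξ → f₁ ξ = f₂ ξ) ∧
      (∏ j, ξ (w₁ j)) * f₁ ξ = H₁ ξ ∧ (∏ j, ξ (w₂ j)) * f₂ ξ = H₂ ξ := by
    filter_upwards [hf₁, hf₂, hrep₁.2, hrep₂.2] with ξ a1 a2 a3 a4
    exact ⟨fun h => (a1 h).trans (a2 h).symm, a3, a4⟩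
  obtain ⟨ws, hws, hev⟩ := eventually_genericNhds_iff.1 hg
  obtain ⟨r, hr, hball⟩ := Metric.eventually_nhds_iff_ball.1
    ((hev.and hrep₁.1.eventually_analyticAt).and hrep₂.1.eventually_analyticAt)
  set G₁ : DualC V → ℂ := fun ξ => (∏ j, ξ (w₂ j)) * H₁ ξ
  set G₂ : DualC V → ℂ := fun ξ => (∏ j, ξ (w₁ j)) * H₂ ξ
  have hG₁ : AnalyticOnNhd ℂ G₁ (Metric.ball 0 r) := fun ξ hξ =>
    (Finset.analyticAt_fun_prod _ fun j _ => analyticAt_apply _ _).mul (hball ξ hξ).1.2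
  have hG₂ : AnalyticOnNhd ℂ G₂ (Metric.ball 0 r) := fun ξ hξ =>
    (Finset.analyticAt_fun_prod _ fun j _ => analyticAt_apply _ _).mul (hball ξ hξ).2
  -- a small ball on which the sums converge
  obtain ⟨t, ht, htr⟩ : ∃ t > 0, t * (‖ξ₀‖ + δ) < r := by
    have hp : 0 < ‖ξ₀‖ + δ := by positivity
    exact ⟨r / (2 * (‖ξ₀‖ + δ)), by positivity, by
      rw [div_mul_eq_mul_div, div_lt_iff₀ (by positivity)]; nlinarith⟩
  have hsub : Metric.ball (t • ξ₀) (t * δ) ⊆ Metric.ball 0 r := by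
    refine Metric.ball_subset_ball' ?_
    rw [dist_zero_right, norm_smul, Real.norm_of_nonneg ht.le]
    linarith
  have heq : Set.EqOn G₁ G₂ (Metric.ball (t • ξ₀) (t * δ)) := by
    refine eqOn_of_generic Metric.isOpen_ball (hG₁.continuousOn.mono hsub)
      (hG₂.continuousOn.mono hsub) hws fun ξ hξ hgen => ?_
    obtain ⟨a1, a2, a3⟩ := (hball ξ (hsub hξ)).1.1 hgen
    have hc : SliceConverges Λ L (s +ᵥ coneOf η) ξ := by
      rw [sliceConverges_iff hL, integrable_vadd_iff]
      exact hint t ht ξ (by rwa [← dist_eq_norm]) _ (adm_sliceMeasure hL s)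
    simp only [G₁, G₂, ← a2, ← a3, a1 hc]
    ring
  have hmem : t • ξ₀ ∈ Metric.ball (t • ξ₀) (t * δ) := Metric.mem_ball_self (by positivity)
  have heq' := hG₁.eqOn_of_preconnected_of_eventuallyEq hG₂
    (convex_ball (0 : DualC V) r).isPreconnected (hsub hmem)
    (heq.eventuallyEq_of_mem (Metric.isOpen_ball.mem_nhds hmem))
  rw [Germ.coe_eq]
  have hb : ∀ᶠ ξ in genericNhds V, ξ ∈ Metric.ball (0 : DualC V) r :=
    eventually_genericNhds_of_eventually (Metric.ball_mem_nhds _ hr)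
  filter_upwards [hg, hb, eventually_all.2 fun j => eventually_apply_ne_zero (hw₁ j),
    eventually_all.2 fun j => eventually_apply_ne_zero (hw₂ j)] with ξ ⟨_, a2, a3⟩ hξ b1 b2
  have h1 : ∏ j, ξ (w₁ j) ≠ 0 := Finset.prod_ne_zero_iff.2 fun j _ => b1 j
  have h2 : ∏ j, ξ (w₂ j) ≠ 0 := Finset.prod_ne_zero_iff.2 fun j _ => b2 j
  have h3 := heq' hξ
  simp only [G₁, G₂, ← a2, ← a3] at h3
  refine mul_left_cancel₀ (mul_ne_zero h1 h2) ?_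
  linear_combination h3

lemma SL_eq_zero {c : Set V} (hline : ContainsLine c) (s : V) : SL Λ L c s = 0 := by
  rw [SL, genFun, if_pos ((containsLine_vadd_iff s c).2 hline)]

lemma SL_eq (hL : IsRationalSubspace Λ L) (hline : ¬ ContainsLine (coneOf η)) {l : List V}
    (hl : ∀ w ∈ l, w ∈ Λ ∧ w ≠ 0) (hb : BddSupp (diffOp l (indC (coneOf η)))) (s : V) :
    SL Λ L (coneOf η) s =
      ((fun ξ => Complex.exp (ξ s) * regFun Λ L (coneOf η) l s ξ : DualC V → ℂ) : GenGerm V) := by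
  have hex := isContinuation_regFun hL hl hb s
  rw [SL, genFun, if_neg (mt (containsLine_vadd_iff s _).1 hline), dif_pos ⟨_, hex⟩]
  exact IsContinuation.unique hL hline (Exists.choose_spec _) hex

lemma ML_eq (hL : IsRationalSubspace Λ L) (hline : ¬ ContainsLine (coneOf η)) {l : List V}
    (hl : ∀ w ∈ l, w ∈ Λ ∧ w ≠ 0) (hb : BddSupp (diffOp l (indC (coneOf η)))) (s : V) :
    ML Λ L (coneOf η) s = (regFun Λ L (coneOf η) l s : GenGerm V) := by
  rw [ML, SL_eq hL hline hl hb, expGerm, ← Germ.coe_mul]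
  congr 1
  funext ξ
  simp only [Pi.mul_apply, map_neg, ← mul_assoc, ← Complex.exp_add, neg_add_cancel,
    Complex.exp_zero, one_mul]

end GeneratingFunction

/-! ### Laurent expansions -/

section Laurent

/-- `f` has the Laurent expansion `∑ a_m τ^m` at `0`, with finitely many negative powers. -/
def HasLaurent (f : ℂ → ℂ) (a : ℤ → ℂ) : Prop :=
  (∃ m₀ : ℤ, ∀ m < m₀, a m = 0) ∧ ∀ᶠ τ : ℂ in 𝓝[≠] 0, HasSum (fun m : ℤ => τ ^ m * a m) (f τ)

lemma hasSum_of_eq {ι : Type*} {f g : ι → ℂ} {z : ℂ} (h : HasSum f z) (hfg : ∀ i, g i = f i) :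
    HasSum g z := by
  rwa [funext hfg]

lemma hasSum_int_iff {g : ℤ → ℂ} {m₀ : ℤ} (hg : ∀ m < m₀, g m = 0) {z : ℂ} :
    HasSum (fun k : ℕ => g (m₀ + k)) z ↔ HasSum g z := by
  have hinj : Function.Injective fun k : ℕ => m₀ + (k : ℤ) := fun a b h => by simpa using h
  refine hinj.hasSum_iff (f := g) fun m hm => hg m ?_
  by_contra h
  exact hm ⟨(m - m₀).toNat, by simp only; omega⟩

lemma eq_zero_of_hasSum_zero {e : ℕ → ℂ}
    (h : ∀ᶠ τ : ℂ in 𝓝[≠] 0, HasSum (fun k : ℕ => τ ^ k * e k) 0) (k : ℕ) : e k = 0 := by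
  -- The hypothesis says nothing at τ = 0, where the series equals e 0. This F has the power series
  -- there, and its continuity forces e 0 = 0.
  set F : ℂ → ℂ := fun τ => if τ = 0 then e 0 else 0 with hF
  have hp : HasFPowerSeriesAt F (FormalMultilinearSeries.ofScalars ℂ e) 0 := by
    rw [hasFPowerSeriesAt_iff]
    rw [eventually_nhdsWithin_iff] at h
    filter_upwards [h] with τ hτ
    rcases eq_or_ne τ 0 with rfl | h0
    · have h1 := hasSum_single (f := fun n : ℕ => (0 : ℂ) ^ n * e n) 0 fun n hn => by simp [hn]
      simpa [hF, FormalMultilinearSeries.coeff_ofScalars] using h1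
    · simpa [hF, h0, FormalMultilinearSeries.coeff_ofScalars] using hτ h0
  have hc : ContinuousAt F 0 := hp.continuousAt
  have h0 : e 0 = 0 := by
    have h1 : Tendsto F (𝓝[≠] 0) (𝓝 (F 0)) := hc.tendsto.mono_left nhdsWithin_le_nhds
    have h2 : Tendsto F (𝓝[≠] 0) (𝓝 0) := by
      refine tendsto_const_nhds.congr' ?_
      filter_upwards [self_mem_nhdsWithin] with τ hτ
      exact (if_neg hτ).symm
    simpa [hF] using tendsto_nhds_unique h1 h2
  have hF0 : F = 0 := by funext τ; simp [hF, h0]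
  rw [hF0] at hp
  have := congrArg (fun p => FormalMultilinearSeries.coeff p k) hp.eq_zero
  rw [FormalMultilinearSeries.coeff_ofScalars] at this
  exact this

lemma HasLaurent.unique {f g : ℂ → ℂ} {a b : ℤ → ℂ} (hf : HasLaurent f a) (hg : HasLaurent g b)
    (h : f =ᶠ[𝓝[≠] 0] g) : a = b := by
  obtain ⟨⟨m₁, h₁⟩, hf⟩ := hf
  obtain ⟨⟨m₂, h₂⟩, hg⟩ := hg
  set m₀ := min m₁ m₂
  have h0 : ∀ m < m₀, a m - b m = 0 := fun m hm => by
    rw [h₁ m (hm.trans_le (min_le_left _ _)), h₂ m (hm.trans_le (min_le_right _ _)), sub_zero]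
  have key : ∀ k : ℕ, a (m₀ + k) - b (m₀ + k) = 0 := by
    refine eq_zero_of_hasSum_zero ?_
    filter_upwards [hf, hg, h, self_mem_nhdsWithin] with τ h1 h2 h3 h4
    have h5 := h1.sub h2
    rw [h3, sub_self] at h5
    simp only [← mul_sub] at h5
    rw [← hasSum_int_iff (m₀ := m₀) fun m hm => by rw [h0 m hm, mul_zero]] at h5
    have h6 := h5.mul_left (τ ^ m₀)⁻¹
    rw [mul_zero] at h6
    have h7 : (fun k : ℕ => τ ^ k * (a (m₀ + k) - b (m₀ + k))) = fun k : ℕ =>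
        (τ ^ m₀)⁻¹ * (τ ^ (m₀ + (k : ℤ)) * (a (m₀ + k) - b (m₀ + k))) := by
      funext k
      rw [zpow_add₀ h4, zpow_natCast, mul_assoc (τ ^ m₀), inv_mul_cancel_left₀ (zpow_ne_zero m₀ h4)]
    rw [h7]
    exact h6
  funext m
  refine sub_eq_zero.1 ?_
  rcases lt_or_ge m m₀ with hm | hm
  · exact h0 m hm
  · obtain ⟨k, rfl⟩ := Int.exists_add_of_le hm
    exact key k

lemma HasLaurent.congr {f g : ℂ → ℂ} {a : ℤ → ℂ} (hf : HasLaurent f a) (h : f =ᶠ[𝓝[≠] 0] g) :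
    HasLaurent g a :=
  ⟨hf.1, by filter_upwards [hf.2, h] with τ h1 h2; rwa [← h2]⟩

lemma HasLaurent.zero : HasLaurent (fun _ => 0) 0 :=
  ⟨⟨0, fun _ _ => rfl⟩, Eventually.of_forall fun τ => by simp⟩

lemma HasLaurent.add {f g : ℂ → ℂ} {a b : ℤ → ℂ} (hf : HasLaurent f a) (hg : HasLaurent g b) :
    HasLaurent (fun τ => f τ + g τ) (a + b) := by
  obtain ⟨⟨m₁, h₁⟩, hf⟩ := hf
  obtain ⟨⟨m₂, h₂⟩, hg⟩ := hg
  refine ⟨⟨min m₁ m₂, fun m hm => ?_⟩, ?_⟩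
  · simp [h₁ m (hm.trans_le (min_le_left _ _)), h₂ m (hm.trans_le (min_le_right _ _))]
  · filter_upwards [hf, hg] with τ h1 h2
    simpa [mul_add] using h1.add h2

lemma HasLaurent.sum {ι : Type*} (s : Finset ι) {f : ι → ℂ → ℂ} {a : ι → ℤ → ℂ}
    (h : ∀ i ∈ s, HasLaurent (f i) (a i)) :
    HasLaurent (fun τ => ∑ i ∈ s, f i τ) (∑ i ∈ s, a i) := by
  classical
  induction s using Finset.induction_on with
  | empty => simpa using HasLaurent.zero
  | insert i s hi ih =>
    simp only [Finset.sum_insert hi]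
    exact (h i (Finset.mem_insert_self _ _)).add
      (ih fun j hj => h j (Finset.mem_insert_of_mem hj))

lemma hasLaurent_of_hasSum {f : ℂ → ℂ} {e : ℕ → ℂ} (N : ℕ)
    (h : ∀ᶠ τ : ℂ in 𝓝[≠] 0, HasSum (fun k : ℕ => τ ^ k * e k) (τ ^ N * f τ)) :
    HasLaurent f fun m => if 0 ≤ m + N then e (m + N).toNat else 0 := by
  refine ⟨⟨-N, fun m hm => if_neg (by omega)⟩, ?_⟩
  filter_upwards [h, self_mem_nhdsWithin] with τ hτ h0
  rw [← hasSum_int_iff (m₀ := -N) fun m hm => by rw [if_neg (by omega), mul_zero]]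
  have h1 := hτ.mul_left (τ ^ N)⁻¹
  rw [inv_mul_cancel_left₀ (pow_ne_zero N h0)] at h1
  refine hasSum_of_eq h1 fun k => ?_
  have h2 : (-(N : ℤ) + k + N) = (k : ℤ) := by ring
  rw [h2, if_pos (by omega), Int.toNat_natCast, zpow_add₀ h0, zpow_neg, zpow_natCast,
    zpow_natCast, mul_assoc]

lemma exists_hasLaurent {f : ℂ → ℂ} (hf : MeromorphicAt f 0) : ∃ a, HasLaurent f a := by
  obtain ⟨N, p, hp⟩ := hf
  rw [hasFPowerSeriesAt_iff] at hp
  refine ⟨_, hasLaurent_of_hasSum (e := p.coeff) N (Eventually.filter_mono nhdsWithin_le_nhds ?_)⟩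
  filter_upwards [hp] with τ hτ
  simpa using hτ

/-- Reindexing of the Cauchy product of a power series and a Laurent series. -/
def antidiagonalEquiv : ℤ × ℕ ≃ ℕ × ℤ where
  toFun p := (p.2, p.1 - p.2)
  invFun q := (q.2 + q.1, q.1)
  left_inv p := by simp
  right_inv q := by simp

lemma hasSum_mul_prod {ι κ : Type*} {f : ι → ℂ} {g : κ → ℂ} {x y : ℂ} (hf : HasSum f x)
    (hg : HasSum g y) : HasSum (fun p : ι × κ => f p.1 * g p.2) (x * y) :=
  hf.mul hg (summable_mul_of_summable_norm hf.summable.norm hg.summable.norm)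

/-- In the Cauchy product only 0 ≤ k ≤ m - j₀ can contribute to τ^m, since r vanishes below j₀.
Finiteness of this sum makes the coefficients polynomial in s later on. -/
lemma HasLaurent.powerSeries_mul {E R : ℂ → ℂ} {e : ℕ → ℂ} {r : ℤ → ℂ} {j₀ : ℤ}
    (hE : ∀ τ, HasSum (fun k : ℕ => τ ^ k * e k) (E τ)) (hr : ∀ m < j₀, r m = 0)
    (hR : HasLaurent R r) : HasLaurent (fun τ => E τ * R τ)
      fun m => ∑ k ∈ Finset.range (m - j₀ + 1).toNat, e k * r (m - k) := by
  refine ⟨⟨j₀, fun m hm => ?_⟩, ?_⟩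
  · have : (m - j₀ + 1).toNat = 0 := by omega
    simp [this]
  filter_upwards [hR.2, self_mem_nhdsWithin] with τ hτ h0
  have h1 := hasSum_mul_prod (hE τ) hτ
  have h2 : HasSum (fun p : ℤ × ℕ => τ ^ p.1 * (e p.2 * r (p.1 - p.2))) (E τ * R τ) := by
    refine hasSum_of_eq (antidiagonalEquiv.hasSum_iff.2 h1) fun p => ?_
    have h3 : τ ^ p.1 = τ ^ p.2 * τ ^ (p.1 - p.2) := by
      rw [← zpow_natCast, ← zpow_add₀ h0]
      congr 1
      ring
    change _ = τ ^ p.2 * e p.2 * (τ ^ (p.1 - p.2) * r (p.1 - p.2))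
    rw [h3]
    ring
  refine h2.prod_fiberwise fun m => ?_
  rw [Finset.mul_sum]
  refine hasSum_sum_of_ne_finset_zero fun k hk => ?_
  rw [hr (m - k) (by simp only [Finset.mem_range] at hk; omega), mul_zero, mul_zero]

end Laurent

/-! ### Homogeneous components -/

section HomComp

variable {V : Type*} [NormedAddCommGroup V] [NormedSpace ℝ V] [FiniteDimensional ℝ V]

/-- Any two representations agree along the ray near τ = 0, so the value does not depend on the
choice made in `homComp`. -/
lemma homComp_eq {φ : GenGerm V} {N : ℕ} {w : Fin N → V} {h : DualC V → ℂ} (H : IsRep φ w h)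
    {ξ : DualC V} (hw : ∀ j, ξ (w j) ≠ 0) {a : ℤ → ℂ}
    (ha : HasLaurent (fun τ => h (τ • ξ) / ∏ j, (τ • ξ) (w j)) a) (m : ℤ) :
    homComp φ m ξ = a m := by
  have hex : ∃ a : ℤ → ℂ, HasRayExpansion φ ξ a := ⟨a, N, w, h, H, hw, ha.1, ha.2⟩
  rw [homComp, dif_pos hex]
  obtain ⟨N', w', h', H', hw', hb1, hb2⟩ := hex.choose_spec
  exact congrFun (HasLaurent.unique ⟨hb1, hb2⟩ ha (H'.div_eq_div H hw' hw)) m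

lemma homComp_div_expDen {F : DualC V → ℂ} (hF : AnalyticAt ℂ F 0) {l : List V} {ξ : DualC V}
    (hξ : ∀ w ∈ l, ξ w ≠ 0) {a : ℤ → ℂ}
    (ha : HasLaurent (fun τ => F (τ • ξ) / expDen l (τ • ξ)) a) (m : ℤ) :
    homComp ((fun ξ => F ξ / expDen l ξ : DualC V → ℂ) : GenGerm V) m ξ = a m := by
  have hl : ∀ w ∈ l, w ≠ 0 := fun w hw h0 => hξ w hw (by rw [h0, map_zero])
  refine homComp_eq (isRep_div_expDen hF hl) (fun j => hξ _ (List.get_mem l j)) ?_ m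
  convert ha using 2 with τ
  rw [expDen_eq_prod, Finset.prod_mul_distrib, Finset.prod_inv_distrib, div_eq_mul_inv,
    div_eq_mul_inv, mul_inv]
  ring

/-! ### Homogeneous polynomials and the space W -/

/-- The monomials in the coordinates of a basis. -/
def monomialFun {ι : Type*} (b : Basis ι ℝ V) {k : ℕ} (f : Fin k → ι) (ξ : DualC V) : ℂ :=
  ∏ j, ξ (b (f j))

lemma multilinear_diag_mem_span {ι : Type*} [Fintype ι] (b : Basis ι ℝ V) {k : ℕ}
    (p : MultilinearMap ℂ (fun _ : Fin k => DualC V) ℂ) :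
    (fun ξ => p fun _ => ξ) ∈
      Submodule.span ℂ (Set.range fun f : Fin k → ι => monomialFun b f) := by
  classical
  set β : ι → DualC V := fun i =>
    Complex.ofRealCLM.comp (LinearMap.toContinuousLinearMap (b.coord i)) with hβ
  have hexp : ∀ ξ : DualC V, ξ = ∑ i, ξ (b i) • β i := by
    intro ξ
    ext x
    conv_lhs => rw [← b.sum_repr x, map_sum]
    simp [hβ, mul_comm]
  have : (fun ξ => p fun _ => ξ) =
      ∑ f : Fin k → ι, (p fun j => β (f j)) • monomialFun b f := by
    funext ξ
    conv_lhs => rw [hexp ξ]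
    rw [p.map_sum, Finset.sum_apply]
    refine Finset.sum_congr rfl fun f _ => ?_
    rw [p.map_smul_univ (fun j => ξ (b (f j))) fun j => β (f j)]
    simp only [Pi.smul_apply, monomialFun, smul_eq_mul, mul_comm]
  rw [this]
  exact Submodule.sum_mem _ fun f _ =>
    Submodule.smul_mem _ _ (Submodule.subset_span (Set.mem_range_self f))

lemma homPoly_natCast_eq {ι : Type*} [Fintype ι] (b : Basis ι ℝ V) (k : ℕ) :
    homPoly V (k : ℤ) = Submodule.span ℂ (Set.range fun f : Fin k → ι => monomialFun b f) := by
  refine le_antisymm (Submodule.span_le.2 ?_) (Submodule.span_le.2 ?_)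
  · rintro P ⟨n, u, hn, rfl⟩
    obtain rfl : n = k := by exact_mod_cast hn
    have := multilinear_diag_mem_span b ((MultilinearMap.mkPiAlgebra ℂ (Fin n) ℂ).compLinearMap
      fun j => (evalC (u j) : DualC V →ₗ[ℂ] ℂ))
    exact this
  · rintro _ ⟨f, rfl⟩
    exact Submodule.subset_span ⟨k, fun j => b (f j), rfl, rfl⟩

lemma homPoly_of_neg {k : ℤ} (hk : k < 0) : homPoly V k = ⊥ := by
  rw [homPoly, Submodule.span_eq_bot]
  rintro P ⟨n, u, hn, -⟩
  omega

instance finiteDimensional_homPoly (k : ℤ) : FiniteDimensional ℂ (homPoly V k) := by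
  rcases lt_or_ge k 0 with hk | hk
  · rw [homPoly_of_neg hk]; infer_instance
  · lift k to ℕ using hk
    rw [homPoly_natCast_eq (finBasis ℝ V)]
    exact FiniteDimensional.span_of_finite ℂ (Set.finite_range _)

lemma continuous_of_mem_homPoly {k : ℤ} {P : DualC V → ℂ} (hP : P ∈ homPoly V k) :
    Continuous P := by
  induction hP using Submodule.span_induction with
  | mem P hP =>
    obtain ⟨n, u, -, rfl⟩ := hP
    exact continuous_finsetProd _ fun j _ => (evalC (u j)).continuous
  | zero => exact continuous_const
  | add P Q _ _ hP hQ => exact hP.add hQ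
  | smul r P _ hP => exact hP.const_smul r

variable {N : ℕ} {v : Fin N → V}

instance finiteDimensional_fracSpace (k : ℤ) : FiniteDimensional ℂ (fracSpace v k) := by
  let T : (DualC V → ℂ) →ₗ[ℂ] (Regular v → ℂ) :=
    { toFun := fun P ξ => P ξ.1 / ∏ j, ξ.1 (v j)
      map_add' := fun P Q => by funext ξ; simp [add_div]
      map_smul' := fun r P => by funext ξ; simp [mul_div_assoc] }
  have : fracSpace v k = (homPoly V k).map T := by
    ext f
    constructor
    · rintro ⟨P, hP, h⟩
      exact ⟨P, hP, funext fun ξ => (h ξ).symm⟩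
    · rintro ⟨P, hP, rfl⟩
      exact ⟨P, hP, fun ξ => rfl⟩
  rw [this]
  infer_instance

/-- The denominator contributes τ^N along a ray, so the coefficient of τ^m comes from the Taylor
term of degree m + N of the numerator. -/
lemma homComp_mem_fracSpace {φ : GenGerm V} (hφ : HolomorphicAfterMul v φ) (m : ℤ) :
    (fun ξ : Regular v => homComp φ m ξ.1) ∈ fracSpace v (m + N) := by
  obtain ⟨h, H⟩ := hφ
  obtain ⟨p, hp⟩ := H.1
  have key : ∀ ξ : Regular v, homComp φ m ξ.1 =
      if 0 ≤ m + N then (p (m + N).toNat fun _ => ξ.1) / ∏ j, ξ.1 (v j) else 0 := by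
    intro ξ
    refine homComp_eq H ξ.2 (hasLaurent_of_hasSum
      (e := fun k => (p k fun _ => ξ.1) / ∏ j, ξ.1 (v j)) N ?_) m
    filter_upwards [(tendsto_smul_nhds_zero ξ.1).eventually hp.eventually_hasSum,
      self_mem_nhdsWithin] with τ hτ h0
    rw [zero_add] at hτ
    have h1 := hτ.div_const (∏ j, ξ.1 (v j))
    have h2 : ∏ j, (τ • ξ.1) (v j) = τ ^ N * ∏ j, ξ.1 (v j) := by
      simp [Finset.prod_mul_distrib]
    have h3 : τ ^ N * (h (τ • ξ.1) / ∏ j, (τ • ξ.1) (v j)) = h (τ • ξ.1) / ∏ j, ξ.1 (v j) := by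
      rw [h2, mul_div_assoc', mul_div_mul_left _ _ (pow_ne_zero N h0)]
    rw [h3]
    refine hasSum_of_eq h1 fun k => ?_
    rw [(p k).map_smul_univ (fun _ => τ) fun _ => ξ.1]
    simp [mul_div_assoc]
  by_cases hm : 0 ≤ m + N
  · refine ⟨fun ξ => p (m + N).toNat fun _ => ξ, ?_, fun ξ => (key ξ).trans (if_pos hm)⟩
    have := multilinear_diag_mem_span (finBasis ℝ V) (p (m + N).toNat).toMultilinearMap
    rw [← homPoly_natCast_eq, Int.toNat_of_nonneg hm] at this
    exact this
  · exact ⟨0, Submodule.zero_mem _, fun ξ => by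
      simpa using (key ξ).trans (if_neg hm)⟩

/-! ### Passing from generic points to all regular points -/

/-- The evaluation functional at `ξ` on a space of functions. -/
def evalOn {X : Type*} (W : Submodule ℂ (X → ℂ)) (ξ : X) : Dual ℂ W :=
  (LinearMap.proj ξ : (X → ℂ) →ₗ[ℂ] ℂ) ∘ₗ W.subtype

/-- An element of W vanishing at all generic points has a numerator that vanishes on a dense set,
hence is 0. Finite-dimensional duality turns this into a spanning statement. -/
lemma span_evalOn_generic (hv : ∀ j, v j ≠ 0) (k : ℤ) (ws : Finset V) (hws : ∀ w ∈ ws, w ≠ 0) :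
    Submodule.span ℂ (Set.range fun ξ : {ξ : Regular v // ∀ w ∈ ws, ξ.1 w ≠ 0} =>
      evalOn (fracSpace v k) ξ.1) = ⊤ := by
  classical
  set S := Submodule.span ℂ (Set.range fun ξ : {ξ : Regular v // ∀ w ∈ ws, ξ.1 w ≠ 0} =>
      evalOn (fracSpace v k) ξ.1)
  have hbot : S.dualCoannihilator = ⊥ := by
    rw [eq_bot_iff]
    rintro ⟨f, P, hP, hf⟩ hfS
    rw [Submodule.mem_dualCoannihilator] at hfS
    have hP0 : Set.EqOn P (fun _ => 0) Set.univ := by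
      refine eqOn_of_generic (ws := ws ∪ Finset.univ.image v) isOpen_univ
        (continuous_of_mem_homPoly hP).continuousOn continuousOn_const ?_ fun ξ _ hξ => ?_
      · intro w hw
        rcases Finset.mem_union.1 hw with hw | hw
        · exact hws w hw
        · obtain ⟨j, -, rfl⟩ := Finset.mem_image.1 hw
          exact hv j
      · have hreg : ∀ j, ξ (v j) ≠ 0 := fun j =>
          hξ _ (Finset.mem_union_right _ (Finset.mem_image_of_mem v (Finset.mem_univ j)))
        have h1 := hfS (evalOn (fracSpace v k) ⟨ξ, hreg⟩)
          (Submodule.subset_span ⟨⟨⟨ξ, hreg⟩, fun w hw => hξ w (Finset.mem_union_left _ hw)⟩, rfl⟩)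
        change f ⟨ξ, hreg⟩ = 0 at h1
        rw [hf, div_eq_zero_iff] at h1
        exact h1.resolve_right (Finset.prod_ne_zero_iff.2 fun j _ => hreg j)
    rw [Submodule.mem_bot]
    refine Subtype.ext (funext fun ξ => ?_)
    change f ξ = 0
    rw [hf ξ, hP0 (Set.mem_univ _), zero_div]
  rw [← Subspace.dualCoannihilator_dualAnnihilator_eq (W := S), hbot,
    Submodule.dualAnnihilator_bot]

lemma exists_dual_eq_sum_eval (hv : ∀ j, v j ≠ 0) (k : ℤ) (ws : Finset V)
    (hws : ∀ w ∈ ws, w ≠ 0) (ψ : Dual ℂ (fracSpace v k)) :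
    ∃ (t : Finset {ξ : Regular v // ∀ w ∈ ws, ξ.1 w ≠ 0})
      (a : {ξ : Regular v // ∀ w ∈ ws, ξ.1 w ≠ 0} → ℂ),
      ∀ f : fracSpace v k, ψ f = ∑ ξ ∈ t, a ξ * f.1 ξ.1 := by
  have h : ψ ∈ Submodule.span ℂ (Set.range fun ξ : {ξ : Regular v // ∀ w ∈ ws, ξ.1 w ≠ 0} =>
      evalOn (fracSpace v k) ξ.1) := by
    rw [span_evalOn_generic hv k ws hws]; trivial
  obtain ⟨c, rfl⟩ := Finsupp.mem_span_range_iff_exists_finsupp.1 h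
  refine ⟨c.support, c, fun f => ?_⟩
  simp [Finsupp.sum, LinearMap.sum_apply, evalOn]

/-- Coordinates in a basis of W are finite combinations of values at generic points, so they inherit
polynomiality in s. -/
lemma isPolynomialOn_of_generic (hv : ∀ j, v j ≠ 0) {k : ℤ} {ws : Finset V}
    (hws : ∀ w ∈ ws, w ≠ 0) {a : Set V} {F : V → Regular v → ℂ}
    (hF : ∀ s, F s ∈ fracSpace v k)
    (h : ∀ ξ : Regular v, (∀ w ∈ ws, ξ.1 w ≠ 0) → ∃ p ∈ polyFun V, ∀ s ∈ a, F s ξ = p s) :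
    IsPolynomialOn a (fracSpace v k) F := by
  let b := finBasis ℂ (fracSpace v k)
  choose p hp hpF using fun ξ : {ξ : Regular v // ∀ w ∈ ws, ξ.1 w ≠ 0} => h ξ.1 ξ.2
  choose t c htc using fun i => exists_dual_eq_sum_eval hv k ws hws (b.coord i)
  refine ⟨_, fun i => ∑ ξ ∈ t i, c i ξ • p ξ, fun i => (b i : Regular v → ℂ), fun i => ?_,
    fun i => (b i).2, fun s hs => ?_⟩
  · exact Subalgebra.sum_mem _ fun ξ _ => Subalgebra.smul_mem _ (hp ξ) _
  · have h1 : ((∑ i, b.repr ⟨F s, hF s⟩ i • b i : fracSpace v k) : Regular v → ℂ) = F s :=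
      congrArg Subtype.val (b.sum_repr ⟨F s, hF s⟩)
    refine h1.symm.trans ?_
    rw [AddSubmonoidClass.coe_finsetSum]
    refine Finset.sum_congr rfl fun i _ => ?_
    have h2 := htc i ⟨F s, hF s⟩
    rw [Basis.coord_apply] at h2
    rw [h2]
    simp only [Finset.sum_apply, Pi.smul_apply, smul_eq_mul, Submodule.coe_smul]
    congr 1
    exact Finset.sum_congr rfl fun ξ _ => by rw [hpF ξ s hs]

lemma tendsto_of_generic (hv : ∀ j, v j ≠ 0) {k : ℤ} {ws : Finset V}
    (hws : ∀ w ∈ ws, w ≠ 0) {α : Type*} {l : Filter α} {F : α → Regular v → ℂ}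
    {G : Regular v → ℂ} (hF : ∀ t, F t ∈ fracSpace v k) (hG : G ∈ fracSpace v k)
    (h : ∀ ξ : Regular v, (∀ w ∈ ws, ξ.1 w ≠ 0) → Tendsto (fun t => F t ξ) l (𝓝 (G ξ)))
    (ξ : Regular v) : Tendsto (fun t => F t ξ) l (𝓝 (G ξ)) := by
  obtain ⟨t, c, htc⟩ := exists_dual_eq_sum_eval hv k ws hws (evalOn (fracSpace v k) ξ)
  have h1 : ∀ f (hf : f ∈ fracSpace v k), f ξ = ∑ ζ ∈ t, c ζ * f ζ.1 := fun f hf => htc ⟨f, hf⟩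
  rw [h1 G hG]
  simp only [fun s => h1 (F s) (hF s)]
  exact tendsto_finsetSum _ fun ζ _ => (h ζ.1 ζ.2).const_mul _

end HomComp

/-! ### One-sided continuity -/

section Continuity

variable {V : Type*} [NormedAddCommGroup V] [NormedSpace ℝ V] [FiniteDimensional ℝ V]
  [MeasurableSpace V] [BorelSpace V] {Λ : Submodule ℤ V} [DiscreteTopology Λ]
  [IsZLattice ℝ Λ] {L : Submodule ℝ V} {n : ℕ} {η : Fin n → Dual ℝ V}

lemma HolomorphicAfterMul.ML {c : Set V} {s : V} {N : ℕ} {v : Fin N → V}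
    (h : HolomorphicAfterMul v (SL Λ L c s)) : HolomorphicAfterMul v (ML Λ L c s) := by
  obtain ⟨H, hH, hrep⟩ := h
  refine ⟨fun ξ => Complex.exp (ξ (-s)) * H ξ, (analyticAt_exp_apply (-s) 0).mul hH, ?_⟩
  rw [IntermediateSum.ML, mul_left_comm, hrep, expGerm, ← Germ.coe_mul]
  rfl

lemma analyticAt_smul_apply (ξ : DualC V) (w : V) (τ₀ : ℂ) :
    AnalyticAt ℂ (fun τ : ℂ => (τ • ξ) w) τ₀ := by
  change AnalyticAt ℂ (fun τ : ℂ => τ * ξ w) τ₀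
  fun_prop

lemma meromorphicAt_expDen (l : List V) (ξ : DualC V) :
    MeromorphicAt (fun τ : ℂ => expDen l (τ • ξ)) 0 := by
  induction l with
  | nil => simp [expDen]
  | cons w l ih =>
    have h : AnalyticAt ℂ (fun τ : ℂ => 1 - Complex.exp ((τ • ξ) w)) 0 :=
      analyticAt_const.sub (analyticAt_smul_apply ξ w 0).cexp
    have he : (fun τ : ℂ => expDen (w :: l) (τ • ξ)) =
        (fun τ : ℂ => 1 - Complex.exp ((τ • ξ) w)) * fun τ : ℂ => expDen l (τ • ξ) := by
      funext τ
      simp [expDen]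
    rw [he]
    exact h.meromorphicAt.mul ih

/-- The Taylor coefficients of the numerator of `M^L(s, c)` along the line spanned by `ξ`. -/
def momentCoeff (μ : Measure V) (ξ : DualC V) (g : V → ℂ) (k : ℕ) : ℂ :=
  (k.factorial : ℂ)⁻¹ * ∫ x, g x * (ξ x) ^ k ∂μ

/-- The denominator does not involve s, so neither its Laurent coefficients r nor the length K of
the sum do. -/
lemma exists_homComp_ML_eq_sum (hL : IsRationalSubspace Λ L) (hline : ¬ ContainsLine (coneOf η))
    {l : List V} (hl : ∀ w ∈ l, w ∈ Λ ∧ w ≠ 0) (hb : BddSupp (diffOp l (indC (coneOf η))))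
    {ξ : DualC V} (hξ : ∀ w ∈ l, ξ w ≠ 0) (m : ℤ) :
    ∃ (K : ℕ) (r : ℕ → ℂ), ∀ s, homComp (ML Λ L (coneOf η) s) m ξ =
      ∑ k ∈ Finset.range K,
        momentCoeff (sliceMeasure Λ L s) ξ (diffOp l (indC (coneOf η))) k * r k := by
  obtain ⟨r, hr⟩ := exists_hasLaurent (meromorphicAt_expDen l ξ).inv
  obtain ⟨j₀, hj₀⟩ := hr.1
  refine ⟨(m - j₀ + 1).toNat, fun k => r (m - k), fun s => ?_⟩
  have hμ := adm_sliceMeasure (Λ := Λ) hL s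
  rw [ML_eq hL hline hl hb]
  have h := HasLaurent.powerSeries_mul (fun τ => hb.hasSum_expInt_smul hμ ξ τ) hj₀ hr
  exact homComp_div_expDen (hb.analyticAt_expInt hμ 0) hξ h m

lemma sliceMeasure_sub (s u : V) :
    sliceMeasure Λ L (s - u) = (sliceMeasure Λ L s).map fun x => x + u := by
  have hm : Measurable fun x : V => x + u := measurable_add_const u
  have h1 : ∀ y : projLattice Λ L,
      Measurable fun x : L => Quotient.out (y : V ⧸ L) + (x : V) - s := fun y => by fun_prop
  conv_rhs => rw [sliceMeasure, Measure.map_sum hm.aemeasurable]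
  simp only [Measure.map_map hm (h1 _)]
  rw [sliceMeasure]
  congr 1
  funext y
  congr 1
  funext x
  simp only [Function.comp_apply]
  abel

/-- Moving in a direction u of the cone, points inside stay inside, while a strictly violated
inequality remains violated for small t. -/
lemma eventually_diffOp_indC_eq {u : V} (hu : u ∈ coneOf η) (l : List V) (x : V) :
    ∀ᶠ t : ℝ in 𝓝[>] 0,
      diffOp l (indC (coneOf η)) (x + t • u) = diffOp l (indC (coneOf η)) x := by
  induction l generalizing x with
  | nil =>
    simp only [diffOp]
    by_cases hx : x ∈ coneOf η
    · filter_upwards [self_mem_nhdsWithin] with t ht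
      rw [indC_of_mem hx, indC_of_mem]
      intro j
      rw [map_add, map_smul, smul_eq_mul]
      exact add_nonneg (hx j) (mul_nonneg (le_of_lt ht) (hu j))
    · obtain ⟨j, hj⟩ : ∃ j, η j x < 0 := by
        by_contra! h
        exact hx h
      have hc : Continuous fun t : ℝ => η j x + t * η j u := by fun_prop
      have h0 : ∀ᶠ t : ℝ in 𝓝 0, η j x + t * η j u < 0 :=
        (hc.tendsto 0).eventually_lt_const (by simpa using hj)
      filter_upwards [h0.filter_mono nhdsWithin_le_nhds] with t ht
      rw [indC_of_notMem hx, indC_of_notMem]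
      intro h
      have := h j
      rw [map_add, map_smul, smul_eq_mul] at this
      linarith
  | cons w l ih =>
    filter_upwards [ih x, ih (x - w)] with t h1 h2
    simp only [diffOp]
    rw [h1, add_sub_right_comm, h2]

lemma tendsto_momentCoeff (hL : IsRationalSubspace Λ L) {l : List V}
    (hb : BddSupp (diffOp l (indC (coneOf η)))) {u : V} (hu : u ∈ coneOf η) (s : V) (ξ : DualC V)
    (k : ℕ) :
    Tendsto (fun t : ℝ => momentCoeff (sliceMeasure Λ L (s - t • u)) ξ
        (diffOp l (indC (coneOf η))) k)
      (𝓝[>] 0) (𝓝 (momentCoeff (sliceMeasure Λ L s) ξ (diffOp l (indC (coneOf η))) k)) := by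
  have hμ := adm_sliceMeasure (Λ := Λ) hL s
  have hev := eventually_diffOp_indC_eq hu l
  set g := diffOp l (indC (coneOf η))
  obtain ⟨mg, ⟨C, hC⟩, R, hR⟩ := hb
  refine Tendsto.const_mul _ ?_
  have he : ∀ t : ℝ, ∫ x, g x * (ξ x) ^ k ∂(sliceMeasure Λ L (s - t • u)) =
      ∫ x, g (x + t • u) * (ξ (x + t • u)) ^ k ∂(sliceMeasure Λ L s) := by
    intro t
    have hme : MeasurableEmbedding fun x : V => x + t • u :=
      (Homeomorph.addRight (t • u)).measurableEmbedding
    rw [sliceMeasure_sub, hme.integral_map]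
  simp only [he]
  -- For 0 < t < 1, the translate of the support by -tu stays in the ball of radius S.
  set S := |R| + ‖u‖
  have hC0 : 0 ≤ C := (norm_nonneg _).trans (hC 0)
  refine tendsto_integral_filter_of_dominated_convergence
    ((Metric.closedBall (0 : V) S).indicator fun _ => C * (‖ξ‖ * (S + ‖u‖)) ^ k) ?_ ?_ ?_ ?_
  · refine Eventually.of_forall fun t => ?_
    exact ((mg.comp (measurable_add_const _)).mul (by fun_prop)).aestronglyMeasurable
  · have h1 : ∀ᶠ t : ℝ in 𝓝[>] 0, t < 1 :=
      (eventually_lt_nhds zero_lt_one).filter_mono nhdsWithin_le_nhds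
    filter_upwards [h1, self_mem_nhdsWithin] with t ht1 ht0
    refine Eventually.of_forall fun x => ?_
    have ht : ‖t • u‖ ≤ ‖u‖ := by
      rw [norm_smul, Real.norm_of_nonneg (le_of_lt ht0)]
      exact mul_le_of_le_one_left (norm_nonneg _) ht1.le
    by_cases hx : x ∈ Metric.closedBall (0 : V) S
    · rw [Set.indicator_of_mem hx, norm_mul, norm_pow]
      rw [mem_closedBall_zero_iff] at hx
      have h2 : ‖ξ (x + t • u)‖ ≤ ‖ξ‖ * (S + ‖u‖) :=
        (ξ.le_opNorm _).trans (by gcongr; exact (norm_add_le _ _).trans (add_le_add hx ht))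
      gcongr
      exact hC _
    · rw [Set.indicator_of_notMem hx]
      rw [mem_closedBall_zero_iff, not_le] at hx
      have h3 : R < ‖x + t • u‖ := by
        have h4 := norm_sub_le (x + t • u) (t • u)
        rw [add_sub_cancel_right] at h4
        have h5 := le_abs_self R
        simp only [S] at hx
        linarith
      rw [hR _ h3]
      simp
  · rw [integrable_indicator_iff Metric.isClosed_closedBall.measurableSet]
    exact integrableOn_const (hμ.fin _).ne
  · refine Eventually.of_forall fun x => ?_
    have h1 : Tendsto (fun t : ℝ => g (x + t • u)) (𝓝[>] 0) (𝓝 (g x)) :=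
      tendsto_const_nhds.congr' ((hev x).mono fun t h => h.symm)
    have hc : Continuous fun t : ℝ => (ξ (x + t • u)) ^ k := by fun_prop
    have h2 : Tendsto (fun t : ℝ => (ξ (x + t • u)) ^ k) (𝓝[>] 0) (𝓝 ((ξ x) ^ k)) :=
      (hc.tendsto' 0 _ (by simp)).mono_left nhdsWithin_le_nhds
    exact h1.mul h2

theorem tendsto_homComp_ML (hL : IsRationalSubspace Λ L) {c : Set V} (hc : IsRationalCone Λ c)
    {N : ℕ} {v : Fin N → V} (hv : ∀ j, v j ≠ 0)
    (hhol : ∀ s : V, HolomorphicAfterMul v (SL Λ L c s)) (m : ℤ) (s : V) {x : V}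
    (hx : x ∈ (L : Set V) - c) {ξ : DualC V} (hξ : ∀ j, ξ (v j) ≠ 0) :
    Tendsto (fun t : ℝ => homComp (ML Λ L c (s + t • x)) m ξ) (𝓝[>] 0)
      (𝓝 (homComp (ML Λ L c s) m ξ)) := by
  classical
  by_cases hline : ContainsLine c
  · have h0 : ∀ s, ML Λ L c s = 0 := fun s => by rw [ML, SL_eq_zero hline, mul_zero]
    simp only [h0]
    exact tendsto_const_nhds
  obtain ⟨n, η, hη, rfl⟩ := hc
  change ¬ ContainsLine (coneOf η) at hline
  obtain ⟨y, hy, u, hu, rfl⟩ := Set.mem_sub.1 hx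
  obtain ⟨l, hl, hb⟩ := exists_list_bddSupp (IsZLattice.span_top (K := ℝ) (L := Λ)) hη
  refine tendsto_of_generic (F := fun t ζ => homComp (ML Λ L (coneOf η) (s + t • (y - u))) m ζ.1)
    (G := fun ζ => homComp (ML Λ L (coneOf η) s) m ζ.1) hv (ws := l.toFinset)
    (fun w hw => (hl w (List.mem_toFinset.1 hw)).2)
    (fun t => homComp_mem_fracSpace (hhol _).ML m) (homComp_mem_fracSpace (hhol _).ML m)
    (fun ζ hζ => ?_) ⟨ξ, hξ⟩
  obtain ⟨K, r, hr⟩ := exists_homComp_ML_eq_sum hL hline hl hb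
    (fun w hw => hζ w (List.mem_toFinset.2 hw)) m
  simp only [hr]
  refine tendsto_finsetSum _ fun k _ => Tendsto.mul_const _ ?_
  -- The component of the direction along L is invisible to the slice measure; only -u remains.
  have hcongr : ∀ t : ℝ, sliceMeasure Λ L (s + t • (y - u)) = sliceMeasure Λ L (s - t • u) := by
    intro t
    refine sliceMeasure_congr hL ((Submodule.Quotient.eq L).2 ?_)
    have : s + t • (y - u) - (s - t • u) = t • y := by rw [smul_sub]; abel
    rw [this]
    exact L.smul_mem t hy
  simp only [hcongr]
  exact tendsto_momentCoeff hL hb hu s ζ.1 k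

end Continuity

/-! ### Simplicial cones and half-open boxes -/

section Boxes

variable {E : Type*} [NormedAddCommGroup E] [NormedSpace ℝ E] [FiniteDimensional ℝ E]
  {ι : Type*} [Fintype ι]

open Classical in
/-- The indicator function of `[0, ∞)`. -/
def stepFun (t : ℝ) : ℂ := if 0 ≤ t then 1 else 0

open Classical in
/-- The indicator function of `[0, 1)`. -/
def unitFun (t : ℝ) : ℂ := if 0 ≤ t ∧ t < 1 then 1 else 0

lemma stepFun_sub (t : ℝ) : stepFun t - stepFun (t - 1) = unitFun t := by
  unfold stepFun unitFun
  by_cases h1 : 0 ≤ t <;> by_cases h2 : t < 1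
  · rw [if_pos h1, if_neg (by linarith), if_pos ⟨h1, h2⟩, sub_zero]
  · rw [if_pos h1, if_pos (by linarith), if_neg (fun h => h2 h.2), sub_self]
  · rw [if_neg h1, if_neg (by linarith), if_neg (fun h => h1 h.1), sub_self]
  · exact absurd (not_lt.1 h2) (by linarith)

/-- The indicator function of the half-open box `{x | ∀ i, 0 ≤ β i x < 1}`. -/
def boxFun (β : ι → Dual ℝ E) (x : E) : ℂ := ∏ i, unitFun (β i x)

lemma indC_eq_prod (β : ι → Dual ℝ E) (x : E) :
    indC {x | ∀ i, 0 ≤ β i x} x = ∏ i, stepFun (β i x) := by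
  by_cases h : ∀ i, 0 ≤ β i x
  · rw [indC_of_mem (show x ∈ {x | ∀ i, 0 ≤ β i x} from h)]
    exact (Finset.prod_eq_one fun i _ => if_pos (h i)).symm
  · rw [indC_of_notMem (show x ∉ {x | ∀ i, 0 ≤ β i x} from h)]
    push Not at h
    obtain ⟨i, hi⟩ := h
    exact (Finset.prod_eq_zero (Finset.mem_univ i) (if_neg (not_le.2 hi))).symm

/-- `β` and `w` are dual bases of `E`. -/
structure IsDualPair (β : ι → Dual ℝ E) (w : ι → E) : Prop where
  apply_self : ∀ i, β i (w i) = 1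
  apply_ne : ∀ i j, i ≠ j → β i (w j) = 0
  sum_eq : ∀ x, ∑ i, β i x • w i = x

lemma isDualPair_basis (b : Basis ι ℝ E) : IsDualPair (fun i => b.coord i) b where
  apply_self i := by simp
  apply_ne i j h := by simp [h.symm]
  sum_eq x := b.sum_repr x

variable {β : ι → Dual ℝ E} {w : ι → E}

open Classical in
-- By duality, translation by w a changes only the factor of index a, where the difference of two
-- step functions is the indicator function of [0, 1).
lemma IsDualPair.diffOp_prod (h : IsDualPair β w) (l : List ι) (hl : l.Nodup) (x : E) :
    diffOp (l.map w) (fun x => ∏ i, stepFun (β i x)) x =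
      ∏ i, if i ∈ l then unitFun (β i x) else stepFun (β i x) := by
  induction l generalizing x with
  | nil => simp [diffOp]
  | cons a l ih =>
    rw [List.nodup_cons] at hl
    simp only [List.map_cons, diffOp]
    rw [ih hl.2, ih hl.2]
    rw [← Finset.mul_prod_erase _ _ (Finset.mem_univ a),
      ← Finset.mul_prod_erase _ (fun i => if i ∈ l then unitFun (β i (x - w a))
        else stepFun (β i (x - w a))) (Finset.mem_univ a),
      ← Finset.mul_prod_erase _ (fun i => if i ∈ a :: l then unitFun (β i x)
        else stepFun (β i x)) (Finset.mem_univ a)]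
    have h1 : ∏ i ∈ Finset.univ.erase a, (if i ∈ l then unitFun (β i (x - w a))
        else stepFun (β i (x - w a))) = ∏ i ∈ Finset.univ.erase a, (if i ∈ l then unitFun (β i x)
        else stepFun (β i x)) := by
      refine Finset.prod_congr rfl fun i hi => ?_
      rw [map_sub, h.apply_ne i a (Finset.ne_of_mem_erase hi), sub_zero]
    have h2 : ∏ i ∈ Finset.univ.erase a, (if i ∈ a :: l then unitFun (β i x)
        else stepFun (β i x)) = ∏ i ∈ Finset.univ.erase a, (if i ∈ l then unitFun (β i x)
        else stepFun (β i x)) := by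
      refine Finset.prod_congr rfl fun i hi => ?_
      simp [Finset.ne_of_mem_erase hi]
    rw [h1, h2, ← sub_mul, if_neg hl.1, if_neg hl.1, if_pos List.mem_cons_self, map_sub,
      h.apply_self, stepFun_sub]

lemma IsDualPair.diffOp_indC (h : IsDualPair β w) :
    diffOp ((Finset.univ : Finset ι).toList.map w) (indC {x | ∀ i, 0 ≤ β i x}) = boxFun β := by
  classical
  have : indC {x | ∀ i, 0 ≤ β i x} = fun x => ∏ i, stepFun (β i x) :=
    funext fun x => indC_eq_prod β x
  rw [this]
  funext x
  rw [h.diffOp_prod _ (Finset.nodup_toList _)]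
  simp [boxFun]

lemma unitFun_ne_zero {t : ℝ} (h : unitFun t ≠ 0) : 0 ≤ t ∧ t < 1 := by
  by_contra h'
  exact h (if_neg h')

variable [MeasurableSpace E] [BorelSpace E]

lemma IsDualPair.bddSupp_boxFun (h : IsDualPair β w) : BddSupp (boxFun β) where
  meas := by
    have hu : Measurable unitFun :=
      Measurable.ite ((measurableSet_le measurable_const measurable_id).inter
        (measurableSet_lt measurable_id measurable_const)) measurable_const measurable_const
    exact Finset.measurable_prod _ fun i _ =>
      hu.comp (β i).continuous_of_finiteDimensional.measurable
  bdd := by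
    refine ⟨1, fun x => ?_⟩
    rw [boxFun, norm_prod]
    refine Finset.prod_le_one (fun _ _ => norm_nonneg _) fun i _ => ?_
    unfold unitFun
    split_ifs <;> simp
  supp := by
    refine ⟨∑ i, ‖w i‖, fun x hx => ?_⟩
    by_contra h0
    have h1 : ∀ i, 0 ≤ β i x ∧ β i x < 1 := fun i =>
      unitFun_ne_zero fun h2 => h0 (Finset.prod_eq_zero (Finset.mem_univ i) h2)
    refine absurd hx (not_lt.2 ?_)
    conv_lhs => rw [← h.sum_eq x]
    refine (norm_sum_le _ _).trans (Finset.sum_le_sum fun i _ => ?_)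
    rw [norm_smul, Real.norm_of_nonneg (h1 i).1]
    exact mul_le_of_le_one_left (norm_nonneg _) (h1 i).2.le

lemma IsDualPair.isExt (h : IsDualPair β w) {Λ : Submodule ℤ E} (hw : ∀ i, w i ∈ Λ)
    (μ : Measure E) {ξ : DualC E} (hξ : ∀ i, Complex.exp (ξ (w i)) ≠ 1) :
    IsExt Λ μ ξ (indC {x | ∀ i, 0 ≤ β i x})
      (expInt μ ξ (boxFun β) / ∏ i, (1 - Complex.exp (ξ (w i)))) := by
  refine ⟨(Finset.univ : Finset ι).toList.map w, ?_, ?_, ?_⟩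
  · intro x hx
    obtain ⟨i, -, rfl⟩ := List.mem_map.1 hx
    exact ⟨hw i, hξ i⟩
  · rw [h.diffOp_indC]
    exact h.bddSupp_boxFun
  · have hd : expDen ((Finset.univ : Finset ι).toList.map w) ξ =
        ∏ i, (1 - Complex.exp (ξ (w i))) := by
      rw [expDen, List.map_map]
      exact Finset.prod_map_toList _ _
    rw [h.diffOp_indC, hd, mul_div_cancel₀]
    exact Finset.prod_ne_zero_iff.2 fun i _ => sub_ne_zero.2 (hξ i).symm

/-- The half-open box of a lattice basis is a fundamental domain, so it contains exactly one point
of Γ - s, whose coordinates are ⌈s_i⌉ - s_i. -/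
lemma expInt_latticeCount_boxFun (u : Basis ι ℝ E) {Γ : Submodule ℤ E} [Countable Γ]
    (hu : Submodule.span ℤ (Set.range u) = Γ) (s : E) (ξ : DualC E) :
    expInt (latticeCount Γ s) ξ (boxFun fun i => u.coord i) =
      Complex.exp (ξ (∑ i, (⌈u.coord i s⌉ - u.coord i s : ℝ) • u i)) := by
  have h0 : latticeCount Γ s = Measure.sum fun y : Γ => (1 : ENNReal) • Measure.dirac ((y : E) - s) := by
    simp only [one_smul]
    rfl
  rw [expInt, h0, integral_sum_dirac fun _ => ENNReal.one_ne_top]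
  have hmem : ∀ a : ι → ℤ, ∑ i, (a i : ℝ) • u i ∈ Γ := fun a => by
    rw [← hu]
    refine Submodule.sum_mem _ fun i _ => ?_
    rw [Int.cast_smul_eq_zsmul]
    exact Submodule.smul_mem _ _ (Submodule.subset_span (Set.mem_range_self i))
  set y₀ : Γ := ⟨∑ i, (⌈u.coord i s⌉ : ℝ) • u i, hmem _⟩ with hy₀
  have hcoord : ∀ i, u.coord i y₀ = ⌈u.coord i s⌉ := by
    classical
    intro i
    simp [hy₀, Finsupp.single_apply]
  have hs : (y₀ : E) - s = ∑ i, (⌈u.coord i s⌉ - u.coord i s : ℝ) • u i := by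
    simp only [sub_smul, Finset.sum_sub_distrib]
    congr 1
    exact (u.sum_repr s).symm
  rw [tsum_eq_single y₀, ← hs]
  · have h1 : boxFun (fun i => u.coord i) ((y₀ : E) - s) = 1 := by
      refine Finset.prod_eq_one fun i _ => if_pos ?_
      rw [map_sub, hcoord]
      have h2 := Int.le_ceil (u.coord i s)
      have h3 := Int.ceil_lt_add_one (u.coord i s)
      constructor <;> linarith
    rw [h1]
    simp
  · intro y hy
    have h1 : boxFun (fun i => u.coord i) ((y : E) - s) = 0 := by
      by_contra hne
      refine hy (Subtype.ext (u.ext_elem fun i => ?_))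
      have h2 : 0 ≤ u.coord i ((y : E) - s) ∧ u.coord i ((y : E) - s) < 1 :=
        unitFun_ne_zero fun h2 => hne (Finset.prod_eq_zero (Finset.mem_univ i) h2)
      rw [map_sub] at h2
      have hyΓ : (y : E) ∈ Submodule.span ℤ (Set.range u) := by rw [hu]; exact y.2
      obtain ⟨a, ha⟩ := (u.mem_span_iff_repr_mem ℤ (y : E)).1 hyΓ i
      have ha' : u.coord i (y : E) = a := ha.symm
      have h3 : ⌈u.coord i s⌉ = a := by
        rw [Int.ceil_eq_iff]
        rw [ha'] at h2
        constructor <;> linarith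
      have h4 := hcoord i
      rw [h3, ← ha'] at h4
      exact h4.symm
    rw [h1]
    simp

end Boxes

/-! ### Simplicial cones with a face parallel to `L` -/

section Congruence

variable {E : Type*} [NormedAddCommGroup E] [NormedSpace ℝ E] [FiniteDimensional ℝ E]
  [MeasurableSpace E] [BorelSpace E] {Λ : Submodule ℤ E}

/-- The exceptional vectors come from the congruence alone, so one generic ξ serves all the measures
μ_s at once. -/
lemma CongrModLines.exists_isExt (hΛ : Submodule.span ℝ (Λ : Set E) = ⊤) {ι : Type*} [Fintype ι]
    {c : Set E} {ε : ι → ℤˣ} {C : ι → Set E}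
    (h : CongrModLines Λ (ind c) (∑ i, ((ε i : ℤ) : ℝ) • ind (C i))) :
    ∃ ws : Finset E, (∀ w ∈ ws, w ≠ 0) ∧ ∀ ξ : DualC E, (∀ w ∈ ws, Complex.exp (ξ w) ≠ 1) →
      ∀ μ : Measure E, Adm Λ μ → ∀ Z : ι → ℂ, (∀ i, IsExt Λ μ ξ (indC (C i)) (Z i)) →
        IsExt Λ μ ξ (indC c) (∑ i, ((ε i : ℤ) : ℂ) * Z i) := by
  classical
  obtain ⟨l, hl, hneg⟩ := h.negligible hΛ
  refine ⟨l.toFinset, fun w hw => (hl w (List.mem_toFinset.1 hw)).2, fun ξ hξ μ hμ Z hZ => ?_⟩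
  have h1 := (hneg ξ (fun w hw => hξ w (List.mem_toFinset.2 hw)) μ hμ).add hμ
    (IsExt.sum hμ Finset.univ fun i _ => (hZ i).smul ((ε i : ℤ) : ℂ))
  rw [zero_add] at h1
  convert h1 using 1
  funext x
  simp [indC]

end Congruence

/-! ### Splitting a simplicial cone along its face in L -/

section Faces

variable {V : Type*} [NormedAddCommGroup V] [NormedSpace ℝ V] [FiniteDimensional ℝ V]
  {L : Submodule ℝ V} {ι : Type*} {b : Basis ι ℝ V} {I : Set ι}

lemma coord_eq_zero_of_mem_span_image {x : V} (hx : x ∈ Submodule.span ℝ (b '' I)) {j : ι}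
    (hj : j ∉ I) : b.coord j x = 0 := by
  have h : Submodule.span ℝ (b '' I) ≤ LinearMap.ker (b.coord j) := by
    rw [Submodule.span_le]
    rintro _ ⟨i, hi, rfl⟩
    have hij : i ≠ j := fun h => hj (h ▸ hi)
    simp [hij]
  exact h hx

/-- `σ` identifies `V / L` with the span of the vectors `b j`, `j ∉ I`, where `L` is the span of
the vectors `b j`, `j ∈ I`. -/
structure IsFaceSection (b : Basis ι ℝ V) (I : Set ι) (L : Submodule ℝ V)
    (σ : (V ⧸ L) →ₗ[ℝ] V) : Prop where
  span_eq : Submodule.span ℝ (b '' I) = L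
  mkQ_apply : ∀ z, L.mkQ (σ z) = z
  apply_mk : ∀ j ∉ I, σ (L.mkQ (b j)) = b j
  coord : ∀ z, ∀ j ∈ I, b.coord j (σ z) = 0

lemma exists_isFaceSection [Fintype ι] (hI : Submodule.span ℝ (b '' I) = L) :
    ∃ σ, IsFaceSection b I L σ := by
  classical
  let p : V →ₗ[ℝ] V := ∑ j, if j ∈ I then 0 else (b.coord j).smulRight (b j)
  have hp : ∀ x, p x = ∑ j, if j ∈ I then 0 else b.coord j x • b j := fun x => by
    simp only [p, LinearMap.sum_apply]
    refine Finset.sum_congr rfl fun j _ => ?_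
    split_ifs <;> simp
  have hker : L ≤ LinearMap.ker p := fun x hx => by
    rw [← hI] at hx
    rw [LinearMap.mem_ker, hp]
    refine Finset.sum_eq_zero fun j _ => ?_
    split_ifs with hj
    · rfl
    · rw [coord_eq_zero_of_mem_span_image hx hj, zero_smul]
  have hσ : ∀ x, L.liftQ p hker (L.mkQ x) = p x := fun x => L.liftQ_apply p x
  refine ⟨L.liftQ p hker, hI, fun z => ?_, fun j hj => ?_, fun z j hj => ?_⟩
  · obtain ⟨x, rfl⟩ := L.mkQ_surjective z
    rw [hσ, hp]
    refine (Submodule.Quotient.eq L).2 ?_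
    rw [← neg_mem_iff, neg_sub]
    nth_rw 1 [← b.sum_repr x]
    rw [← Finset.sum_sub_distrib]
    refine L.sum_mem fun j _ => ?_
    split_ifs with hj
    · rw [sub_zero, ← hI]
      exact Submodule.smul_mem _ _ (Submodule.subset_span ⟨j, hj, rfl⟩)
    · simp
  · rw [hσ, hp, Finset.sum_eq_single j]
    · simp [hj]
    · intro i _ hij
      simp [hij.symm]
    · simp
  · obtain ⟨x, rfl⟩ := L.mkQ_surjective z
    rw [hσ, hp, map_sum]
    refine Finset.sum_eq_zero fun i _ => ?_
    split_ifs with hi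
    · simp
    · have hij : i ≠ j := fun h => hi (h ▸ hj)
      simp [hij]

namespace IsFaceSection

variable {σ : (V ⧸ L) →ₗ[ℝ] V}

lemma mem (h : IsFaceSection b I L σ) {j : ι} (hj : j ∈ I) : b j ∈ L := by
  rw [← h.span_eq]
  exact Submodule.subset_span ⟨j, hj, rfl⟩

lemma coord_coe (h : IsFaceSection b I L σ) {x : V} (hx : x ∈ L) {j : ι} (hj : j ∉ I) :
    b.coord j x = 0 :=
  coord_eq_zero_of_mem_span_image (h.span_eq ▸ hx) hj

lemma coord_mk (h : IsFaceSection b I L σ) (x : V) {j : ι} (hj : j ∉ I) :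
    b.coord j (σ (L.mkQ x)) = b.coord j x := by
  have h1 : x - σ (L.mkQ x) ∈ L := (Submodule.Quotient.eq L).1 (h.mkQ_apply (L.mkQ x)).symm
  have h2 := h.coord_coe h1 hj
  rw [map_sub] at h2
  linarith

lemma image_basisCone (h : IsFaceSection b I L σ) :
    L.mkQ '' basisCone b = {z | ∀ j : {j // j ∉ I}, 0 ≤ (b.coord j ∘ₗ σ) z} := by
  ext z
  constructor
  · rintro ⟨x, hx, rfl⟩ j
    rw [LinearMap.comp_apply, h.coord_mk x j.2]
    exact hx j
  · intro hz
    refine ⟨σ z, fun j => ?_, h.mkQ_apply z⟩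
    by_cases hj : j ∈ I
    · exact (h.coord z j hj).ge
    · exact hz ⟨j, hj⟩

variable [Fintype ι] [DecidablePred (· ∈ I)]

lemma isDualPair_quotient (h : IsFaceSection b I L σ) :
    IsDualPair (fun j : {j // j ∉ I} => b.coord j ∘ₗ σ) (fun j => L.mkQ (b j)) where
  apply_self j := by
    rw [LinearMap.comp_apply, h.apply_mk j j.2]
    simp
  apply_ne i j hij := by
    have hij' : (j : ι) ≠ i := fun h => hij (Subtype.ext h.symm)
    rw [LinearMap.comp_apply, h.apply_mk j j.2]
    simp [hij']
  sum_eq z := by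
    conv_rhs => rw [← h.mkQ_apply z, ← b.sum_repr (σ z), ← Fintype.sum_subtype_add_sum_subtype (· ∈ I)]
    rw [map_add, map_sum, map_sum, Finset.sum_eq_zero fun (j : {j // j ∈ I}) _ => ?_, zero_add]
    · rfl
    · rw [← Basis.coord_apply, h.coord z j j.2, zero_smul, map_zero]

lemma isDualPair_face (h : IsFaceSection b I L σ) :
    IsDualPair (fun j : {j // j ∈ I} => b.coord j ∘ₗ L.subtype)
      (fun j => (⟨b j, h.mem j.2⟩ : L)) where
  apply_self j := by simp
  apply_ne i j hij := by
    have hij' : (j : ι) ≠ i := fun h => hij (Subtype.ext h.symm)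
    simp [hij']
  sum_eq x := by
    refine Subtype.ext ?_
    conv_rhs => rw [← b.sum_repr (x : V), ← Fintype.sum_subtype_add_sum_subtype (· ∈ I)]
    rw [Finset.sum_eq_zero (s := (Finset.univ : Finset {j // j ∉ I})) fun j _ => ?_, add_zero]
    · simp
    · rw [← Basis.coord_apply, h.coord_coe x.2 j.2, zero_smul]

lemma boxFun_add (h : IsFaceSection b I L σ) (z : V ⧸ L) (x : L) :
    boxFun (fun j => b.coord j) (σ z + (x : V)) =
      boxFun (fun j : {j // j ∉ I} => b.coord j ∘ₗ σ) z *
        boxFun (fun j : {j // j ∈ I} => b.coord j ∘ₗ L.subtype) x := by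
  rw [boxFun, ← Fintype.prod_subtype_mul_prod_subtype (· ∈ I), mul_comm, boxFun, boxFun]
  congr 1
  · refine Finset.prod_congr rfl fun j _ => ?_
    rw [map_add, h.coord_coe x.2 j.2, add_zero]
    rfl
  · refine Finset.prod_congr rfl fun j _ => ?_
    rw [map_add, h.coord z j j.2, zero_add]
    rfl

end IsFaceSection

variable [MeasurableSpace V] [BorelSpace V] {Λ : Submodule ℤ V} [DiscreteTopology Λ]
  [IsZLattice ℝ Λ]

lemma adm_subspaceMeasure (hL : IsRationalSubspace Λ L) :
    Adm (interLattice Λ L) (subspaceMeasure Λ L) where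
  inv w _ := by
    have := isAddHaarMeasure_subspaceMeasure hL
    exact map_add_right_eq_self _ w
  fin R := by
    have := isAddHaarMeasure_subspaceMeasure hL
    exact (isCompact_closedBall (0 : L) R).measure_lt_top

/-- The pullback of linear forms by a section of the projection to `V / L`. -/
def pullback (σ : (V ⧸ L) →ₗ[ℝ] V) (ξ : DualC V) : DualC (V ⧸ L) :=
  ξ.comp (LinearMap.toContinuousLinearMap σ)

lemma pullback_apply (σ : (V ⧸ L) →ₗ[ℝ] V) (ξ : DualC V) (z : V ⧸ L) :
    pullback σ ξ z = ξ (σ z) := rfl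

variable [Fintype ι] [DecidablePred (· ∈ I)]

/-- The box, the exponential and the slice measure all split along V/L × L, so Fubini applies; only
the factor on V/L sees s. -/
lemma IsFaceSection.expInt_boxFun {σ : (V ⧸ L) →ₗ[ℝ] V} (h : IsFaceSection b I L σ)
    (hL : IsRationalSubspace Λ L) (s : V) (ξ : DualC V) :
    expInt (sliceMeasure Λ L s) ξ (boxFun fun j => b.coord j) =
      expInt (latticeCount (projLattice Λ L) (L.mkQ s)) (pullback σ ξ)
          (boxFun fun j : {j // j ∉ I} => b.coord j ∘ₗ σ) *
        expInt (subspaceMeasure Λ L) (ξ.comp L.subtypeL)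
          (boxFun fun j : {j // j ∈ I} => b.coord j ∘ₗ L.subtype) := by
  have := isAddHaarMeasure_subspaceMeasure hL
  have := countable_projLattice (Λ := Λ) hL
  have hsf : SFinite (latticeCount (projLattice Λ L) (L.mkQ s)) := by
    unfold latticeCount
    infer_instance
  have hc : Continuous σ := σ.continuous_of_finiteDimensional
  have hm : Measurable fun p : (V ⧸ L) × L => σ p.1 + (p.2 : V) :=
    ((hc.measurable.comp measurable_fst).add (measurable_subtype_coe.comp measurable_snd))
  have hmeas : Measurable fun x : V => boxFun (fun j => b.coord j) x * Complex.exp (ξ x) :=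
    (isDualPair_basis b).bddSupp_boxFun.meas.mul (by fun_prop)
  rw [expInt, sliceMeasure_eq_map_prod hL s h.mkQ_apply,
    integral_map hm.aemeasurable hmeas.aestronglyMeasurable, expInt, expInt, ← integral_prod_mul]
  refine integral_congr_ae (Eventually.of_forall fun p => ?_)
  simp only [h.boxFun_add, map_add, Complex.exp_add, pullback_apply]
  change _ = _ * (_ * Complex.exp (ξ (p.2 : V)))
  ring

end Faces

/-! ### Explicit formula for `M^L(s, c)` -/

section Formula

variable {V : Type*} [NormedAddCommGroup V] [NormedSpace ℝ V] [FiniteDimensional ℝ V]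
  [MeasurableSpace V] [BorelSpace V] {Λ : Submodule ℤ V} [DiscreteTopology Λ]
  [IsZLattice ℝ Λ] {L : Submodule ℝ V} {ι κ : Type*} [Fintype ι] [Fintype κ]

/-- The contribution of the face parallel to `L` to the generating function of a simplicial
cone. -/
def faceFactor (Λ : Submodule ℤ V) (L : Submodule ℝ V) (b : Basis ι ℝ V) (I : Set ι)
    [DecidablePred (· ∈ I)] (ξ : DualC V) : ℂ :=
  expInt (subspaceMeasure Λ L) (ξ.comp L.subtypeL)
      (boxFun fun j : {j // j ∈ I} => b.coord j ∘ₗ L.subtype) /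
    ∏ j : {j // j ∈ I}, (1 - Complex.exp (ξ (b j)))

/-- The lift to `V` of the difference between the projection of `s` and the lattice point obtained
by rounding up its coordinates in the basis `u`. -/
def ceilShift (σ : (V ⧸ L) →ₗ[ℝ] V) (u : Basis κ ℝ (V ⧸ L)) (s : V) : V :=
  σ (∑ j, (⌈u.coord j (L.mkQ s)⌉ - u.coord j (L.mkQ s) : ℝ) • u j)

lemma IsFaceSection.exists_isExt_basisCone {b : Basis ι ℝ V} {I : Set ι} [DecidablePred (· ∈ I)]
    {σ : (V ⧸ L) →ₗ[ℝ] V} (h : IsFaceSection b I L σ) (hL : IsRationalSubspace Λ L)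
    (hb : ∀ j, b j ∈ Λ) {ρ : Type*} [Fintype ρ] {δ : ρ → ℤˣ} {u : ρ → Basis κ ℝ (V ⧸ L)}
    (hu : ∀ l, Submodule.span ℤ (Set.range (u l)) = projLattice Λ L)
    (hcongr : CongrModLines (projLattice Λ L) (ind (L.mkQ '' basisCone b))
      (∑ l, ((δ l : ℤ) : ℝ) • ind (basisCone (u l)))) :
    ∃ ws : Finset V, (∀ w ∈ ws, w ≠ 0) ∧ ∀ ξ : DualC V, (∀ w ∈ ws, Complex.exp (ξ w) ≠ 1) →
      ∀ s, IsExt Λ (sliceMeasure Λ L s) ξ (indC (basisCone b))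
        (∑ l, Complex.exp (ξ (ceilShift σ (u l) s)) * (((δ l : ℤ) : ℂ) * (faceFactor Λ L b I ξ /
          ∏ j, (1 - Complex.exp (ξ (σ (u l j))))))) := by
  classical
  have := discreteTopology_projLattice (Λ := Λ) hL
  have := countable_projLattice (Λ := Λ) hL
  obtain ⟨ws, hws, hext⟩ := hcongr.exists_isExt span_projLattice
  have hσ0 : ∀ z, z ≠ 0 → σ z ≠ 0 := fun z hz h0 => hz (by
    rw [← h.mkQ_apply z, h0, map_zero])
  refine ⟨Finset.univ.image b ∪ (Finset.univ.image fun p : ρ × κ => σ (u p.1 p.2)) ∪ ws.image σ,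
    ?_, fun ξ hξ s => ?_⟩
  · intro w hw
    rcases Finset.mem_union.1 hw with hw | hw
    · rcases Finset.mem_union.1 hw with hw | hw
      · obtain ⟨j, -, rfl⟩ := Finset.mem_image.1 hw
        exact b.ne_zero j
      · obtain ⟨p, -, rfl⟩ := Finset.mem_image.1 hw
        exact hσ0 _ ((u p.1).ne_zero _)
    · obtain ⟨z, hz, rfl⟩ := Finset.mem_image.1 hw
      exact hσ0 _ (hws z hz)
  have hξb : ∀ j, Complex.exp (ξ (b j)) ≠ 1 := fun j => hξ _ (by simp)
  have hξu : ∀ l j, Complex.exp (ξ (σ (u l j))) ≠ 1 := fun l j => hξ _ (by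
    refine Finset.mem_union_left _ (Finset.mem_union_right _ (Finset.mem_image.2 ⟨(l, j), ?_⟩))
    simp)
  have hξws : ∀ w ∈ ws, Complex.exp (pullback σ ξ w) ≠ 1 := fun w hw =>
    hξ _ (Finset.mem_union_right _ (Finset.mem_image_of_mem _ hw))
  have hμ := adm_latticeCount (projLattice Λ L) (L.mkQ s)
  have h1 := hext (pullback σ ξ) hξws _ hμ _ fun l =>
    (isDualPair_basis (u l)).isExt (Λ := projLattice Λ L)
      (fun j => (hu l) ▸ Submodule.subset_span (Set.mem_range_self j))
      (latticeCount (projLattice Λ L) (L.mkQ s)) (hξu l)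
  have h2 := h.isDualPair_quotient.isExt (Λ := projLattice Λ L) (fun j => mk_mem_projLattice (hb j))
    (latticeCount (projLattice Λ L) (L.mkQ s)) (ξ := pullback σ ξ) (fun j => by
      rw [pullback_apply, h.apply_mk j j.2]
      exact hξb j)
  rw [← h.image_basisCone] at h2
  -- Both sides regularize the projected cone against the same lattice count, once through its own
  -- generators and once through the unimodular decomposition.
  have h3 := h2.unique hμ h1
  have h4 := (isDualPair_basis b).isExt hb (sliceMeasure Λ L s) hξb
  have h5 : expInt (sliceMeasure Λ L s) ξ (boxFun fun j => b.coord j) /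
      ∏ j, (1 - Complex.exp (ξ (b j))) =
      expInt (latticeCount (projLattice Λ L) (L.mkQ s)) (pullback σ ξ)
        (boxFun fun j : {j // j ∉ I} => b.coord j ∘ₗ σ) /
        (∏ j : {j // j ∉ I}, (1 - Complex.exp (pullback σ ξ (L.mkQ (b j))))) *
        faceFactor Λ L b I ξ := by
    have h6 : ∀ j : {j // j ∉ I}, pullback σ ξ (L.mkQ (b j)) = ξ (b j) := fun j => by
      rw [pullback_apply, h.apply_mk j j.2]
    simp only [h6]
    rw [h.expInt_boxFun hL, ← Fintype.prod_subtype_mul_prod_subtype (· ∈ I), faceFactor,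
      div_mul_div_comm, mul_comm (∏ j : {j // j ∈ I}, _)]
  rw [h5, h3, Finset.sum_mul] at h4
  refine cast (congrArg _ (Finset.sum_congr rfl fun l _ => ?_)) h4
  rw [expInt_latticeCount_boxFun (u l) (hu l)]
  simp only [pullback_apply, ceilShift]
  ring

lemma analyticAt_expInt_smul {E : Type*} [NormedAddCommGroup E] [NormedSpace ℝ E]
    [FiniteDimensional ℝ E] [MeasurableSpace E] [BorelSpace E] {Γ : Submodule ℤ E} {μ : Measure E}
    (hμ : Adm Γ μ) {f : E → ℂ} (hf : BddSupp f) (ξ : DualC E) (τ₀ : ℂ) :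
    AnalyticAt ℂ (fun τ : ℂ => expInt μ (τ • ξ) f) τ₀ :=
  AnalyticAt.comp (f := fun τ : ℂ => τ • ξ) (hf.analyticAt_expInt hμ (τ₀ • ξ))
    (analyticAt_id.smul analyticAt_const)

lemma analyticAt_one_sub_exp_smul (ξ : DualC V) (w : V) (τ₀ : ℂ) :
    AnalyticAt ℂ (fun τ : ℂ => 1 - Complex.exp ((τ • ξ) w)) τ₀ :=
  analyticAt_const.sub (analyticAt_smul_apply ξ w τ₀).cexp

lemma IsFaceSection.meromorphicAt_faceFactor {b : Basis ι ℝ V} {I : Set ι}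
    [DecidablePred (· ∈ I)] {σ : (V ⧸ L) →ₗ[ℝ] V} (h : IsFaceSection b I L σ)
    (hL : IsRationalSubspace Λ L) (ξ : DualC V) :
    MeromorphicAt (fun τ : ℂ => faceFactor Λ L b I (τ • ξ)) 0 := by
  refine MeromorphicAt.fun_div ?_ ?_
  · exact (analyticAt_expInt_smul (adm_subspaceMeasure hL) h.isDualPair_face.bddSupp_boxFun
      (ξ.comp L.subtypeL) 0).meromorphicAt
  · exact (Finset.analyticAt_fun_prod _ fun (j : {j // j ∈ I}) _ =>
      analyticAt_one_sub_exp_smul ξ (b j) 0).meromorphicAt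

/-! ### Polynomial dependence on s inside an alcove -/

lemma const_mem_polyFun (z : ℂ) : (fun _ => z) ∈ polyFun V :=
  (polyFun V).algebraMap_mem z

lemma ofReal_mem_polyFun (η : Dual ℝ V) : (fun s => (η s : ℂ)) ∈ polyFun V :=
  Algebra.subset_adjoin ⟨Complex.ofRealCLM.comp (LinearMap.toContinuousLinearMap η), rfl⟩

lemma coe_mem_polyFun (ξ : DualC V) : (fun s => ξ s) ∈ polyFun V :=
  Algebra.subset_adjoin ⟨ξ, rfl⟩

/-- The image of an alcove under η is an interval without integers. -/
lemma exists_ceil_eq {Ψ : Set (Dual ℝ V)} {a : Set V} (ha : IsAlcove Ψ a) {η : Dual ℝ V}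
    (hη : η ∈ Ψ) : ∃ n : ℤ, ∀ s ∈ a, ⌈η s⌉ = n := by
  obtain ⟨x, hx, rfl⟩ := ha
  refine ⟨⌈η x⌉, fun s hs => ?_⟩
  have hpre : (η '' connectedComponentIn (alcoveDomain Ψ) x).OrdConnected :=
    (isPreconnected_connectedComponentIn.image η
      η.continuous_of_finiteDimensional.continuousOn).ordConnected
  have hxm := mem_connectedComponentIn hx
  have hno : ∀ n : ℤ, (n : ℝ) ∉ η '' connectedComponentIn (alcoveDomain Ψ) x := by
    rintro n ⟨y, hy, hyn⟩
    exact connectedComponentIn_subset _ _ hy η hη n hyn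
  have key : ∀ y z, y ∈ connectedComponentIn (alcoveDomain Ψ) x →
      z ∈ connectedComponentIn (alcoveDomain Ψ) x → ⌈η y⌉ ≤ ⌈η z⌉ := by
    intro y z hy hz
    by_contra! hlt
    exact hno ⌈η z⌉ (hpre.out ⟨z, hz, rfl⟩ ⟨y, hy, rfl⟩
      ⟨Int.le_ceil _, (Int.lt_ceil.1 hlt).le⟩)
  exact le_antisymm (key s x hs hxm) (key x s hxm hs)

lemma exists_polyFun_ceilShift {Ψ : Set (Dual ℝ V)} {a : Set V} (ha : IsAlcove Ψ a)
    (σ : (V ⧸ L) →ₗ[ℝ] V) {u : Basis κ ℝ (V ⧸ L)} (hu : ∀ j, u.coord j ∘ₗ L.mkQ ∈ Ψ)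
    (ξ : DualC V) : ∃ p ∈ polyFun V, ∀ s ∈ a, ξ (ceilShift σ u s) = p s := by
  choose n hn using fun j => exists_ceil_eq ha (hu j)
  refine ⟨∑ j, ((fun _ => (n j : ℂ)) - fun s => (((u.coord j ∘ₗ L.mkQ) s : ℝ) : ℂ)) *
    fun _ => ξ (σ (u j)), ?_, fun s hs => ?_⟩
  · exact Subalgebra.sum_mem _ fun j _ => Subalgebra.mul_mem _
      (Subalgebra.sub_mem _ (const_mem_polyFun _) (ofReal_mem_polyFun _)) (const_mem_polyFun _)
  · rw [ceilShift, map_sum, map_sum, Finset.sum_apply]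
    refine Finset.sum_congr rfl fun j _ => ?_
    have h1 : ⌈u.coord j (L.mkQ s)⌉ = n j := hn j s hs
    rw [map_smul, map_smul, h1, Complex.real_smul]
    simp

theorem exists_regFun_eq_sum (hL : IsRationalSubspace Λ L) {c : Set V} {l : List V}
    (hl : ∀ w ∈ l, w ∈ Λ ∧ w ≠ 0) (hb : BddSupp (diffOp l (indC c))) {Ψ : Set (Dual ℝ V)}
    (hΨ : IsPsi Λ L c Ψ) :
    ∃ (Q : Type) (_ : Fintype Q) (ws : Finset V) (A : Q → V → V) (R : Q → DualC V → ℂ),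
      (∀ w ∈ ws, w ≠ 0) ∧ (∀ q ξ, MeromorphicAt (fun τ : ℂ => R q (τ • ξ)) 0) ∧
      (∀ a, IsAlcove Ψ a → ∀ q (ξ : DualC V), ∃ p ∈ polyFun V, ∀ s ∈ a, ξ (A q s) = p s) ∧
      ∀ ξ, (∀ w ∈ ws, Complex.exp (ξ w) ≠ 1) → ∀ s,
        regFun Λ L c l s ξ = ∑ q, Complex.exp (ξ (A q s)) * R q ξ := by
  classical
  obtain ⟨n, ε, b, k, δ, u, hbΛ, hface, hcongr, hu, hcongr', rfl⟩ := hΨ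
  choose I hI using hface
  choose σ hσ using fun i => exists_isFaceSection (hI i)
  choose ws hws hext using fun i => (hσ i).exists_isExt_basisCone hL (hbΛ i) (hu i) (hcongr' i)
  obtain ⟨ws', hws', hext'⟩ := hcongr.exists_isExt (IsZLattice.span_top (K := ℝ) (L := Λ))
  refine ⟨Σ i, Fin (k i), inferInstance, l.toFinset ∪ Finset.univ.biUnion ws ∪ ws',
    fun q => ceilShift (σ q.1) (u q.1 q.2),
    fun q ξ => ((ε q.1 : ℤ) : ℂ) * (((δ q.1 q.2 : ℤ) : ℂ) * (faceFactor Λ L (b q.1) (I q.1) ξ /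
      ∏ j, (1 - Complex.exp (ξ (σ q.1 (u q.1 q.2 j)))))), ?_, ?_, ?_, ?_⟩
  · intro w hw
    rcases Finset.mem_union.1 hw with hw | hw
    · rcases Finset.mem_union.1 hw with hw | hw
      · exact (hl w (List.mem_toFinset.1 hw)).2
      · obtain ⟨i, -, hi⟩ := Finset.mem_biUnion.1 hw
        exact hws i w hi
    · exact hws' w hw
  · intro q ξ
    refine (MeromorphicAt.const _ _).fun_mul ((MeromorphicAt.const _ _).fun_mul
      (((hσ q.1).meromorphicAt_faceFactor hL ξ).fun_div ?_))
    exact (Finset.analyticAt_fun_prod _ fun j _ =>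
      analyticAt_one_sub_exp_smul ξ (σ q.1 (u q.1 q.2 j)) 0).meromorphicAt
  · exact fun a ha q ξ => exists_polyFun_ceilShift ha (σ q.1) (fun j => ⟨q.1, q.2, j, rfl⟩) ξ
  · intro ξ hξ s
    have hμ := adm_sliceMeasure (Λ := Λ) hL s
    have hξl : ∀ w ∈ l, Complex.exp (ξ w) ≠ 1 := fun w hw => hξ w
      (Finset.mem_union_left _ (Finset.mem_union_left _ (List.mem_toFinset.2 hw)))
    have h1 := hext' ξ (fun w hw => hξ w (Finset.mem_union_right _ hw)) _ hμ _ fun i =>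
      hext i ξ (fun w hw => hξ w (Finset.mem_union_left _ (Finset.mem_union_right _
        (Finset.mem_biUnion.2 ⟨i, Finset.mem_univ i, hw⟩)))) s
    -- The quotient defining `regFun` is a regularized value by construction, so uniqueness equates
    -- it with the value computed from the decomposition.
    have h2 : IsExt Λ (sliceMeasure Λ L s) ξ (indC c) (regFun Λ L c l s ξ) :=
      ⟨l, fun w hw => ⟨(hl w hw).1, hξl w hw⟩, hb,
        by rw [regFun, mul_div_cancel₀ _ (expDen_ne_zero hξl)]⟩
    rw [h2.unique hμ h1, Fintype.sum_sigma]
    refine Finset.sum_congr rfl fun i _ => ?_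
    rw [Finset.mul_sum]
    refine Finset.sum_congr rfl fun j _ => ?_
    ring

end Formula

/-! ### Polynomiality on alcoves -/

section Alcoves

variable {V : Type*} [NormedAddCommGroup V] [NormedSpace ℝ V] [FiniteDimensional ℝ V]
  [MeasurableSpace V] [BorelSpace V] {Λ : Submodule ℤ V} [DiscreteTopology Λ]
  [IsZLattice ℝ Λ] {L : Submodule ℝ V}

lemma hasSum_exp_smul_apply (ξ : DualC V) (x : V) (τ : ℂ) :
    HasSum (fun k : ℕ => τ ^ k * ((k.factorial : ℂ)⁻¹ * ξ x ^ k)) (Complex.exp ((τ • ξ) x)) := by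
  have h := NormedSpace.expSeries_div_hasSum_exp ((τ • ξ) x)
  rw [← Complex.exp_eq_exp_ℂ] at h
  refine hasSum_of_eq h fun k => ?_
  change _ = (τ * ξ x) ^ k / _
  rw [mul_pow]
  ring

/-- On the alcove, the exponents ⟨ξ, T s + A_q(s)⟩ are polynomial in s, and each Laurent coefficient
involves only finitely many of their powers. The map T treats M (T = 0) and S (T = id) together. -/
lemma exists_polyFun_homComp (hL : IsRationalSubspace Λ L) {c : Set V} {l : List V}
    (hl : ∀ w ∈ l, w ∈ Λ ∧ w ≠ 0) (hb : BddSupp (diffOp l (indC c))) {Ψ : Set (Dual ℝ V)}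
    (hΨ : IsPsi Λ L c Ψ) {a : Set V} (ha : IsAlcove Ψ a) {T : V → V}
    (hT : ∀ ξ : DualC V, (fun s => ξ (T s)) ∈ polyFun V) (m : ℤ) :
    ∃ ws : Finset V, (∀ w ∈ ws, w ≠ 0) ∧ ∀ ξ : DualC V, (∀ w ∈ ws, ξ w ≠ 0) →
      ∃ p ∈ polyFun V, ∀ s ∈ a, homComp ((fun ξ => Complex.exp (ξ (T s)) * regFun Λ L c l s ξ :
        DualC V → ℂ) : GenGerm V) m ξ = p s := by
  classical
  obtain ⟨Q, _, ws, A, R, hws, hR, hA, hsum⟩ := exists_regFun_eq_sum hL hl hb hΨ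
  refine ⟨l.toFinset ∪ ws, fun w hw => ?_, fun ξ hξ => ?_⟩
  · rcases Finset.mem_union.1 hw with hw | hw
    exacts [(hl w (List.mem_toFinset.1 hw)).2, hws w hw]
  choose r hr using fun q => exists_hasLaurent (hR q ξ)
  choose j₀ hj₀ using fun q => (hr q).1
  choose p hp hpA using fun q => hA a ha q ξ
  refine ⟨∑ q, ∑ k ∈ Finset.range (m - j₀ q + 1).toNat, ((fun _ => (k.factorial : ℂ)⁻¹) *
    ((fun s => ξ (T s)) + p q) ^ k) * fun _ => r q (m - k), ?_, fun s hs => ?_⟩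
  · exact Subalgebra.sum_mem _ fun q _ => Subalgebra.sum_mem _ fun k _ => Subalgebra.mul_mem _
      (Subalgebra.mul_mem _ (const_mem_polyFun _)
        (Subalgebra.pow_mem _ (Subalgebra.add_mem _ (hT ξ) (hp q)) k)) (const_mem_polyFun _)
  have hμ := adm_sliceMeasure (Λ := Λ) hL s
  have h1 := HasLaurent.sum Finset.univ fun q (_ : q ∈ Finset.univ) =>
    HasLaurent.powerSeries_mul (hasSum_exp_smul_apply ξ (T s + A q s)) (hj₀ q) (hr q)
  have h2 : ∀ᶠ τ : ℂ in 𝓝[≠] 0, ∀ w ∈ ws, Complex.exp ((τ • ξ) w) ≠ 1 :=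
    (Filter.eventually_all_finset ws).2 fun w hw =>
      eventually_exp_smul_ne_one (hξ w (Finset.mem_union_right _ hw))
  have h3 := h1.congr (g := fun τ : ℂ => (Complex.exp ((τ • ξ) (T s)) *
      expInt (sliceMeasure Λ L s) (τ • ξ) (diffOp l (indC c))) / expDen l (τ • ξ)) (by
    filter_upwards [h2] with τ hτ
    have h4 := hsum (τ • ξ) hτ s
    rw [regFun] at h4
    rw [mul_div_assoc, h4, Finset.mul_sum]
    refine Finset.sum_congr rfl fun q _ => ?_
    rw [map_add, Complex.exp_add, mul_assoc])
  have h5 := homComp_div_expDen ((analyticAt_exp_apply (T s) 0).mul (hb.analyticAt_expInt hμ 0))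
    (fun w hw => hξ w (Finset.mem_union_left _ (List.mem_toFinset.2 hw))) h3 m
  have h6 : (fun ξ => Complex.exp (ξ (T s)) * regFun Λ L c l s ξ : DualC V → ℂ) = fun ξ =>
      (Complex.exp (ξ (T s)) * expInt (sliceMeasure Λ L s) ξ (diffOp l (indC c))) /
        expDen l ξ := by
    funext ξ
    rw [regFun, mul_div_assoc]
  rw [h6]
  refine h5.trans ?_
  simp only [Finset.sum_apply, Pi.mul_apply, Pi.pow_apply, Pi.add_apply, hpA _ s hs, map_add]

theorem isPolynomialOn_homComp (hL : IsRationalSubspace Λ L) {c : Set V}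
    (hc : IsRationalCone Λ c) {N : ℕ} {v : Fin N → V} (hv : ∀ j, v j ≠ 0)
    (hhol : ∀ s : V, HolomorphicAfterMul v (SL Λ L c s)) (m : ℤ) {Ψ : Set (Dual ℝ V)}
    (hΨ : IsPsi Λ L c Ψ) {a : Set V} (ha : IsAlcove Ψ a) :
    IsPolynomialOn a (fracSpace v (m + N)) (fun s ξ => homComp (ML Λ L c s) m ξ.1) ∧
      IsPolynomialOn a (fracSpace v (m + N)) (fun s ξ => homComp (SL Λ L c s) m ξ.1) := by
  by_cases hline : ContainsLine c
  · have h0 : ∀ s, SL Λ L c s = 0 := SL_eq_zero hline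
    have h1 : ∀ s, ML Λ L c s = 0 := fun s => by rw [ML, h0, mul_zero]
    constructor
    · refine isPolynomialOn_of_generic hv (ws := ∅) (by simp)
        (fun s => homComp_mem_fracSpace (hhol s).ML m) fun ξ _ =>
        ⟨_, const_mem_polyFun (homComp 0 m ξ.1), fun s _ => by rw [h1]⟩
    · refine isPolynomialOn_of_generic hv (ws := ∅) (by simp)
        (fun s => homComp_mem_fracSpace (hhol s) m) fun ξ _ =>
        ⟨_, const_mem_polyFun (homComp 0 m ξ.1), fun s _ => by rw [h0]⟩
  obtain ⟨n, η, hη, rfl⟩ := hc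
  change ¬ ContainsLine (coneOf η) at hline
  obtain ⟨l, hl, hb⟩ := exists_list_bddSupp (IsZLattice.span_top (K := ℝ) (L := Λ)) hη
  constructor
  · obtain ⟨ws, hws, h⟩ := exists_polyFun_homComp hL hl hb hΨ ha (T := fun _ => 0)
      (fun ξ => by simpa using const_mem_polyFun 0) m
    refine isPolynomialOn_of_generic hv hws (fun s => homComp_mem_fracSpace (hhol s).ML m)
      fun ξ hξ => ?_
    obtain ⟨p, hp, hpa⟩ := h ξ.1 hξ
    refine ⟨p, hp, fun s hs => ?_⟩
    rw [← hpa s hs]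
    have h1 := ML_eq hL hline hl hb s
    change homComp (ML Λ L (coneOf η) s) m ξ.1 = _
    rw [h1]
    simp only [map_zero, Complex.exp_zero, one_mul]
  · obtain ⟨ws, hws, h⟩ := exists_polyFun_homComp hL hl hb hΨ ha (T := id)
      (fun ξ => coe_mem_polyFun ξ) m
    refine isPolynomialOn_of_generic hv hws (fun s => homComp_mem_fracSpace (hhol s) m)
      fun ξ hξ => ?_
    obtain ⟨p, hp, hpa⟩ := h ξ.1 hξ
    refine ⟨p, hp, fun s hs => ?_⟩
    rw [← hpa s hs]
    change homComp (SL Λ L (coneOf η) s) m ξ.1 = _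
    rw [SL_eq hL hline hl hb s]
    rfl

end Alcoves

end IntermediateSum

end

theorem mainTheorem5 {V : Type*} [NormedAddCommGroup V] [NormedSpace ℝ V] [FiniteDimensional ℝ V]
    [MeasurableSpace V] [BorelSpace V]
    (Λ : Submodule ℤ V) [DiscreteTopology Λ] [IsZLattice ℝ Λ]
    (L : Submodule ℝ V) (hL : IntermediateSum.IsRationalSubspace Λ L)
    (c : Set V) (hc : IntermediateSum.IsRationalCone Λ c) (hfull : (interior c).Nonempty)
    {N : ℕ} (v : Fin N → V) (hv : ∀ j, v j ≠ 0)
    (hhol : ∀ s : V, IntermediateSum.HolomorphicAfterMul v (IntermediateSum.SL Λ L c s))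
    (m : ℤ) :
    FiniteDimensional ℂ (IntermediateSum.fracSpace v (m + N)) ∧
    (∀ (Ψ : Set (Module.Dual ℝ V)), IntermediateSum.IsPsi Λ L c Ψ →
      ∀ a : Set V, IntermediateSum.IsAlcove Ψ a →
        IntermediateSum.IsPolynomialOn a (IntermediateSum.fracSpace v (m + N))
          (fun s ξ => IntermediateSum.homComp (IntermediateSum.ML Λ L c s) m ξ.1) ∧
        IntermediateSum.IsPolynomialOn a (IntermediateSum.fracSpace v (m + N))
          (fun s ξ => IntermediateSum.homComp (IntermediateSum.SL Λ L c s) m ξ.1)) ∧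
    (∀ s : V, ∀ x ∈ (L : Set V) - c, ∀ ξ : IntermediateSum.DualC V, (∀ j, ξ (v j) ≠ 0) →
      Tendsto (fun t : ℝ => IntermediateSum.homComp (IntermediateSum.ML Λ L c (s + t • x)) m ξ)
        (𝓝[>] 0) (𝓝 (IntermediateSum.homComp (IntermediateSum.ML Λ L c s) m ξ))) := by
  exact ⟨inferInstance,
    fun Ψ hΨ a ha => IntermediateSum.isPolynomialOn_homComp hL hc hv hhol m hΨ ha,
    fun s x hx ξ hξ => IntermediateSum.tendsto_homComp_ML hL hc hv hhol m s hx hξ⟩
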